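/- **Setting.** Let $d\ge 1$, $\alpha>1/2$, let $\gamma=(\gamma_1,\gamma_2,\dots)$ be positive weights and $t\in(0,1)$. For $k\in\mathbb Z^d$ put $r(k)=r_{\alpha,\gamma}(k)=\prod_{j=1}^d\max\{1,|k_j|^\alpha/\gamma_j\}$. For $k\in\mathbb Z_+^d$ let $|k|_0$ be the number of nonzero entries, $\phi_k(x)=\sqrt2^{\,|k|_0}\prod_j\cos(\pi k_jx_j)$ and $\lambda_k=\pi^2\sum_jk_j^2$. The half-period cosine space $\mathcal C_{d,\alpha,\gamma}$ consists of the functions $f:[0,1]^d\to\mathbb R$ that are the uniform sum of their cosine series $\sum_k\widetilde f(k)\phi_k$, $\widetilde f(k)=\int_{[0,1]^d} f\phi_k$, with $\|f\|^2_{\mathcal C_{d,\alpha,\gamma}}=\sum_k|\widetilde f(k)|^2r(k)^2<\infty$. **Lattice and frequencies.** For a prime $N$ let $$M=\sup_{1/\alpha<q\le2}\Bigl(\tfrac N2\prod_{j=1}^d(1+2\gamma_j^q\zeta(\alpha q))^{-1}\Bigr)^{1/q},\quad A=\{k\in\mathbb Z^d:r(k)<M\},\quad A^+=\{k\in\mathbb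 Z_+^d:r(k)<M\}.$$ Let $g\in\mathbb Z^d$ be produced by the component-by-component construction: $g_1=1$, and for $s=2,\dots,d$ the entry $g_s$ minimizes $P_{\alpha,\gamma,N}(g_1,\dots,g_s)=\sum_{0\ne k\in\mathbb Z^s,\;k\cdot g\equiv0\,(N)}r_{\alpha,\gamma}(k)^{-2}$ over $\{1,\dots,N-1\}$ (ties broken in any way); if $\alpha\ge1$, the construction may also be run with $(\lfloor\alpha\rfloor,(\gamma_j^{\lfloor\alpha\rfloor/\alpha})_j)$ in place of $(\alpha,\gamma)$. The fiber of $l$ is $\Gamma(l)=\{k\in A:k\cdot g\equiv l\cdot g\ (\mathrm{mod}\ N)\}$, $R=\max_{l\in A}|\Gamma(l)|$, and $\mathcal H$ is the set of the nonzero differences of two elements of a common fiber. **Shifts.** The shifts $y_1,\dots,y_S$ and their number $S$ are determined as follows. If $R=1$ or $\mathcal H=\emptyset$, then $S=1$, $y_1=0$. Otherwise: * Construct $z\in\mathbb Z^d$ entry by entry: $z_j$ is the first element of $0,1,-1,\dots,\lceil|\mathcal H_j|/2\rceil,-\lceil|\mathcal H_j|/2\rceil$ that differs from $-\frac1{h_j}\sum_{l<j}h_lz_l$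 for all $h\in\mathcal H_j$, the set of the $h\in\mathcal H$ whose last nonzero entry is the $j$-th. Put $V=\max_{h\in\mathcal H}|h\cdot z|$. * For a list of primes $q_1,\dots,q_m$ let $Y(q_1,\dots,q_m)$ be the union, with multiplicity, of the sets $\{\{iz/q_j\}:0\le i<q_j\}$ ($\{\cdot\}$ is the componentwise fractional part). The initial shift set is $Y(p_1,\dots,p_k)$, where $p_1$ is the smallest prime $\ge 2(R-1)\ln V/(0.32\,t)$ and $p_1<\dots<p_k$ are consecutive primes, $k=\max\{1,\lceil 2(R-1)\ln V/(t\ln p_1)\rceil\}$. * Run through the primes $p\ge R$ in increasing order as long as $p$ is smaller than the size of the current shift set. (a) If the set $\{p^{-1}(s,s^2,\dots,s^d)\bmod1:0\le s<p\}$ satisfies $|\sum_{s}e^{2\pi ih\cdot y_s}|\le tp/(R-1)$ for all $h\in\mathcal H$, take it and stop. (b) Otherwise, if $p\ge\lfloor(\gamma_1M)^{1/\alpha}\rfloor\lfloor(\gamma_2M)^{1/\alpha}\rfloor/N$ and $p\nmid h\cdot z$ for all $h\in\mathcal H$, take $Y(p)$ and stop. (c) Otherwise, unless (c) has succeeded before,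 append $p$ to a list $Q$ (initially empty); (c) succeeds if $\sum_{q\in Q,\,q\mid h\cdot z}q\le\frac t{R-1}\sum_{q\in Q}q$ for all $h\in\mathcal H$, and then $Y(Q)$ replaces the current set if it is smaller. The current set at the end is the output. The total number of function evaluations is $N_{tot}=NS$. **Numerical solution.** For $\Delta\in[0,1]^d$, $\psi(z)=(1-|2z_j-1|)_j$ and a fiber $\{l_1,\dots,l_v\}$ put $B=(e^{2\pi il_m\cdot y_s})_{s,m}\in\mathbb C^{S\times v}$, $D(\Delta)=\mathrm{diag}(e^{2\pi il_m\cdot\Delta})_m$, and $b_s(\Delta)=\frac1N\sum_{n=0}^{N-1}f(\psi(\{ng/N+y_s+\Delta\}))\,e^{-2\pi il_1\cdot ng/N}$. The recovered Fourier coefficients $(\widehat c_{l_1},\dots,\widehat c_{l_v})^\top=D(-\Delta)(B^HB)^{-1}B^Hb(\Delta)$ give the cosine coefficients $\widetilde c_k=2^{-|k|_0/2}\sum_{|h|=k}\widehat c_h$ for $k\in A^+$, where $|h|=(|h_1|,\dots,|h_d|)$. For the Neumann problem $\nabla^2u=f$ in $(0,1)^d$, $\partial u/\partial n=0$ on the boundary,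 and a solution $u$ with known mean $\widehat u(0)=\int_{[0,1]^d}u$, the numerical solution is $$\widetilde u_\Delta(x)=\widehat u(0)-\sum_{k\in A^+\setminus\{0\}}\frac{\widetilde c_k}{\lambda_k}\phi_k(x).$$ **Theorem 7.3 (Convergence of the PDE solution).** For all $d,\alpha,\gamma,t$ as above and every $\tau\in(0,1]$ there are constants $C,C'>0$, depending only on $d,\alpha,\gamma,t,\tau$, such that for every prime $N$, every generating vector $g$ as above, every $f\in\mathcal C_{d,\alpha,\gamma}$ and every weak solution $u\in H^1((0,1)^d)$ of the Neumann problem (that is, $\int\nabla u\cdot\nabla v=-\int fv$ for all $v$ that are smooth up to the boundary), the following holds. With $\Delta$ uniformly distributed on $[0,1]^d$, $\sqrt{\mathbb E_\Delta\|u-\widetilde u_\Delta\|_2^2}$ is at most each of $$\frac{C}{\pi^2}(\log N)^{(d-1)/2}N^{-\alpha+\tau}\,\|f\|_{\mathcal C_{d,\alpha,\gamma}},\qquad \frac{C'}{\pi^2}(\log N_{tot})^{(2\alpha-2\tau+1/2)d-1/2}N_{tot}^{-\alpha+\tau}\,\|f\|_{\mathcal C_{d,\alpha,\gamma}},$$ and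 for the deterministic method ($\Delta=0$) $\|u-\widetilde u_0\|_{L_\infty}$ is at most each of $$\frac{C}{\pi^2}(\log N)^{(d-1)/2}N^{-\alpha+1/2+\tau}\,\|f\|_{\mathcal C_{d,\alpha,\gamma}},\qquad \frac{C'}{\pi^2}(\log N_{tot})^{(2\alpha-2\tau-1/2)d-1/2}N_{tot}^{-\alpha+1/2+\tau}\,\|f\|_{\mathcal C_{d,\alpha,\gamma}}.$$ Moreover, if $\tau\le\alpha$ in the first case, and if $\tau\le\alpha-1/2$ in the second, the bound in $N$ is at most the bound in $N_{tot}$. -/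

import Mathlib

open MeasureTheory
open scoped ContDiff

namespace LatticeNeumann

noncomputable section

open scoped Classical in
/-- The elements of a finite set `s`, as a `Finset` (used only for sets that are proved finite
below). -/
def finsetOf {ι : Type*} (s : Set ι) : Finset ι :=
  if h : s.Finite then h.toFinset else ∅

/-! ### Weights, hyperbolic cross, truncation parameter -/

/-- `r_{α,γ}(k) = ∏_j max {1, |k_j|^α / γ_j}`. The weights form a sequence `γ 0, γ 1, …`. -/
def rWeight {d : ℕ} (α : ℝ) (γ : ℕ → ℝ) (k : Fin d → ℤ) : ℝ :=
  ∏ j : Fin d, max 1 (|(k j : ℝ)| ^ α / γ j)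

/-- The hyperbolic cross `A_{α,γ,M} = {k ∈ ℤ^d : r_{α,γ}(k) < M}`. -/
def crossSet (d : ℕ) (α : ℝ) (γ : ℕ → ℝ) (M : ℝ) : Set (Fin d → ℤ) :=
  {k | rWeight α γ k < M}

/-- The nonnegative part `A⁺_{α,γ,M} = {k ∈ ℤ_+^d : r_{α,γ}(k) < M}`. -/
def crossSetPlus (d : ℕ) (α : ℝ) (γ : ℕ → ℝ) (M : ℝ) : Set (Fin d → ℕ) :=
  {k | rWeight α γ (fun j => (k j : ℤ)) < M}

theorem crossSet_finite (d : ℕ) {α : ℝ} (hα : 0 < α) {γ : ℕ → ℝ} (hγ : ∀ j, 0 < γ j) (M : ℝ) :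
    (crossSet d α γ M).Finite := by
  have hbox : (Set.univ.pi fun j : Fin d =>
      Set.Icc (-⌈(γ j * M) ^ α⁻¹⌉) ⌈(γ j * M) ^ α⁻¹⌉).Finite :=
    Set.Finite.pi fun j => Set.finite_Icc _ _
  refine hbox.subset ?_
  intro k hk j _
  have h1 : max 1 (|(k j : ℝ)| ^ α / γ j) < M := by
    refine lt_of_le_of_lt ?_ hk
    have := Finset.prod_le_prod_of_subset_of_one_le (s := {j}) (t := Finset.univ)
      (f := fun j : Fin d => max 1 (|(k j : ℝ)| ^ α / γ j))
      (Finset.subset_univ _) (fun i _ => le_trans zero_le_one (le_max_left _ _))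
      (fun i _ _ => le_max_left _ _)
    rwa [Finset.prod_singleton] at this
  have h2 : |(k j : ℝ)| ^ α < γ j * M := by
    have := lt_of_le_of_lt (le_max_right _ _) h1
    rwa [div_lt_iff₀ (hγ j), mul_comm] at this
  have h3 : |(k j : ℝ)| ≤ (γ j * M) ^ α⁻¹ := by
    rw [Real.le_rpow_inv_iff_of_pos (abs_nonneg _)
      (le_trans (Real.rpow_nonneg (abs_nonneg _) _) h2.le) hα]
    exact h2.le
  have h4 : |k j| ≤ ⌈(γ j * M) ^ α⁻¹⌉ := by
    have : ((|k j| : ℤ) : ℝ) ≤ (⌈(γ j * M) ^ α⁻¹⌉ : ℤ) := by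
      push_cast
      exact h3.trans (Int.le_ceil _)
    exact_mod_cast this
  exact ⟨(abs_le.mp h4).1, (abs_le.mp h4).2⟩

theorem crossSetPlus_finite (d : ℕ) {α : ℝ} (hα : 0 < α) {γ : ℕ → ℝ} (hγ : ∀ j, 0 < γ j)
    (M : ℝ) : (crossSetPlus d α γ M).Finite := by
  have hinj : Function.Injective fun (k : Fin d → ℕ) (j : Fin d) => (k j : ℤ) := by
    intro k l h
    funext j
    exact Int.ofNat.inj (congrFun h j)
  exact (crossSet_finite d hα hγ M).preimage hinj.injOn

def cross (d : ℕ) (α : ℝ) (γ : ℕ → ℝ) (M : ℝ) : Finset (Fin d → ℤ) :=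
  finsetOf (crossSet d α γ M)

def crossPlus (d : ℕ) (α : ℝ) (γ : ℕ → ℝ) (M : ℝ) : Finset (Fin d → ℕ) :=
  finsetOf (crossSetPlus d α γ M)

theorem mem_cross {d : ℕ} {α : ℝ} (hα : 0 < α) {γ : ℕ → ℝ} (hγ : ∀ j, 0 < γ j) {M : ℝ}
    {k : Fin d → ℤ} : k ∈ cross d α γ M ↔ rWeight α γ k < M := by
  rw [cross, finsetOf, dif_pos (crossSet_finite d hα hγ M), Set.Finite.mem_toFinset]
  rfl

theorem mem_crossPlus {d : ℕ} {α : ℝ} (hα : 0 < α) {γ : ℕ → ℝ} (hγ : ∀ j, 0 < γ j) {M : ℝ}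
    {k : Fin d → ℕ} : k ∈ crossPlus d α γ M ↔ rWeight α γ (fun j => (k j : ℤ)) < M := by
  rw [crossPlus, finsetOf, dif_pos (crossSetPlus_finite d hα hγ M), Set.Finite.mem_toFinset]
  rfl

/-- `M = sup_{1/α < q ≤ 2} (N/2 ∏_j (1 + 2 γ_j^q ζ(α q))⁻¹)^{1/q}`. -/
def truncM (d : ℕ) (α : ℝ) (γ : ℕ → ℝ) (N : ℕ) : ℝ :=
  sSup ((fun q : ℝ =>
    ((N : ℝ) / 2 * ∏ j : Fin d,
      (1 + 2 * γ j ^ q * (riemannZeta ((α * q : ℝ) : ℂ)).re)⁻¹) ^ (1 / q)) '' Set.Ioc (1 / α) 2)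

/-! ### Generating vector -/

/-- `k · g` for integer vectors. -/
def idot {d : ℕ} (k z : Fin d → ℤ) : ℤ := ∑ j, k j * z j

/-- `k · x` for an integer frequency `k` and a real point `x`. -/
def rdot {d : ℕ} (k : Fin d → ℤ) (x : Fin d → ℝ) : ℝ := ∑ j, (k j : ℝ) * x j

/-- `P_{α,γ,N}(g) = ∑ r_{α,γ}(k)⁻²` over the nonzero `k` with `k · g ≡ 0 (mod N)`. -/
def PError {s : ℕ} (α : ℝ) (γ : ℕ → ℝ) (N : ℕ) (g : Fin s → ℤ) : ℝ :=
  ∑' k : {k : Fin s → ℤ // k ≠ 0 ∧ idot k g ≡ 0 [ZMOD N]}, 1 / rWeight α γ k.1 ^ 2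

/-- The vector `(g_0, …, g_{s-1}, x)`, the first `s` entries being those of `g`. -/
def extendPrefix {d : ℕ} (g : Fin d → ℤ) (s : Fin d) (x : ℤ) :
    Fin ((s : ℕ) + 1) → ℤ :=
  fun i => if h : (i : ℕ) < s then g ⟨i, h.trans s.2⟩ else x

/-- `g` is a possible output of the component-by-component construction (ties in the
minimization may be broken in any way): the first entry is `1` and each later entry minimizes
`P` over `{1, …, N-1}`, the earlier entries being kept fixed. -/
def IsCBC {d : ℕ} (α : ℝ) (γ : ℕ → ℝ) (N : ℕ) (g : Fin d → ℤ) : Prop :=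
  (∀ s : Fin d, (s : ℕ) = 0 → g s = 1) ∧
  ∀ s : Fin d, (s : ℕ) ≠ 0 →
    g s ∈ Finset.Icc (1 : ℤ) (N - 1) ∧
    ∀ x ∈ Finset.Icc (1 : ℤ) (N - 1),
      PError α γ N (extendPrefix g s (g s)) ≤ PError α γ N (extendPrefix g s x)

/-- Admissible generating vectors: the construction is run with `P_{α,γ,N}` itself or, if
`α ≥ 1`, with the integer smoothness `⌊α⌋` and the weights `γ_j^{⌊α⌋/α}`, for which `P` has a
closed form (for integer `α` the two coincide). -/
def IsGeneratingVector {d : ℕ} (α : ℝ) (γ : ℕ → ℝ) (N : ℕ) (g : Fin d → ℤ) : Prop :=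
  IsCBC α γ N g ∨
    (1 ≤ α ∧ IsCBC (⌊α⌋ : ℝ) (fun j => γ j ^ ((⌊α⌋ : ℝ) / α)) N g)

/-! ### Fibers -/

/-- The fiber of `l`: all frequencies of `A` that alias with `l`. -/
def fiber {d : ℕ} (A : Finset (Fin d → ℤ)) (N : ℕ) (g l : Fin d → ℤ) : Finset (Fin d → ℤ) :=
  A.filter fun k => idot k g ≡ idot l g [ZMOD N]

/-- The maximum fiber length `R`. -/
def maxFiber {d : ℕ} (A : Finset (Fin d → ℤ)) (N : ℕ) (g : Fin d → ℤ) : ℕ :=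
  A.sup fun l => (fiber A N g l).card

/-- `H \ {0}`: the nonzero differences of two frequencies in a common fiber. -/
def diffSet {d : ℕ} (A : Finset (Fin d → ℤ)) (N : ℕ) (g : Fin d → ℤ) : Finset (Fin d → ℤ) :=
  (A.biUnion fun l => (fiber A N g l ×ˢ fiber A N g l).image fun p => p.2 - p.1).erase 0

/-! ### Symmetric component-by-component construction of the projection vector -/

/-- The elements of `H` whose last nonzero entry has index `j`. -/
def activeSet {d : ℕ} (H : Finset (Fin d → ℤ)) (j : Fin d) : Finset (Fin d → ℤ) :=
  H.filter fun h => h j ≠ 0 ∧ ∀ i, j < i → h i = 0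

/-- The values that are forbidden for `z_j`, given `z_l` for `l < j`. -/
def forbidden {d : ℕ} (H : Finset (Fin d → ℤ)) (z : Fin d → ℤ) (j : Fin d) : Finset ℤ :=
  ((activeSet H j).filter fun h => h j ∣ ∑ l ∈ Finset.Iio j, h l * z l).image
    fun h => -(∑ l ∈ Finset.Iio j, h l * z l) / h j

/-- The list `0, 1, -1, …, ⌈n/2⌉, -⌈n/2⌉`. -/
def candidates (n : ℕ) : List ℤ :=
  0 :: (List.range ((n + 1) / 2)).flatMap fun i => [(i : ℤ) + 1, -((i : ℤ) + 1)]

/-- The projection vector: each entry in turn is the first candidate that is not forbidden. -/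
def projVec {d : ℕ} (H : Finset (Fin d → ℤ)) : Fin d → ℤ :=
  (List.finRange d).foldl
    (fun z j => Function.update z j
      (((candidates (activeSet H j).card).find? fun x => decide (x ∉ forbidden H z j)).getD 0))
    0

/-! ### Shifts -/

/-- `e(x) = exp(2 π i x)`. -/
def expi (x : ℝ) : ℂ := Complex.exp (2 * Real.pi * Complex.I * x)

/-- The polynomial shifts `p⁻¹ (s, s², …, s^d) mod 1`, `s = 0, …, p-1`. -/
def polyShifts (d p : ℕ) : List (Fin d → ℝ) :=
  (List.range p).map fun (s : ℕ) (j : Fin d) => Int.fract ((s : ℝ) ^ ((j : ℕ) + 1) / p)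

/-- The lattice shifts `{i z / p}`, `i = 0, …, p-1`. -/
def latticeShifts {d : ℕ} (z : Fin d → ℤ) (p : ℕ) : List (Fin d → ℝ) :=
  (List.range p).map fun (i : ℕ) (j : Fin d) => Int.fract ((i : ℝ) * z j / p)

/-- The union (counted with multiplicity) of the lattice shifts for the given primes. -/
def multiShifts {d : ℕ} (z : Fin d → ℤ) (ps : List ℕ) : List (Fin d → ℝ) :=
  ps.flatMap (latticeShifts z)

/-- `V = max_h |h · z|`. -/
def projBound {d : ℕ} (H : Finset (Fin d → ℤ)) (z : Fin d → ℤ) : ℕ :=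
  H.sup fun h => (idot h z).natAbs

/-- The smallest prime `p_1 ≥ 2 (R-1) ln V / (c t)`, where `c = 0.32`, is the prime with this
index (the primes being numbered from `0`). -/
def crtIndex (R V : ℕ) (t : ℝ) : ℕ :=
  Nat.primeCounting' ⌈2 * ((R : ℝ) - 1) * Real.log V / (0.32 * t)⌉₊

/-- The `k = ⌈2 (R-1) ln V / (t ln p_1)⌉` consecutive primes that start with `p_1`
(at least one of them, also if `V = 1`). -/
def crtPrimes (R V : ℕ) (t : ℝ) : List ℕ :=
  (List.range (max 1
    ⌈2 * ((R : ℝ) - 1) * Real.log V /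
      (t * Real.log (Nat.nth Nat.Prime (crtIndex R V t)))⌉₊)).map
    fun i => Nat.nth Nat.Prime (crtIndex R V t + i)

/-- State of the adaptive search: the best shift set so far (its length is `S_best`), the primes
of the greedy strategy, whether that strategy has succeeded, and whether the loop has ended. -/
structure SearchState (d : ℕ) where
  best : List (Fin d → ℝ)
  greedy : List ℕ
  greedyFound : Bool
  stopped : Bool

open scoped Classical in
/-- One pass, for the prime `p`, of the loop `while p < S_best`. -/
def searchPass {d : ℕ} (H : Finset (Fin d → ℤ)) (R : ℕ) (t pmin : ℝ) (z : Fin d → ℤ)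
    (σ : SearchState d) (p : ℕ) : SearchState d :=
  if σ.stopped = true ∨ σ.best.length ≤ p then { σ with stopped := true }
  -- polynomial strategy
  else if ∀ h ∈ H, ‖((polyShifts d p).map fun y => expi (rdot h y)).sum‖ ≤ t * p / ((R : ℝ) - 1)
    then { σ with best := polyShifts d p, stopped := true }
  -- single-lattice strategy
  else if pmin ≤ p ∧ ∀ h ∈ H, ¬ (p : ℤ) ∣ idot h z
    then { σ with best := latticeShifts z p, stopped := true }
  -- greedy multi-lattice strategy
  else if σ.greedyFound = true then σ
  else if ∀ h ∈ H,
      ((((σ.greedy ++ [p]).filter fun q : ℕ => decide ((q : ℤ) ∣ idot h z)).sum : ℕ) : ℝ) /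
        (((σ.greedy ++ [p]).sum : ℕ) : ℝ) ≤ t / ((R : ℝ) - 1)
    then
      { best := if (σ.greedy ++ [p]).sum < σ.best.length then multiShifts z (σ.greedy ++ [p])
          else σ.best
        greedy := σ.greedy ++ [p]
        greedyFound := true
        stopped := false }
  else { σ with greedy := σ.greedy ++ [p] }

/-- The adaptive deterministic shift construction. The loop runs through the primes `p ≥ R`; as
`S_best` never increases, only primes below its initial value can be reached. -/
def adaptiveShifts {d : ℕ} (H : Finset (Fin d → ℤ)) (R : ℕ) (t pmin : ℝ) :
    List (Fin d → ℝ) :=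
  if R = 1 ∨ H = ∅ then [0]
  else
    let z := projVec H
    let Y₀ := multiShifts z (crtPrimes R (projBound H z) t)
    (((List.range Y₀.length).filter fun p => decide (R ≤ p ∧ p.Prime)).foldl
      (searchPass H R t pmin z)
      { best := Y₀, greedy := [], greedyFound := false, stopped := false }).best

/-- The shifts for the lattice with `N` points and generating vector `g`. -/
def shifts {d : ℕ} (α : ℝ) (γ : ℕ → ℝ) (t : ℝ) (N : ℕ) (g : Fin d → ℤ) : List (Fin d → ℝ) :=
  let M := truncM d α γ N
  let A := cross d α γ M
  adaptiveShifts (diffSet A N g) (maxFiber A N g) t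
    ((⌊(γ 0 * M) ^ (1 / α)⌋ : ℝ) * (⌊(γ 1 * M) ^ (1 / α)⌋ : ℝ) / N)

/-- The total number of function evaluations `N_tot = N S`. -/
def Ntot {d : ℕ} (α : ℝ) (γ : ℕ → ℝ) (t : ℝ) (N : ℕ) (g : Fin d → ℤ) : ℕ :=
  N * (shifts α γ t N g).length

/-! ### Least-squares recovery of the Fourier coefficients -/

/-- The matrix `B` with entries `B_{s,m} = e(m · y_s)`, `m` running through the fiber `F`. -/
def sysMatrix {d : ℕ} (Y : List (Fin d → ℝ)) (F : Finset (Fin d → ℤ)) :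
    Matrix (Fin Y.length) F ℂ :=
  Matrix.of fun s m => expi (rdot m.1 (Y.get s))

/-- The observation
`b_s(Δ) = N⁻¹ ∑_{n<N} G({n g/N + y_s + Δ}) e(-l · n g/N)`. -/
def observation {d : ℕ} (G : (Fin d → ℝ) → ℂ) (N : ℕ) (g : Fin d → ℤ) (Y : List (Fin d → ℝ))
    (Δ : Fin d → ℝ) (l : Fin d → ℤ) (s : Fin Y.length) : ℂ :=
  (N : ℂ)⁻¹ * ∑ n ∈ Finset.range N,
    G (fun j => Int.fract ((n : ℝ) * g j / N + Y.get s j + Δ j)) *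
      expi (-(rdot l fun j => (n : ℝ) * g j / N))

/-- The recovered coefficient at `l`: the entry at `l` of `D(-Δ) (Bᴴ B)⁻¹ Bᴴ b(Δ)` for the fiber
of `l`. (`b(Δ)` is the same for all frequencies of a fiber, so that `l` may serve as the
representative.) It is `0` if `l` is not in `A`. -/
def coeffEst {d : ℕ} (A : Finset (Fin d → ℤ)) (G : (Fin d → ℝ) → ℂ) (N : ℕ) (g : Fin d → ℤ)
    (Y : List (Fin d → ℝ)) (Δ : Fin d → ℝ) (l : Fin d → ℤ) : ℂ :=
  let F := fiber A N g l
  let B := sysMatrix Y F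
  if h : l ∈ F then
    expi (-(rdot l Δ)) *
      ((B.conjTranspose * B)⁻¹.mulVec (B.conjTranspose.mulVec (observation G N g Y Δ l))) ⟨l, h⟩
  else 0

/-! ### Half-period cosine space -/

/-- The closed unit cube. -/
def cube (d : ℕ) : Set (Fin d → ℝ) := Set.Icc 0 1

/-- Number of nonzero entries. -/
def nnz {d : ℕ} (k : Fin d → ℕ) : ℕ := (Finset.univ.filter fun j => k j ≠ 0).card

/-- `φ_k(x) = √2^{|k|_0} ∏_j cos(π k_j x_j)`. -/
def cosBasis {d : ℕ} (k : Fin d → ℕ) (x : Fin d → ℝ) : ℝ :=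
  Real.sqrt 2 ^ nnz k * ∏ j, Real.cos (Real.pi * k j * x j)

/-- The cosine coefficients of `f`. -/
def cosCoeff {d : ℕ} (f : (Fin d → ℝ) → ℝ) (k : Fin d → ℕ) : ℝ :=
  ∫ x in cube d, f x * cosBasis k x

/-- `f` (a function on the unit cube; its values elsewhere are irrelevant) belongs to the weighted
half-period cosine space: it is the uniform sum of its cosine series and its norm is finite. -/
def MemCosineSpace {d : ℕ} (α : ℝ) (γ : ℕ → ℝ) (f : (Fin d → ℝ) → ℝ) : Prop :=
  (Summable fun k : Fin d → ℕ =>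
    |cosCoeff f k| ^ 2 * rWeight α γ (fun j => (k j : ℤ)) ^ 2) ∧
  TendstoUniformlyOn
    (fun (s : Finset (Fin d → ℕ)) x => ∑ k ∈ s, cosCoeff f k * cosBasis k x) f Filter.atTop (cube d)

def cosineNorm {d : ℕ} (α : ℝ) (γ : ℕ → ℝ) (f : (Fin d → ℝ) → ℝ) : ℝ :=
  Real.sqrt (∑' k : Fin d → ℕ, |cosCoeff f k| ^ 2 * rWeight α γ (fun j => (k j : ℤ)) ^ 2)

/-- The componentwise tent transformation `ψ(z) = 1 - |2z - 1|`. -/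
def tent {d : ℕ} (z : Fin d → ℝ) : Fin d → ℝ := fun j => 1 - |2 * z j - 1|

/-- The recovered cosine coefficient
`c_k = 2^{-|k|_0/2} ∑_{|h| = k} ĉ_h`, where `ĉ_h` is recovered from the samples of `f ∘ ψ`. -/
def cosCoeffEst {d : ℕ} (α : ℝ) (γ : ℕ → ℝ) (t : ℝ) (N : ℕ) (g : Fin d → ℤ)
    (f : (Fin d → ℝ) → ℝ) (Δ : Fin d → ℝ) (k : Fin d → ℕ) : ℂ :=
  (((2 : ℝ) ^ (-(nnz k : ℝ) / 2) : ℝ) : ℂ) *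
    ∑ h ∈ Fintype.piFinset fun j => ({(k j : ℤ), -(k j : ℤ)} : Finset ℤ),
      coeffEst (cross d α γ (truncM d α γ N)) (fun z => (f (tent z) : ℂ)) N g
        (shifts α γ t N g) Δ h

/-! ### The Neumann problem -/

/-- `G` is the weak `j`-th partial derivative of `u` in the open unit cube. -/
def IsWeakPartial {d : ℕ} (j : Fin d) (u G : (Fin d → ℝ) → ℝ) : Prop :=
  ∀ φ : (Fin d → ℝ) → ℝ, ContDiff ℝ ∞ φ → HasCompactSupport φ →
    tsupport φ ⊆ Set.univ.pi (fun _ => Set.Ioo (0 : ℝ) 1) →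
    ∫ x in cube d, u x * fderiv ℝ φ x (Pi.single j 1) = - ∫ x in cube d, G x * φ x

/-- `u ∈ H¹((0,1)^d)` is a weak solution of `∇² u = f` in `(0,1)^d` with `∂u/∂n = 0` on the
boundary: `∫ ∇u · ∇v = - ∫ f v` for all functions `v` that are smooth up to the boundary. -/
def IsWeakNeumannSolution {d : ℕ} (f u : (Fin d → ℝ) → ℝ) : Prop :=
  MemLp u 2 (volume.restrict (cube d)) ∧
  ∃ G : Fin d → (Fin d → ℝ) → ℝ,
    (∀ j, MemLp (G j) 2 (volume.restrict (cube d)) ∧ IsWeakPartial j u (G j)) ∧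
    ∀ v : (Fin d → ℝ) → ℝ, ContDiff ℝ ∞ v →
      ∫ x in cube d, ∑ j, G j x * fderiv ℝ v x (Pi.single j 1) = - ∫ x in cube d, f x * v x

/-- `λ_k = π² ∑_j k_j²`. -/
def eigval {d : ℕ} (k : Fin d → ℕ) : ℝ := Real.pi ^ 2 * ∑ j, (k j : ℝ) ^ 2

/-- The numerical solution
`m - ∑_{k ∈ A⁺ \ {0}} (c_k / λ_k) φ_k(x)`, where `m` is the known mean value. -/
def approxSol {d : ℕ} (α : ℝ) (γ : ℕ → ℝ) (t : ℝ) (N : ℕ) (g : Fin d → ℤ)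
    (f : (Fin d → ℝ) → ℝ) (m : ℝ) (Δ x : Fin d → ℝ) : ℂ :=
  (m : ℂ) - ∑ k ∈ (crossPlus d α γ (truncM d α γ N)).erase 0,
    cosCoeffEst α γ t N g f Δ k / (eigval k : ℂ) * (cosBasis k x : ℂ)

/-- The error of the numerical solution for the global shift `Δ`, the mean of `u` being known. -/
def solError {d : ℕ} (α : ℝ) (γ : ℕ → ℝ) (t : ℝ) (N : ℕ) (g : Fin d → ℤ)
    (f u : (Fin d → ℝ) → ℝ) (Δ x : Fin d → ℝ) : ℂ :=
  (u x : ℂ) - approxSol α γ t N g f (∫ y in cube d, u y) Δ x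

open scoped ENNReal in
/-- The root-mean-square `L₂` error for a uniformly distributed global shift `Δ ∈ [0,1]^d`. -/
def rmsError {d : ℕ} (α : ℝ) (γ : ℕ → ℝ) (t : ℝ) (N : ℕ) (g : Fin d → ℤ)
    (f u : (Fin d → ℝ) → ℝ) : ℝ≥0∞ :=
  (∫⁻ Δ in cube d, eLpNorm (solError α γ t N g f u Δ) 2 (volume.restrict (cube d)) ^ 2) ^
    (1 / 2 : ℝ)

open scoped ENNReal in
/-- The `L_∞` error of the deterministic method (`Δ = 0`). -/
def supError {d : ℕ} (α : ℝ) (γ : ℕ → ℝ) (t : ℝ) (N : ℕ) (g : Fin d → ℤ)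
    (f u : (Fin d → ℝ) → ℝ) : ℝ≥0∞ :=
  eLpNorm (solError α γ t N g f u 0) ∞ (volume.restrict (cube d))

/-- `(log n)^a n^b`. -/
def logRate (n : ℕ) (a b : ℝ) : ℝ := Real.log n ^ a * (n : ℝ) ^ b

end

end LatticeNeumann

open LatticeNeumann

namespace LatticeNeumann

noncomputable section

open scoped ENNReal

/-! Reduction to coefficients. Testing the weak equation with `φ_k` and integrating by parts up to
the boundary shows that the solution has the cosine coefficients `-f̃(k) / λ_k` for `k ≠ 0`
(`IsWeakNeumannSolution.eigval_mul`); since the cosine system is complete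
(`ae_eq_zero_of_orthogonal_cosBasis`), they determine it. The mean is known and `λ_k ≥ π²`
otherwise, so the error is governed by the `ℓ²` and `ℓ¹` norms of the coefficient errors of `f`. The
tent map turns the cosine series into an absolutely convergent Fourier series of `f ∘ ψ` with the
same weighted norm.

The lattice. Jensen's inequality and averaging over the candidates show that a nonzero dual vector
has weight at least `c M` (`exists_truncM_le_rWeight`). Frequencies in one residue class are
therefore separated. Packing into dyadic boxes yields fibers of size `O((log N)^(d-1))`
(`exists_maxFiber_le`) and small tails of `∑ r⁻²` in each residue class (`tsum_wgt_separated_le`).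

The shifts. The Gram matrix of a fiber consists of exponential sums over the shifts. For sets
accepted by the search its off-diagonal entries are small (`isStable_of_expSum_le`). For the initial
set each frequency is free of aliasing for at least half of the primes, and these primes agree up to
the factor `1024` (`isStable_initial`). The search never lengthens the shift set, and the initial
one has size `O((R log V)²)` up to constants, which gives `O((log N)^(2d))` shifts
(`exists_shifts_good`).

The error. Stable least squares amplifies the aliasing noise only by a constant (`lsqCoeff_error`).
Averaged over `Δ`, the noise has mean square at most `M⁻² ‖f‖²` by Parseval's identity. For fixed
`Δ`, Cauchy-Schwarz in each residue class controls it, and passing to the `ℓ¹` norm costs the root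
of the cardinality of the cross. As `M` is at least a multiple of `N^(α-τ)`, the powers of `N`
follow without any logarithm. The logarithms in the bounds in `N` are slack, and those in `N_tot`
pay for the number of shifts (`exists_logRate_comparison`). -/

/-! ### Weights -/

/-- The univariate factor `max {1, |n|^α / c}` of the weight function. -/
def rho (α c : ℝ) (n : ℤ) : ℝ := max 1 (|(n : ℝ)| ^ α / c)

theorem one_le_rho (α c : ℝ) (n : ℤ) : 1 ≤ rho α c n := le_max_left _ _

theorem rho_pos (α c : ℝ) (n : ℤ) : 0 < rho α c n := zero_lt_one.trans_le (one_le_rho α c n)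

theorem rho_zero {α : ℝ} (hα : 0 < α) (c : ℝ) : rho α c 0 = 1 := by
  simp [rho, Real.zero_rpow hα.ne']

theorem rWeight_eq_prod {d : ℕ} (α : ℝ) (γ : ℕ → ℝ) (k : Fin d → ℤ) :
    rWeight α γ k = ∏ j : Fin d, rho α (γ j) (k j) := rfl

theorem one_le_rWeight {d : ℕ} (α : ℝ) (γ : ℕ → ℝ) (k : Fin d → ℤ) : 1 ≤ rWeight α γ k := by
  rw [rWeight_eq_prod]
  calc (1 : ℝ) = ∏ _j : Fin d, (1 : ℝ) := by simp
    _ ≤ _ := Finset.prod_le_prod (fun _ _ => zero_le_one) fun j _ => one_le_rho _ _ _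

theorem rWeight_pos {d : ℕ} (α : ℝ) (γ : ℕ → ℝ) (k : Fin d → ℤ) : 0 < rWeight α γ k :=
  zero_lt_one.trans_le (one_le_rWeight α γ k)

theorem rWeight_snoc {s : ℕ} (α : ℝ) (γ : ℕ → ℝ) (k : Fin s → ℤ) (n : ℤ) :
    rWeight α γ (Fin.snoc k n : Fin (s + 1) → ℤ) = rWeight α γ k * rho α (γ s) n := by
  rw [rWeight_eq_prod, Fin.prod_univ_castSucc]
  simp [rWeight_eq_prod]

/-- The power `r(k)^{-q}` of the weight as an extended nonnegative real. -/
def wgt {d : ℕ} (α : ℝ) (γ : ℕ → ℝ) (q : ℝ) (k : Fin d → ℤ) : ℝ≥0∞ :=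
  ENNReal.ofReal (rWeight α γ k ^ (-q))

theorem wgt_snoc {s : ℕ} (α : ℝ) (γ : ℕ → ℝ) (q : ℝ) (k : Fin s → ℤ) (n : ℤ) :
    wgt α γ q (Fin.snoc k n : Fin (s + 1) → ℤ) =
      wgt α γ q k * ENNReal.ofReal (rho α (γ s) n ^ (-q)) := by
  rw [wgt, rWeight_snoc, Real.mul_rpow (rWeight_pos _ _ _).le (rho_pos _ _ _).le,
    ENNReal.ofReal_mul (Real.rpow_nonneg (rWeight_pos _ _ _).le _)]
  rfl

theorem wgt_eq_prod {d : ℕ} (α : ℝ) (γ : ℕ → ℝ) (q : ℝ) (k : Fin d → ℤ) :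
    wgt α γ q k = ∏ j : Fin d, ENNReal.ofReal (rho α (γ j) (k j) ^ (-q)) := by
  rw [wgt, rWeight_eq_prod, ← Real.finsetProd_rpow _ _ fun i _ => (rho_pos _ _ _).le,
    ENNReal.ofReal_prod_of_nonneg]
  exact fun i _ => Real.rpow_nonneg (rho_pos _ _ _).le _

theorem wgt_rpow {d : ℕ} (α : ℝ) (γ : ℕ → ℝ) (k : Fin d → ℤ) {q p : ℝ} (hp : 0 ≤ p) :
    wgt α γ q k ^ p = wgt α γ (q * p) k := by
  rw [wgt, wgt, ENNReal.ofReal_rpow_of_nonneg (Real.rpow_nonneg (rWeight_pos _ _ _).le _) hp,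
    ← Real.rpow_mul (rWeight_pos _ _ _).le]
  ring_nf

/-- Tonelli's theorem, splitting off the last coordinate; in `ℝ≥0∞` no summability has to be
checked. -/
theorem tsum_pi_prod {ι : Type*} : ∀ {d : ℕ} (F : Fin d → ι → ℝ≥0∞),
    ∑' k : Fin d → ι, ∏ j, F j (k j) = ∏ j, ∑' n, F j n
  | 0, F => by simp
  | d + 1, F => by
    rw [← (Fin.snocEquiv fun _ : Fin (d + 1) => ι).tsum_eq, ENNReal.tsum_prod']
    simp only [Fin.snocEquiv, Equiv.coe_fn_mk, Fin.prod_univ_castSucc, Fin.snoc_castSucc,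
      Fin.snoc_last]
    rw [ENNReal.tsum_comm]
    simp only [ENNReal.tsum_mul_left, ENNReal.tsum_mul_right]
    rw [tsum_pi_prod fun j => F j.castSucc]

/-- The majorant `c^q |n|^{-αq}` of `ρ(n)^{-q}`, set to `0` at `n = 0`. -/
def powTerm (α c q : ℝ) (n : ℤ) : ℝ≥0∞ :=
  if n = 0 then 0 else ENNReal.ofReal (c ^ q * |(n : ℝ)| ^ (-(α * q)))

/-- The sum `2 c^q ζ(αq)` of the majorants. -/
def powSum (α c q : ℝ) : ℝ≥0∞ := ∑' n : ℤ, powTerm α c q n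

theorem rho_rpow_le {α c q : ℝ} (hc : 0 < c) (hq : 0 < q) {n : ℤ} (hn : n ≠ 0) :
    ENNReal.ofReal (rho α c n ^ (-q)) ≤ powTerm α c q n := by
  rw [powTerm, if_neg hn]
  apply ENNReal.ofReal_le_ofReal
  have hn' : 0 < |(n : ℝ)| := abs_pos.mpr (Int.cast_ne_zero.mpr hn)
  have h1 : 0 < |(n : ℝ)| ^ α / c := div_pos (Real.rpow_pos_of_pos hn' _) hc
  calc rho α c n ^ (-q) ≤ (|(n : ℝ)| ^ α / c) ^ (-q) :=
        Real.rpow_le_rpow_of_nonpos h1 (le_max_right _ _) (by linarith)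
    _ = c ^ q * |(n : ℝ)| ^ (-(α * q)) := by
        rw [Real.div_rpow (Real.rpow_nonneg hn'.le _) hc.le, ← Real.rpow_mul hn'.le,
          Real.rpow_neg hc.le q, div_inv_eq_mul, mul_comm]
        ring_nf

theorem tsum_rho_le {α c q : ℝ} (hc : 0 < c) (hq : 0 < q) :
    ∑' n : ℤ, ENNReal.ofReal (rho α c n ^ (-q)) ≤ 1 + powSum α c q := by
  calc ∑' n : ℤ, ENNReal.ofReal (rho α c n ^ (-q))
      ≤ ∑' n : ℤ, ((if n = 0 then 1 else 0) + powTerm α c q n) := by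
        refine ENNReal.tsum_le_tsum fun n => ?_
        by_cases hn : n = 0
        · rw [if_pos hn]
          refine le_trans ?_ le_self_add
          rw [← ENNReal.ofReal_one]
          exact ENNReal.ofReal_le_ofReal
            (Real.rpow_le_one_of_one_le_of_nonpos (one_le_rho _ _ _) (by linarith))
        · rw [if_neg hn, zero_add]
          exact rho_rpow_le hc hq hn
    _ = 1 + powSum α c q := by
        rw [ENNReal.tsum_add, tsum_ite_eq]
        rfl

theorem tsum_wgt_le {d : ℕ} {α q : ℝ} {γ : ℕ → ℝ} (hγ : ∀ j, 0 < γ j) (hq : 0 < q) :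
    ∑' k : Fin d → ℤ, wgt α γ q k ≤ ∏ j : Fin d, (1 + powSum α (γ j) q) := by
  simp_rw [wgt_eq_prod]
  rw [tsum_pi_prod fun (j : Fin d) n => ENNReal.ofReal (rho α (γ j) n ^ (-q))]
  exact Finset.prod_le_prod' fun j _ => tsum_rho_le (hγ j) hq

theorem zeta_re_eq {s : ℝ} (hs : 1 < s) :
    (riemannZeta (s : ℂ)).re = ∑' n : ℕ, ((n : ℝ) + 1) ^ (-s) := by
  rw [zeta_eq_tsum_one_div_nat_add_one_cpow (by simpa using hs)]
  have : ∀ n : ℕ, 1 / ((n : ℂ) + 1) ^ (s : ℂ) = (((n : ℝ) + 1) ^ (-s) : ℝ) := by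
    intro n
    rw [Real.rpow_neg (by positivity), Complex.ofReal_inv,
      Complex.ofReal_cpow (by positivity)]
    simp
  simp_rw [this]
  rw [← Complex.ofReal_tsum, Complex.ofReal_re]

theorem summable_succ_rpow {s : ℝ} (hs : 1 < s) : Summable fun n : ℕ => ((n : ℝ) + 1) ^ (-s) := by
  have := (summable_nat_add_iff 1).mpr (Real.summable_nat_rpow.mpr (by linarith : -s < -1))
  simpa using this

theorem zeta_re_nonneg {s : ℝ} (hs : 1 < s) : 0 ≤ (riemannZeta (s : ℂ)).re := by
  rw [zeta_re_eq hs]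
  exact tsum_nonneg fun n => by positivity

theorem powSum_eq {α c q : ℝ} (hc : 0 < c) (hq : 1 < α * q) :
    powSum α c q = ENNReal.ofReal (2 * c ^ q * (riemannZeta ((α * q : ℝ) : ℂ)).re) := by
  have hterm : ∀ n : ℕ, powTerm α c q ((n : ℤ) + 1) =
      ENNReal.ofReal (c ^ q * ((n : ℝ) + 1) ^ (-(α * q))) := by
    intro n
    rw [powTerm, if_neg (by lia)]
    push_cast
    rw [abs_of_nonneg (by positivity)]
  have hterm' : ∀ n : ℕ, powTerm α c q (-((n : ℤ) + 1)) =
      ENNReal.ofReal (c ^ q * ((n : ℝ) + 1) ^ (-(α * q))) := by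
    intro n
    rw [powTerm, if_neg (by lia)]
    push_cast
    rw [abs_neg, abs_of_nonneg (by positivity)]
  have hsum : ∑' n : ℕ, ENNReal.ofReal (c ^ q * ((n : ℝ) + 1) ^ (-(α * q))) =
      ENNReal.ofReal (c ^ q * (riemannZeta ((α * q : ℝ) : ℂ)).re) := by
    rw [zeta_re_eq hq, ← tsum_mul_left, ENNReal.ofReal_tsum_of_nonneg]
    · intro n; positivity
    · exact (summable_succ_rpow hq).mul_left _
  rw [powSum, tsum_of_nat_of_neg_add_one ENNReal.summable ENNReal.summable,
    tsum_eq_zero_add' ENNReal.summable]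
  simp only [Nat.cast_add, Nat.cast_one, hterm, hterm', hsum]
  rw [show powTerm α c q ((0 : ℕ) : ℤ) = 0 by simp [powTerm], zero_add, ← ENNReal.ofReal_add]
  · ring_nf
  all_goals exact mul_nonneg (Real.rpow_nonneg hc.le _) (zeta_re_nonneg hq)

theorem powSum_ne_top {α c q : ℝ} (hc : 0 < c) (hq : 1 < α * q) : powSum α c q ≠ ⊤ := by
  rw [powSum_eq hc hq]
  exact ENNReal.ofReal_ne_top

/-- Replacing `m` by `N m` scales the term by `N^(-αq)`, and `αq > 1` leaves room for the factor
`N`. -/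
theorem tsum_powTerm_dvd_le {α c q : ℝ} (hc : 0 < c) (hq : 1 < α * q) {N : ℕ} (hN : 0 < N) :
    (N : ℝ≥0∞) * ∑' n : ℤ, (if (N : ℤ) ∣ n then powTerm α c q n else 0) ≤ powSum α c q := by
  have hinj : Function.Injective fun m : ℤ => (N : ℤ) * m :=
    mul_right_injective₀ (by exact_mod_cast hN.ne')
  rw [← hinj.tsum_eq (f := fun n : ℤ => if (N : ℤ) ∣ n then powTerm α c q n else 0)]
  · rw [← ENNReal.tsum_mul_left]
    refine ENNReal.tsum_le_tsum fun m => ?_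
    rw [if_pos (dvd_mul_right _ _)]
    by_cases hm : m = 0
    · simp [hm, powTerm]
    · rw [powTerm, if_neg (by simp [hm, hN.ne']), powTerm, if_neg hm, ← ENNReal.ofReal_natCast,
        ← ENNReal.ofReal_mul (by positivity)]
      apply ENNReal.ofReal_le_ofReal
      have hN1 : (1 : ℝ) ≤ N := by exact_mod_cast hN
      have h1 : (N : ℝ) * (N : ℝ) ^ (-(α * q)) ≤ 1 := by
        rw [← Real.rpow_one_add' (by positivity) (by linarith)]
        exact Real.rpow_le_one_of_one_le_of_nonpos hN1 (by linarith)
      push_cast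
      rw [abs_mul, abs_of_nonneg (by positivity : (0 : ℝ) ≤ N),
        Real.mul_rpow (by positivity) (abs_nonneg _)]
      have h2 : 0 ≤ c ^ q * |(m : ℝ)| ^ (-(α * q)) := by positivity
      nlinarith
  · intro n hn
    rw [Function.mem_support] at hn
    by_contra hcon
    apply hn
    rw [if_neg]
    rintro ⟨m, rfl⟩
    exact hcon ⟨m, rfl⟩

/-- Jensen's inequality for sums, that is, subadditivity of `x ↦ x^p` for `p ≤ 1`. -/
theorem ennreal_rpow_sum_le {ι : Type*} (s : Finset ι) (f : ι → ℝ≥0∞) {p : ℝ} (hp0 : 0 < p)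
    (hp1 : p ≤ 1) : (∑ i ∈ s, f i) ^ p ≤ ∑ i ∈ s, f i ^ p := by
  classical
  induction s using Finset.induction_on with
  | empty => simp [ENNReal.zero_rpow_of_pos hp0]
  | insert a s ha ih =>
    rw [Finset.sum_insert ha, Finset.sum_insert ha]
    exact (ENNReal.rpow_add_le_add_rpow _ _ hp0.le hp1).trans (add_le_add_right ih _)

theorem ennreal_rpow_tsum_le {ι : Type*} (f : ι → ℝ≥0∞) {p : ℝ} (hp0 : 0 < p)
    (hp1 : p ≤ 1) : (∑' i, f i) ^ p ≤ ∑' i, f i ^ p := by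
  have h : Filter.Tendsto (fun s : Finset ι => (∑ i ∈ s, f i) ^ p) Filter.atTop
      (nhds ((∑' i, f i) ^ p)) :=
    ((ENNReal.continuous_rpow_const (y := p)).tendsto _).comp ENNReal.summable.hasSum
  exact le_of_tendsto' h fun s => (ennreal_rpow_sum_le s f hp0 hp1).trans (ENNReal.sum_le_tsum s)

/-! ### The component-by-component construction -/

/-- The sum of `r(k)^{-q}` over the nonzero vectors of the dual lattice. -/
def dualSum {s : ℕ} (α : ℝ) (γ : ℕ → ℝ) (q : ℝ) (N : ℕ) (g : Fin s → ℤ) : ℝ≥0∞ :=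
  ∑' k : Fin s → ℤ, if k ≠ 0 ∧ idot k g ≡ 0 [ZMOD N] then wgt α γ q k else 0

/-- The part of `dualSum` that a new last component `x` adds. -/
def newSum {s : ℕ} (α : ℝ) (γ : ℕ → ℝ) (q : ℝ) (N : ℕ) (g : Fin s → ℤ) (x : ℤ) : ℝ≥0∞ :=
  ∑' n : ℤ, ∑' k : Fin s → ℤ, if n ≠ 0 ∧ idot k g + n * x ≡ 0 [ZMOD N] then
    wgt α γ q k * ENNReal.ofReal (rho α (γ s) n ^ (-q)) else 0

theorem idot_snoc {s : ℕ} (k g : Fin s → ℤ) (n x : ℤ) :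
    idot (Fin.snoc k n : Fin (s + 1) → ℤ) (Fin.snoc g x : Fin (s + 1) → ℤ) =
      idot k g + n * x := by
  simp [idot, Fin.sum_univ_castSucc]

theorem snoc_eq_zero_iff {s : ℕ} (k : Fin s → ℤ) :
    (Fin.snoc k 0 : Fin (s + 1) → ℤ) = 0 ↔ k = 0 := by
  constructor
  · intro h
    funext i
    simpa using congrFun h i.castSucc
  · rintro rfl
    funext i
    refine Fin.lastCases ?_ (fun i => ?_) i <;> simp

theorem snoc_ne_zero {s : ℕ} (k : Fin s → ℤ) {n : ℤ} (hn : n ≠ 0) :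
    (Fin.snoc k n : Fin (s + 1) → ℤ) ≠ 0 := by
  intro h
  exact hn (by simpa using congrFun h (Fin.last s))

theorem dualSum_snoc {s : ℕ} {α : ℝ} (hα : 0 < α) (γ : ℕ → ℝ) (q : ℝ) (N : ℕ) (g : Fin s → ℤ)
    (x : ℤ) : dualSum α γ q N (Fin.snoc g x : Fin (s + 1) → ℤ) =
      dualSum α γ q N g + newSum α γ q N g x := by
  rw [dualSum, ← (Fin.snocEquiv fun _ : Fin (s + 1) => ℤ).tsum_eq, ENNReal.tsum_prod']
  simp only [Fin.snocEquiv, Equiv.coe_fn_mk, wgt_snoc, idot_snoc]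
  have h : ∀ n : ℤ, (∑' k : Fin s → ℤ,
      if (Fin.snoc k n : Fin (s + 1) → ℤ) ≠ 0 ∧ idot k g + n * x ≡ 0 [ZMOD N] then
        wgt α γ q k * ENNReal.ofReal (rho α (γ s) n ^ (-q)) else 0) =
      (if n = 0 then dualSum α γ q N g else 0) +
      ∑' k : Fin s → ℤ, if n ≠ 0 ∧ idot k g + n * x ≡ 0 [ZMOD N] then
        wgt α γ q k * ENNReal.ofReal (rho α (γ s) n ^ (-q)) else 0 := by
    intro n
    by_cases hn : n = 0
    · subst hn
      simp [snoc_eq_zero_iff, rho_zero hα, dualSum]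
    · simp [hn, snoc_ne_zero]
  simp_rw [h]
  rw [ENNReal.tsum_add, tsum_ite_eq]
  rfl

/-- The construction minimizes with exponent `2`, but good rates need exponents `q` near `1/α`.
Jensen's inequality passes from one to the other. -/
theorem newSum_rpow_le {s : ℕ} (α : ℝ) (γ : ℕ → ℝ) {q : ℝ} (hq0 : 0 < q) (hq2 : q ≤ 2) (N : ℕ)
    (g : Fin s → ℤ) (x : ℤ) : newSum α γ 2 N g x ^ (q / 2) ≤ newSum α γ q N g x := by
  have h0 : 0 < q / 2 := by linarith
  refine (ennreal_rpow_tsum_le _ h0 (by linarith)).trans (ENNReal.tsum_le_tsum fun n => ?_)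
  refine (ennreal_rpow_tsum_le _ h0 (by linarith)).trans (ENNReal.tsum_le_tsum fun k => ?_)
  split_ifs
  · rw [ENNReal.mul_rpow_of_nonneg _ _ h0.le, wgt_rpow _ _ _ h0.le,
      ENNReal.ofReal_rpow_of_nonneg (Real.rpow_nonneg (rho_pos _ _ _).le _) h0.le,
      ← Real.rpow_mul (rho_pos _ _ _).le]
    rw [show 2 * (q / 2) = q by ring, show -2 * (q / 2) = -q by ring]
  · rw [ENNReal.zero_rpow_of_pos h0]

/-- Modulo a prime, a linear congruence with invertible coefficient has one solution; if `N ∣ n`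
every candidate may be one. -/
theorem card_solutions_le {N : ℕ} (hN : N.Prime) (a n : ℤ) :
    ((Finset.Icc (1 : ℤ) (N - 1)).filter fun x => a + n * x ≡ 0 [ZMOD N]).card ≤
      1 + if (N : ℤ) ∣ n then N else 0 := by
  have hN1 : 1 ≤ N := hN.one_le
  split_ifs with h
  · refine (Finset.card_filter_le _ _).trans ?_
    rw [Int.card_Icc]
    lia
  · rw [add_zero, Finset.card_le_one]
    intro x hx y hy
    rw [Finset.mem_filter, Finset.mem_Icc] at hx hy
    have h1 : (N : ℤ) ∣ n * (x - y) := by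
      have := (hx.2.trans hy.2.symm).symm.dvd
      rw [show n * (x - y) = a + n * x - (a + n * y) by ring]
      exact this
    have h2 : (N : ℤ) ∣ x - y :=
      ((Nat.prime_iff_prime_int.mp hN).dvd_or_dvd h1).resolve_left h
    have h3 : x - y = 0 := Int.eq_zero_of_abs_lt_dvd h2 (by rw [abs_lt]; constructor <;> lia)
    lia

/-- For fixed frequencies the number of admissible `x` is at most `1`, plus `N` if `N ∣ n`.
Multiples of `N` are so light that the second part costs no more than the first, whence the factor
`2`. -/
theorem sum_newSum_le {s : ℕ} {α q : ℝ} {γ : ℕ → ℝ} (hγ : ∀ j, 0 < γ j) (hq0 : 0 < q)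
    (hq : 1 < α * q) {N : ℕ} (hN : N.Prime) (g : Fin s → ℤ) :
    ∑ x ∈ Finset.Icc (1 : ℤ) (N - 1), newSum α γ q N g x ≤
      2 * (∑' k : Fin s → ℤ, wgt α γ q k) * powSum α (γ s) q := by
  have hcount : ∀ (n : ℤ) (k : Fin s → ℤ), (∑ x ∈ Finset.Icc (1 : ℤ) (N - 1),
      if n ≠ 0 ∧ idot k g + n * x ≡ 0 [ZMOD N] then
        wgt α γ q k * ENNReal.ofReal (rho α (γ s) n ^ (-q)) else 0) ≤
      wgt α γ q k * (powTerm α (γ s) q n +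
        N * (if (N : ℤ) ∣ n then powTerm α (γ s) q n else 0)) := by
    intro n k
    by_cases hn : n = 0
    · simp [hn]
    · simp only [ne_eq, hn, not_false_eq_true, true_and]
      rw [← Finset.sum_filter, Finset.sum_const, nsmul_eq_mul, mul_left_comm]
      refine mul_le_mul_right ?_ _
      calc _ ≤ ((1 + if (N : ℤ) ∣ n then N else 0 : ℕ) : ℝ≥0∞) * powTerm α (γ s) q n :=
            mul_le_mul' (by exact_mod_cast card_solutions_le hN _ _) (rho_rpow_le (hγ s) hq0 hn)
        _ = _ := by
            split_ifs <;> push_cast <;> ring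
  simp_rw [newSum]
  rw [← Summable.tsum_finsetSum fun _ _ => ENNReal.summable]
  simp_rw [← Summable.tsum_finsetSum fun _ _ => ENNReal.summable]
  calc _ ≤ ∑' n : ℤ, ∑' k : Fin s → ℤ, wgt α γ q k * (powTerm α (γ s) q n +
        N * (if (N : ℤ) ∣ n then powTerm α (γ s) q n else 0)) :=
        ENNReal.tsum_le_tsum fun n => ENNReal.tsum_le_tsum fun k => hcount n k
    _ = (∑' k : Fin s → ℤ, wgt α γ q k) * (powSum α (γ s) q +
        N * ∑' n : ℤ, if (N : ℤ) ∣ n then powTerm α (γ s) q n else 0) := by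
        simp_rw [ENNReal.tsum_mul_right]
        rw [ENNReal.tsum_mul_left, ENNReal.tsum_add, ENNReal.tsum_mul_left]
        rfl
    _ ≤ (∑' k : Fin s → ℤ, wgt α γ q k) * (powSum α (γ s) q + powSum α (γ s) q) := by
        gcongr
        exact tsum_powTerm_dvd_le (hγ s) hq hN.pos
    _ = _ := by ring

/-- The first `n` entries of `g`. -/
def prefixVec {d : ℕ} (g : Fin d → ℤ) (n : ℕ) (hn : n ≤ d) : Fin n → ℤ :=
  fun i => g (Fin.castLE hn i)

theorem extendPrefix_eq_snoc {d : ℕ} (g : Fin d → ℤ) (s : Fin d) (x : ℤ) :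
    extendPrefix g s x = (Fin.snoc (prefixVec g s s.2.le) x : Fin ((s : ℕ) + 1) → ℤ) := by
  funext i
  refine Fin.lastCases ?_ (fun i => ?_) i
  · simp [extendPrefix]
  · simp only [extendPrefix, Fin.val_castSucc, Fin.snoc_castSucc, i.2, dif_pos, prefixVec]
    rfl

theorem prefixVec_succ {d : ℕ} (g : Fin d → ℤ) (n : ℕ) (hn : n + 1 ≤ d) :
    prefixVec g (n + 1) hn =
      (Fin.snoc (prefixVec g n (Nat.le_of_succ_le hn)) (g ⟨n, hn⟩) : Fin (n + 1) → ℤ) := by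
  funext i
  refine Fin.lastCases ?_ (fun i => ?_) i
  · simp [prefixVec]
    rfl
  · simp [prefixVec]

theorem tsum_wgt_ne_top {d : ℕ} {α q : ℝ} {γ : ℕ → ℝ} (hγ : ∀ j, 0 < γ j) (hq0 : 0 < q)
    (hq : 1 < α * q) : ∑' k : Fin d → ℤ, wgt α γ q k ≠ ⊤ := by
  refine ((tsum_wgt_le hγ hq0).trans_lt ?_).ne
  exact ENNReal.prod_lt_top fun j _ =>
    ENNReal.add_lt_top.mpr ⟨ENNReal.one_lt_top, (powSum_ne_top (hγ j) hq).lt_top⟩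

theorem dualSum_ne_top {d : ℕ} {α q : ℝ} {γ : ℕ → ℝ} (hγ : ∀ j, 0 < γ j) (hq0 : 0 < q)
    (hq : 1 < α * q) (N : ℕ) (g : Fin d → ℤ) : dualSum α γ q N g ≠ ⊤ := by
  refine ((ENNReal.tsum_le_tsum fun k => ?_).trans_lt (tsum_wgt_ne_top hγ hq0 hq).lt_top).ne
  split_ifs
  · exact le_rfl
  · exact zero_le

theorem tsum_toReal_subtype {ι : Type*} (p : ι → Prop) [DecidablePred p] (f : ι → ℝ≥0∞)
    (hf : ∀ i, f i ≠ ⊤) :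
    ∑' i : {i // p i}, (f i.1).toReal = (∑' i, if p i then f i else 0).toReal := by
  rw [← ENNReal.tsum_toReal_eq fun i : {i // p i} => hf i.1]
  congr 1
  refine (tsum_subtype {i | p i} f).trans (tsum_congr fun i => ?_)
  simp [Set.indicator_apply]

theorem wgt_toReal {d : ℕ} (α : ℝ) (γ : ℕ → ℝ) (q : ℝ) (k : Fin d → ℤ) :
    (wgt α γ q k).toReal = rWeight α γ k ^ (-q) :=
  ENNReal.toReal_ofReal (Real.rpow_nonneg (rWeight_pos _ _ _).le _)

theorem PError_eq {s : ℕ} (α : ℝ) (γ : ℕ → ℝ) (N : ℕ) (g : Fin s → ℤ) :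
    PError α γ N g = (dualSum α γ 2 N g).toReal := by
  rw [dualSum, ← tsum_toReal_subtype (fun k : Fin s → ℤ => k ≠ 0 ∧ idot k g ≡ 0 [ZMOD N])
    (wgt α γ 2) fun _ => ENNReal.ofReal_ne_top, PError]
  refine tsum_congr fun k => ?_
  rw [wgt_toReal, Real.rpow_neg (rWeight_pos _ _ _).le, one_div, Real.rpow_two]

/-- The part of `P` with vanishing last frequency does not depend on the candidate, so it cancels;
the cancellation in `ℝ≥0∞` needs finiteness. -/
theorem newSum_le_of_isCBC {d : ℕ} {α : ℝ} (hα : 1 / 2 < α) {γ : ℕ → ℝ} (hγ : ∀ j, 0 < γ j)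
    {N : ℕ} {g : Fin d → ℤ} (hg : IsCBC α γ N g) (s : Fin d) (hs : (s : ℕ) ≠ 0) {x : ℤ}
    (hx : x ∈ Finset.Icc (1 : ℤ) (N - 1)) :
    newSum α γ 2 N (prefixVec g s s.2.le) (g s) ≤ newSum α γ 2 N (prefixVec g s s.2.le) x := by
  have h := (hg.2 s hs).2 x hx
  have hα0 : 0 < α := by linarith
  have hfin : ∀ y : ℤ, dualSum α γ 2 N (prefixVec g s s.2.le) +
      newSum α γ 2 N (prefixVec g s s.2.le) y ≠ ⊤ := by
    intro y
    rw [← dualSum_snoc hα0]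
    exact dualSum_ne_top hγ two_pos (by linarith) N _
  rw [PError_eq, PError_eq, extendPrefix_eq_snoc, extendPrefix_eq_snoc, dualSum_snoc hα0,
    dualSum_snoc hα0, ENNReal.toReal_le_toReal (hfin _) (hfin _)] at h
  exact (ENNReal.add_le_add_iff_left (dualSum_ne_top hγ two_pos (by linarith) N _)).mp h

/-- In dimension one with `g = 1`, the dual lattice consists of the multiples of `N`. -/
theorem newSum_one_le {α q : ℝ} {γ : ℕ → ℝ} (hγ : ∀ j, 0 < γ j) (hq0 : 0 < q)
    (hq : 1 < α * q) {N : ℕ} (hN : N.Prime) (g : Fin 0 → ℤ) :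
    (N : ℝ≥0∞) * newSum α γ q N g 1 ≤ powSum α (γ 0) q := by
  refine le_trans (mul_le_mul_right (ENNReal.tsum_le_tsum fun n => ?_) _)
    (tsum_powTerm_dvd_le (hγ 0) hq hN.pos)
  rw [tsum_eq_single (default : Fin 0 → ℤ) fun b hb => absurd (Subsingleton.elim _ _) hb]
  by_cases hn : n = 0
  · simp [hn]
  · have : idot (default : Fin 0 → ℤ) g = 0 := by simp [idot]
    simp only [ne_eq, hn, not_false_eq_true, true_and, this, zero_add, mul_one,
      Int.modEq_zero_iff_dvd]
    split_ifs
    · rw [wgt]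
      simpa [rWeight] using rho_rpow_le (hγ 0) hq0 hn
    · exact le_rfl

/-- The minimum over the `N - 1` candidates is at most the average. Passing from `N - 1` to `N`
costs a factor `2`, which with the `2` of `sum_newSum_le` makes `4`. -/
theorem newSum_isCBC_le {d : ℕ} {α : ℝ} (hα : 1 / 2 < α) {γ : ℕ → ℝ} (hγ : ∀ j, 0 < γ j)
    {q : ℝ} (hq : 1 < α * q) (hq0 : 0 < q) (hq2 : q ≤ 2) {N : ℕ} (hN : N.Prime)
    {g : Fin d → ℤ} (hg : IsCBC α γ N g) (s : Fin d) :
    (N : ℝ≥0∞) * newSum α γ 2 N (prefixVec g s s.2.le) (g s) ^ (q / 2) ≤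
      4 * (∏ j : Fin (s : ℕ), (1 + powSum α (γ j) q)) * powSum α (γ s) q := by
  by_cases hs : (s : ℕ) = 0
  · obtain ⟨s, hsd⟩ := s
    obtain rfl : s = 0 := hs
    rw [hg.1 _ rfl]
    refine (mul_le_mul_right (newSum_rpow_le α γ hq0 hq2 N _ _) _).trans ?_
    refine (newSum_one_le hγ hq0 hq hN _).trans ?_
    simp only [Finset.univ_eq_empty, Finset.prod_empty, mul_one]
    exact le_mul_of_one_le_left' (by norm_num)
  · set θ := newSum α γ 2 N (prefixVec g s s.2.le) (g s) ^ (q / 2) with hθ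
    have h1 : ((N - 1 : ℕ) : ℝ≥0∞) * θ ≤
        2 * (∑' k : Fin (s : ℕ) → ℤ, wgt α γ q k) * powSum α (γ s) q := by
      refine le_trans ?_ (sum_newSum_le hγ hq0 hq hN (prefixVec g s s.2.le))
      have hc : (N - 1 : ℕ) = (Finset.Icc (1 : ℤ) (N - 1)).card := by
        rw [Int.card_Icc]
        have := hN.one_le
        lia
      rw [hc, ← nsmul_eq_mul]
      refine Finset.card_nsmul_le_sum _ _ _ fun x hx => ?_
      exact (ENNReal.rpow_le_rpow (newSum_le_of_isCBC hα hγ hg s hs hx) (by linarith)).trans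
        (newSum_rpow_le α γ hq0 hq2 N _ _)
    have h2 : (N : ℝ≥0∞) ≤ 2 * ((N - 1 : ℕ) : ℝ≥0∞) := by
      have := hN.two_le
      exact_mod_cast (by lia : N ≤ 2 * (N - 1))
    calc (N : ℝ≥0∞) * θ ≤ 2 * (((N - 1 : ℕ) : ℝ≥0∞) * θ) := by
          rw [← mul_assoc]
          exact mul_le_mul_left h2 _
      _ ≤ 2 * (2 * (∑' k : Fin (s : ℕ) → ℤ, wgt α γ q k) * powSum α (γ s) q) := by gcongr
      _ ≤ 2 * (2 * (∏ j : Fin (s : ℕ), (1 + powSum α (γ j) q)) * powSum α (γ s) q) := by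
          gcongr
          exact tsum_wgt_le hγ hq0
      _ = _ := by ring

/-- By induction on the dimension: the power `q/2` is subadditive, and `4 ∏ + 4 ∏ · powSum` is `4`
times the next product. -/
theorem dualSum_isCBC_le {d : ℕ} {α : ℝ} (hα : 1 / 2 < α) {γ : ℕ → ℝ} (hγ : ∀ j, 0 < γ j)
    {q : ℝ} (hq : 1 < α * q) (hq0 : 0 < q) (hq2 : q ≤ 2) {N : ℕ} (hN : N.Prime)
    {g : Fin d → ℤ} (hg : IsCBC α γ N g) (n : ℕ) (hn : n ≤ d) :
    (N : ℝ≥0∞) * dualSum α γ 2 N (prefixVec g n hn) ^ (q / 2) ≤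
      4 * ∏ j : Fin n, (1 + powSum α (γ j) q) := by
  induction n with
  | zero =>
    have : dualSum α γ 2 N (prefixVec g 0 hn) = 0 := by
      simp only [dualSum, ENNReal.tsum_eq_zero]
      intro k
      rw [if_neg]
      exact fun h => h.1 (Subsingleton.elim _ _)
    rw [this, ENNReal.zero_rpow_of_pos (by linarith)]
    simp
  | succ n ih =>
    have h1 := ih (Nat.le_of_succ_le hn)
    have h2 := newSum_isCBC_le hα hγ hq hq0 hq2 hN hg ⟨n, hn⟩
    rw [prefixVec_succ, dualSum_snoc (by linarith), Fin.prod_univ_castSucc]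
    calc _ ≤ (N : ℝ≥0∞) * (dualSum α γ 2 N (prefixVec g n (Nat.le_of_succ_le hn)) ^ (q / 2) +
          newSum α γ 2 N (prefixVec g n (Nat.le_of_succ_le hn)) (g ⟨n, hn⟩) ^ (q / 2)) :=
          mul_le_mul_right (ENNReal.rpow_add_le_add_rpow _ _ (by linarith) (by linarith)) _
      _ ≤ 4 * (∏ j : Fin n, (1 + powSum α (γ j) q)) +
          4 * (∏ j : Fin n, (1 + powSum α (γ j) q)) * powSum α (γ n) q := by
          rw [mul_add]
          exact add_le_add h1 h2
      _ = _ := by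
          simp only [Fin.val_castSucc, Fin.val_last]
          ring

/-- The bound for the weights of the dual lattice of a component-by-component construction. -/
theorem wgt_dual_le {d : ℕ} {α : ℝ} (hα : 1 / 2 < α) {γ : ℕ → ℝ} (hγ : ∀ j, 0 < γ j)
    {q : ℝ} (hq : 1 < α * q) (hq0 : 0 < q) (hq2 : q ≤ 2) {N : ℕ} (hN : N.Prime)
    {g : Fin d → ℤ} (hg : IsCBC α γ N g) {h : Fin d → ℤ} (h0 : h ≠ 0)
    (hh : idot h g ≡ 0 [ZMOD N]) :
    (N : ℝ≥0∞) * wgt α γ q h ≤ 4 * ∏ j : Fin d, (1 + powSum α (γ j) q) := by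
  refine le_trans (mul_le_mul_right ?_ _) (dualSum_isCBC_le hα hγ hq hq0 hq2 hN hg d le_rfl)
  -- A single term is at most the whole sum.
  have h1 : wgt α γ 2 h ≤ dualSum α γ 2 N (prefixVec g d le_rfl) := by
    refine le_trans (le_of_eq ?_) (ENNReal.le_tsum h)
    rw [if_pos ⟨h0, hh⟩]
  calc wgt α γ q h = wgt α γ 2 h ^ (q / 2) := by
        rw [wgt_rpow _ _ _ (by linarith)]
        ring_nf
    _ ≤ _ := ENNReal.rpow_le_rpow h1 (by linarith)

/-- The factor `∏_j (1 + 2 γ_j^q ζ(αq))`. -/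
def zetaProd (d : ℕ) (α : ℝ) (γ : ℕ → ℝ) (q : ℝ) : ℝ :=
  ∏ j : Fin d, (1 + 2 * γ j ^ q * (riemannZeta ((α * q : ℝ) : ℂ)).re)

theorem one_le_zetaProd (d : ℕ) {α : ℝ} {γ : ℕ → ℝ} (hγ : ∀ j, 0 < γ j) {q : ℝ}
    (hq : 1 < α * q) : 1 ≤ zetaProd d α γ q := by
  calc (1 : ℝ) = ∏ _j : Fin d, (1 : ℝ) := by simp
    _ ≤ _ := Finset.prod_le_prod (fun _ _ => zero_le_one) fun j _ => by
      have := zeta_re_nonneg hq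
      have := Real.rpow_nonneg (hγ j).le q
      have : 0 ≤ 2 * γ j ^ q * (riemannZeta ((α * q : ℝ) : ℂ)).re := by positivity
      linarith

theorem prod_powSum_eq (d : ℕ) {α : ℝ} {γ : ℕ → ℝ} (hγ : ∀ j, 0 < γ j) {q : ℝ}
    (hq : 1 < α * q) :
    ∏ j : Fin d, (1 + powSum α (γ j) q) = ENNReal.ofReal (zetaProd d α γ q) := by
  have h0 : ∀ j : Fin d, 0 ≤ 2 * γ j ^ q * (riemannZeta ((α * q : ℝ) : ℂ)).re := fun j =>
    mul_nonneg (mul_nonneg two_pos.le (Real.rpow_nonneg (hγ j).le _)) (zeta_re_nonneg hq)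
  rw [zetaProd, ENNReal.ofReal_prod_of_nonneg fun j _ => by linarith [h0 j]]
  refine Finset.prod_congr rfl fun j _ => ?_
  rw [powSum_eq (hγ j) hq, ENNReal.ofReal_add zero_le_one (h0 j), ENNReal.ofReal_one]

theorem rWeight_dual_le {d : ℕ} {α : ℝ} (hα : 1 / 2 < α) {γ : ℕ → ℝ} (hγ : ∀ j, 0 < γ j)
    {q : ℝ} (hq : 1 < α * q) (hq0 : 0 < q) (hq2 : q ≤ 2) {N : ℕ} (hN : N.Prime)
    {g : Fin d → ℤ} (hg : IsCBC α γ N g) {h : Fin d → ℤ} (h0 : h ≠ 0)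
    (hh : idot h g ≡ 0 [ZMOD N]) :
    (N : ℝ) * rWeight α γ h ^ (-q) ≤ 4 * zetaProd d α γ q := by
  have := wgt_dual_le hα hγ hq hq0 hq2 hN hg h0 hh
  have hz := one_le_zetaProd d hγ hq
  rw [prod_powSum_eq d hγ hq, wgt, ← ENNReal.ofReal_natCast,
    ← ENNReal.ofReal_mul (by positivity), ← ENNReal.ofReal_ofNat,
    ← ENNReal.ofReal_mul (by positivity)] at this
  exact (ENNReal.ofReal_le_ofReal_iff (by linarith)).mp this

/-! ### The truncation parameter -/

/-- The function whose supremum is the truncation parameter. -/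
def truncFun (d : ℕ) (α : ℝ) (γ : ℕ → ℝ) (N : ℕ) (q : ℝ) : ℝ :=
  ((N : ℝ) / 2 * (zetaProd d α γ q)⁻¹) ^ (1 / q)

theorem truncM_eq (d : ℕ) (α : ℝ) (γ : ℕ → ℝ) (N : ℕ) :
    truncM d α γ N = sSup (truncFun d α γ N '' Set.Ioc (1 / α) 2) := by
  simp only [truncM, truncFun, zetaProd, Finset.prod_inv_distrib]
  rfl

theorem one_lt_mul_of_mem {α q : ℝ} (hα : 0 < α) (hq : q ∈ Set.Ioc (1 / α) 2) :
    1 < α * q ∧ 0 < q := by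
  have h : 0 < 1 / α := by positivity
  refine ⟨?_, h.trans hq.1⟩
  have := hq.1
  rwa [div_lt_iff₀ hα, mul_comm] at this

theorem truncFun_le {d : ℕ} {α : ℝ} {γ : ℕ → ℝ} (hα : 0 < α) (hγ : ∀ j, 0 < γ j) (N : ℕ)
    {q : ℝ} (hq : q ∈ Set.Ioc (1 / α) 2) : truncFun d α γ N q ≤ (N : ℝ) ^ (1 / q) := by
  obtain ⟨h1, h2⟩ := one_lt_mul_of_mem hα hq
  have hz := one_le_zetaProd d hγ h1
  refine Real.rpow_le_rpow (by positivity) ?_ (by positivity)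
  have : (zetaProd d α γ q)⁻¹ ≤ 1 := inv_le_one_of_one_le₀ hz
  have hN : (0 : ℝ) ≤ N := by positivity
  nlinarith

theorem truncFun_le_rpow {d : ℕ} {α : ℝ} {γ : ℕ → ℝ} (hα : 0 < α) (hγ : ∀ j, 0 < γ j) {N : ℕ}
    (hN : 1 ≤ N) {q : ℝ} (hq : q ∈ Set.Ioc (1 / α) 2) : truncFun d α γ N q ≤ (N : ℝ) ^ α := by
  obtain ⟨h1, h2⟩ := one_lt_mul_of_mem hα hq
  refine (truncFun_le hα hγ N hq).trans ?_
  refine Real.rpow_le_rpow_of_exponent_le (by exact_mod_cast hN) ?_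
  rw [div_le_iff₀ h2]
  exact h1.le

theorem Ioc_nonempty {α : ℝ} (hα : 1 / 2 < α) : (2 : ℝ) ∈ Set.Ioc (1 / α) 2 := by
  refine ⟨?_, le_rfl⟩
  rw [div_lt_iff₀ (by linarith)]
  linarith

theorem truncM_le {d : ℕ} {α : ℝ} {γ : ℕ → ℝ} (hα : 1 / 2 < α) (hγ : ∀ j, 0 < γ j) {N : ℕ}
    (hN : 1 ≤ N) : truncM d α γ N ≤ (N : ℝ) ^ α := by
  rw [truncM_eq]
  refine csSup_le ⟨_, Set.mem_image_of_mem _ (Ioc_nonempty hα)⟩ ?_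
  rintro _ ⟨q, hq, rfl⟩
  exact truncFun_le_rpow (by linarith) hγ hN hq

theorem truncFun_le_truncM {d : ℕ} {α : ℝ} {γ : ℕ → ℝ} (hα : 0 < α) (hγ : ∀ j, 0 < γ j)
    {N : ℕ} (hN : 1 ≤ N) {q : ℝ} (hq : q ∈ Set.Ioc (1 / α) 2) :
    truncFun d α γ N q ≤ truncM d α γ N := by
  rw [truncM_eq]
  refine le_csSup ⟨(N : ℝ) ^ α, ?_⟩ (Set.mem_image_of_mem _ hq)
  rintro _ ⟨p, hp, rfl⟩
  exact truncFun_le_rpow hα hγ hN hp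

theorem exists_le_truncM {d : ℕ} {α : ℝ} {γ : ℕ → ℝ} (hα : 0 < α) (hγ : ∀ j, 0 < γ j) {q : ℝ}
    (hq : q ∈ Set.Ioc (1 / α) 2) :
    ∃ c : ℝ, 0 < c ∧ ∀ N : ℕ, 1 ≤ N → c * (N : ℝ) ^ (1 / q) ≤ truncM d α γ N := by
  obtain ⟨h1, h2⟩ := one_lt_mul_of_mem hα hq
  have hz := one_le_zetaProd d hγ h1
  have hz0 : 0 < (1 / 2) * (zetaProd d α γ q)⁻¹ := by positivity
  refine ⟨((1 / 2) * (zetaProd d α γ q)⁻¹) ^ (1 / q), by positivity, fun N hN => ?_⟩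
  rw [← Real.mul_rpow hz0.le (by positivity)]
  refine le_trans (le_of_eq ?_) (truncFun_le_truncM hα hγ hN hq)
  rw [truncFun]
  ring_nf

theorem truncM_pos {d : ℕ} {α : ℝ} {γ : ℕ → ℝ} (hα : 1 / 2 < α) (hγ : ∀ j, 0 < γ j) {N : ℕ}
    (hN : 1 ≤ N) : 0 < truncM d α γ N := by
  obtain ⟨c, hc, h⟩ := exists_le_truncM (d := d) (by linarith) hγ (Ioc_nonempty hα)
  have : (0 : ℝ) < N := by exact_mod_cast hN
  exact lt_of_lt_of_le (by positivity) (h N hN)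

/-- Solving the dual bound for `N` leaves a constant `2`, whose `q`-th root is at most `2^α` because
`1/q < α`. So the constant is uniform in `q`, as a supremum over `q` requires. -/
theorem truncFun_le_of_rWeight {d : ℕ} {α : ℝ} {γ : ℕ → ℝ} (hα : 0 < α) (hγ : ∀ j, 0 < γ j)
    {N : ℕ} {q : ℝ} (hq : q ∈ Set.Ioc (1 / α) 2) {r : ℝ} (hr : 0 < r)
    (h : (N : ℝ) * r ^ (-q) ≤ 4 * zetaProd d α γ q) : truncFun d α γ N q ≤ 2 ^ α * r := by
  obtain ⟨h1, h2⟩ := one_lt_mul_of_mem hα hq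
  have hz := one_le_zetaProd d hγ h1
  have hz0 : 0 < zetaProd d α γ q := by linarith
  have hrq : 0 < r ^ q := Real.rpow_pos_of_pos hr q
  have h3 : (N : ℝ) / 2 * (zetaProd d α γ q)⁻¹ ≤ 2 * r ^ q := by
    rw [Real.rpow_neg hr.le, ← div_eq_mul_inv, div_le_iff₀ hrq] at h
    rw [← div_eq_mul_inv, div_le_iff₀ hz0]
    linarith
  calc truncFun d α γ N q ≤ (2 * r ^ q) ^ (1 / q) :=
        Real.rpow_le_rpow (by positivity) h3 (by positivity)
    _ = 2 ^ (1 / q) * r := by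
        rw [Real.mul_rpow two_pos.le hrq.le, ← Real.rpow_mul hr.le, mul_one_div_cancel h2.ne',
          Real.rpow_one]
    _ ≤ 2 ^ α * r := by
        gcongr
        · norm_num
        · rw [div_le_iff₀ h2]
          exact h1.le

/-- Taking a positive power commutes with `max 1`, so the construction with smoothness `⌊α⌋` works
with a power of the original weight, and its dual bounds carry over. -/
theorem rWeight_rescale {d : ℕ} {α a : ℝ} {γ : ℕ → ℝ} (hα : 0 < α) (ha : 0 < a)
    (hγ : ∀ j, 0 < γ j) (k : Fin d → ℤ) :
    rWeight a (fun j => γ j ^ (a / α)) k = rWeight α γ k ^ (a / α) := by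
  rw [rWeight_eq_prod, rWeight_eq_prod, ← Real.finsetProd_rpow _ _ fun i _ => (rho_pos _ _ _).le]
  refine Finset.prod_congr rfl fun j _ => ?_
  have h0 : 0 ≤ |(k j : ℝ)| ^ α / γ j :=
    div_nonneg (Real.rpow_nonneg (abs_nonneg _) _) (hγ j).le
  have h1 : (|(k j : ℝ)| ^ α / γ j) ^ (a / α) = |(k j : ℝ)| ^ a / γ j ^ (a / α) := by
    rw [Real.div_rpow (Real.rpow_nonneg (abs_nonneg _) _) (hγ j).le,
      ← Real.rpow_mul (abs_nonneg _), mul_div_cancel₀ _ hα.ne']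
  rw [rho, rho, ← h1]
  rcases le_total 1 (|(k j : ℝ)| ^ α / γ j) with h | h
  · rw [max_eq_right h, max_eq_right]
    exact Real.one_le_rpow h (by positivity)
  · rw [max_eq_left h, max_eq_left, Real.one_rpow]
    exact Real.rpow_le_one h0 h (by positivity)

theorem zetaProd_rescale {d : ℕ} {α a : ℝ} {γ : ℕ → ℝ} (hα : 0 < α) (ha : 0 < a)
    (hγ : ∀ j, 0 < γ j) (q : ℝ) :
    zetaProd d a (fun j => γ j ^ (a / α)) (α * q / a) = zetaProd d α γ q := by
  rw [zetaProd, zetaProd]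
  refine Finset.prod_congr rfl fun j _ => ?_
  have h1 : a * (α * q / a) = α * q := by field_simp
  have h2 : a / α * (α * q / a) = q := by field_simp
  rw [← Real.rpow_mul (hγ j).le, h1, h2]

/-- The exponent `q` for `r_{α,γ}` corresponds to `αq/a` for the rescaled weight. The restriction `q
≤ 2a/α` says that the latter is at most `2`, as Jensen's inequality requires. -/
theorem rWeight_dual_le_rescale {d : ℕ} {α a : ℝ} {γ : ℕ → ℝ} (hα : 0 < α) (ha : 1 / 2 < a)
    (hγ : ∀ j, 0 < γ j) {q : ℝ} (hq : 1 < α * q) (hqa : q ≤ 2 * a / α) {N : ℕ} (hN : N.Prime)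
    {g : Fin d → ℤ} (hg : IsCBC a (fun j => γ j ^ (a / α)) N g) {h : Fin d → ℤ} (h0 : h ≠ 0)
    (hh : idot h g ≡ 0 [ZMOD N]) :
    (N : ℝ) * rWeight α γ h ^ (-q) ≤ 4 * zetaProd d α γ q := by
  have ha0 : 0 < a := by linarith
  have h1 : a * (α * q / a) = α * q := by field_simp
  have hq0 : 0 < α * q / a := div_pos (by linarith) ha0
  have h3 : α * q / a ≤ 2 := by
    rw [div_le_iff₀ ha0]
    rwa [le_div_iff₀ hα, mul_comm] at hqa
  have := rWeight_dual_le ha (γ := fun j => γ j ^ (a / α)) (fun j => Real.rpow_pos_of_pos (hγ j) _)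
    (q := α * q / a) (by rw [h1]; exact hq) hq0 h3 hN hg h0 hh
  rw [zetaProd_rescale hα ha0 hγ, rWeight_rescale hα ha0 hγ,
    ← Real.rpow_mul (rWeight_pos _ _ _).le] at this
  rwa [show a / α * -(α * q / a) = -q by field_simp] at this

/-- Nonzero vectors of the dual lattice have weight at least a constant multiple of the truncation
parameter. -/
theorem exists_truncM_le_rWeight (d : ℕ) {α : ℝ} (hα : 1 / 2 < α) {γ : ℕ → ℝ}
    (hγ : ∀ j, 0 < γ j) :
    ∃ c : ℝ, 0 < c ∧ c ≤ 1 ∧ ∀ N : ℕ, N.Prime → ∀ g : Fin d → ℤ, IsGeneratingVector α γ N g →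
      ∀ h : Fin d → ℤ, h ≠ 0 → idot h g ≡ 0 [ZMOD N] →
        c * truncM d α γ N ≤ rWeight α γ h := by
  have hα0 : 0 < α := by linarith
  -- The largest exponent that the construction with smoothness `⌊α⌋` can handle.
  set q₀ : ℝ := 2 * (⌊α⌋ : ℝ) / α with hq₀
  -- `2 ^ α` serves the exponents accessible to the construction, the last term those above `q₀`,
  -- and `1` ensures `K⁻¹ ≤ 1`. If `⌊α⌋ = 0` the last term is a zeroth power, hence `1`.
  set K : ℝ := max 1 (max (2 ^ α) ((4 * zetaProd d α γ q₀) ^ (1 / q₀))) with hK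
  have hK1 : 1 ≤ K := le_max_left _ _
  have key : ∀ N : ℕ, N.Prime → ∀ g : Fin d → ℤ, IsGeneratingVector α γ N g →
      ∀ h : Fin d → ℤ, h ≠ 0 → idot h g ≡ 0 [ZMOD N] →
        truncM d α γ N ≤ K * rWeight α γ h := by
    intro N hN g hg h h0 hh
    have hr := rWeight_pos α γ h
    have hgen : ∀ q ∈ Set.Ioc (1 / α) 2,
        (N : ℝ) * rWeight α γ h ^ (-q) ≤ 4 * zetaProd d α γ q →
        truncFun d α γ N q ≤ K * rWeight α γ h := by
      intro q hq hle
      refine (truncFun_le_of_rWeight hα0 hγ hq hr hle).trans ?_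
      gcongr
      exact (le_max_left _ _).trans (le_max_right _ _)
    rw [truncM_eq]
    refine csSup_le ⟨_, Set.mem_image_of_mem _ (Ioc_nonempty hα)⟩ ?_
    rintro _ ⟨q, hq, rfl⟩
    obtain ⟨h1, h2⟩ := one_lt_mul_of_mem hα0 hq
    rcases hg with hg | ⟨hα1, hg⟩
    · exact hgen q hq (rWeight_dual_le hα hγ h1 h2 hq.2 hN hg h0 hh)
    · have ha : (1 : ℝ) ≤ (⌊α⌋ : ℝ) := by exact_mod_cast Int.le_floor.mpr (by simpa using hα1)
      have ha' : (1 : ℝ) / 2 < (⌊α⌋ : ℝ) := by linarith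
      rcases le_or_gt q q₀ with hqq | hqq
      · exact hgen q hq (rWeight_dual_le_rescale hα0 ha' hγ h1 hqq hN hg h0 hh)
      -- For `q > q₀` the trivial bound `N^(1/q) ≤ N^(1/q₀)` suffices, with the dual bound taken at
      -- `q₀`.
      · have hq₀0 : 0 < q₀ := by positivity
        have hq₀1 : 1 < α * q₀ := by
          rw [hq₀, mul_div_cancel₀ _ hα0.ne']
          linarith
        have h3 := rWeight_dual_le_rescale hα0 ha' hγ hq₀1 le_rfl hN hg h0 hh
        have hz := one_le_zetaProd d hγ hq₀1
        have hrq : 0 < rWeight α γ h ^ q₀ := Real.rpow_pos_of_pos hr _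
        rw [Real.rpow_neg hr.le, ← div_eq_mul_inv, div_le_iff₀ hrq] at h3
        calc truncFun d α γ N q ≤ (N : ℝ) ^ (1 / q) := truncFun_le hα0 hγ N hq
          _ ≤ (N : ℝ) ^ (1 / q₀) := Real.rpow_le_rpow_of_exponent_le
              (by exact_mod_cast hN.one_le) (one_div_le_one_div_of_le hq₀0 hqq.le)
          _ ≤ (4 * zetaProd d α γ q₀ * rWeight α γ h ^ q₀) ^ (1 / q₀) :=
              Real.rpow_le_rpow (by positivity) h3 (by positivity)
          _ = (4 * zetaProd d α γ q₀) ^ (1 / q₀) * rWeight α γ h := by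
              rw [Real.mul_rpow (by positivity) hrq.le, ← Real.rpow_mul hr.le,
                mul_one_div_cancel hq₀0.ne', Real.rpow_one]
          _ ≤ K * rWeight α γ h := by
              gcongr
              exact (le_max_right _ _).trans (le_max_right _ _)
  refine ⟨K⁻¹, by positivity, inv_le_one_of_one_le₀ hK1, fun N hN g hg h h0 hh => ?_⟩
  rw [inv_mul_le_iff₀ (by positivity)]
  exact key N hN g hg h h0 hh

/-! ### Packing of separated sets of frequencies -/

/-- The dyadic sizes of the entries of a frequency. -/
def dyad {d : ℕ} (h : Fin d → ℤ) (j : Fin d) : ℕ := Nat.size (h j).natAbs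

/-- A constant with `r(h) ≤ Γ 2^{α |m|}` if `|h_j| < 2^{m_j}` for all `j`. -/
def upConst (d : ℕ) (γ : ℕ → ℝ) : ℝ := ∏ j : Fin d, max 1 (1 / γ j)

/-- A constant `c` with `c 2^{α |m|} ≤ r(h)` for the dyadic size `m` of `h`. -/
def lowConst (d : ℕ) (α : ℝ) (γ : ℕ → ℝ) : ℝ := ∏ j : Fin d, min 1 (1 / (2 ^ α * γ j))

theorem upConst_pos (d : ℕ) (γ : ℕ → ℝ) : 0 < upConst d γ :=
  Finset.prod_pos fun _ _ => lt_of_lt_of_le one_pos (le_max_left _ _)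

theorem lowConst_pos (d : ℕ) (α : ℝ) {γ : ℕ → ℝ} (hγ : ∀ j, 0 < γ j) : 0 < lowConst d α γ :=
  Finset.prod_pos fun j _ => lt_min one_pos (by have := hγ j; positivity)

theorem rWeight_le_of_abs_lt {d : ℕ} {α : ℝ} (hα : 0 < α) {γ : ℕ → ℝ} (hγ : ∀ j, 0 < γ j)
    {h : Fin d → ℤ} {m : Fin d → ℕ} (hm : ∀ j, |h j| < 2 ^ m j) :
    rWeight α γ h ≤ upConst d γ * ((2 : ℝ) ^ α) ^ ∑ j, m j := by
  rw [rWeight_eq_prod, upConst, ← Finset.prod_pow_eq_pow_sum, ← Finset.prod_mul_distrib]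
  refine Finset.prod_le_prod (fun j _ => (rho_pos _ _ _).le) fun j _ => ?_
  have h2 : (1 : ℝ) ≤ 2 ^ α := Real.one_le_rpow one_le_two hα.le
  have h1 : (1 : ℝ) ≤ ((2 : ℝ) ^ α) ^ m j := one_le_pow₀ h2
  have h3 : |(h j : ℝ)| ^ α ≤ ((2 : ℝ) ^ α) ^ m j := by
    rw [← Real.rpow_natCast, ← Real.rpow_mul two_pos.le, mul_comm, Real.rpow_mul two_pos.le,
      Real.rpow_natCast]
    refine Real.rpow_le_rpow (abs_nonneg _) ?_ hα.le
    exact_mod_cast (hm j).le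
  have h4 := hγ j
  refine max_le ?_ ?_
  · calc (1 : ℝ) = 1 * 1 := by ring
      _ ≤ _ := mul_le_mul (le_max_left _ _) h1 zero_le_one (by positivity)
  · calc |(h j : ℝ)| ^ α / γ j = 1 / γ j * |(h j : ℝ)| ^ α := by ring
      _ ≤ _ := mul_le_mul (le_max_right _ _) h3 (by positivity) (by positivity)

theorem le_rWeight_dyad {d : ℕ} {α : ℝ} (hα : 0 < α) {γ : ℕ → ℝ} (hγ : ∀ j, 0 < γ j)
    (h : Fin d → ℤ) : lowConst d α γ * ((2 : ℝ) ^ α) ^ ∑ j, dyad h j ≤ rWeight α γ h := by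
  rw [rWeight_eq_prod, lowConst, ← Finset.prod_pow_eq_pow_sum, ← Finset.prod_mul_distrib]
  have hb : (0 : ℝ) < 2 ^ α := by positivity
  refine Finset.prod_le_prod (fun j _ => ?_) fun j _ => ?_
  · have := hγ j
    positivity
  have h4 := hγ j
  rcases Nat.eq_zero_or_pos (dyad h j) with h0 | h0
  · rw [h0, pow_zero, mul_one]
    exact (min_le_left _ _).trans (one_le_rho _ _ _)
  · obtain ⟨m, hm⟩ := Nat.exists_eq_add_of_le' h0
    -- Binary size `m + 1` gives only `2^m ≤ |h_j|`; the missing factor `2^α` sits in `lowConst`.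
    have h1 : 2 ^ m ≤ (h j).natAbs := Nat.lt_size.mp (by rw [dyad] at hm; lia)
    have h2 : ((2 : ℝ) ^ α) ^ m ≤ |(h j : ℝ)| ^ α := by
      rw [← Real.rpow_natCast, ← Real.rpow_mul two_pos.le, mul_comm, Real.rpow_mul two_pos.le,
        Real.rpow_natCast]
      refine Real.rpow_le_rpow (by positivity) ?_ hα.le
      rw [← Int.cast_abs, Int.abs_eq_natAbs]
      exact_mod_cast h1
    rw [hm]
    calc min 1 (1 / (2 ^ α * γ j)) * ((2 : ℝ) ^ α) ^ (m + 1)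
        ≤ 1 / (2 ^ α * γ j) * ((2 : ℝ) ^ α) ^ (m + 1) := by
          gcongr
          exact min_le_right _ _
      _ = ((2 : ℝ) ^ α) ^ m / γ j := by
          field_simp
          ring
      _ ≤ |(h j : ℝ)| ^ α / γ j := by gcongr
      _ ≤ rho α (γ j) (h j) := le_max_right _ _

theorem abs_lt_two_pow_dyad {d : ℕ} (h : Fin d → ℤ) (j : Fin d) : |h j| < 2 ^ dyad h j := by
  have := Nat.lt_size_self (h j).natAbs
  rw [Int.abs_eq_natAbs]
  exact_mod_cast this

theorem exists_le_sum_eq {d : ℕ} (m : Fin d → ℕ) : ∀ n : ℕ, n ≤ ∑ j, m j →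
    ∃ m' : Fin d → ℕ, (∀ j, m' j ≤ m j) ∧ ∑ j, m' j = n
  | 0, _ => ⟨0, fun _ => Nat.zero_le _, by simp⟩
  | n + 1, hn => by
    obtain ⟨m', h1, h2⟩ := exists_le_sum_eq m n (by lia)
    obtain ⟨i, -, hi⟩ : ∃ i ∈ Finset.univ, m' i < m i := by
      apply Finset.exists_lt_of_sum_lt
      lia
    refine ⟨Function.update m' i (m' i + 1), fun j => ?_, ?_⟩
    · by_cases hj : j = i
      · subst hj
        simpa using hi
      · rw [Function.update_of_ne hj]
        exact h1 j
    · rw [Finset.sum_update_of_mem (Finset.mem_univ i)]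
      rw [← Finset.add_sum_erase _ _ (Finset.mem_univ i), ← Finset.sdiff_singleton_eq_erase] at h2
      lia

theorem exists_ge_sum_eq {d : ℕ} (hd : 1 ≤ d) (m : Fin d → ℕ) {n : ℕ} (hn : ∑ j, m j ≤ n) :
    ∃ m' : Fin d → ℕ, (∀ j, m j ≤ m' j) ∧ ∑ j, m' j = n := by
  let i : Fin d := ⟨0, hd⟩
  refine ⟨Function.update m i (m i + (n - ∑ j, m j)), fun j => ?_, ?_⟩
  · by_cases hj : j = i
    · subst hj
      simp
    · rw [Function.update_of_ne hj]
  · rw [Finset.sum_update_of_mem (Finset.mem_univ i)]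
    rw [← Finset.add_sum_erase _ _ (Finset.mem_univ i), ← Finset.sdiff_singleton_eq_erase] at hn ⊢
    lia

/-- The box is cut into sub-boxes with sides `2 ^ m' j`. Two points in one sub-box differ by a
vector of weight below `M₀`, so they coincide. Each coordinate range `(-2^m, 2^m)` has `2 ·
2^(m-m')` pieces, which yields the factor `2 ^ d`. -/
theorem card_le_of_separated_aux {d : ℕ} {α : ℝ} (hα : 0 < α) {γ : ℕ → ℝ} (hγ : ∀ j, 0 < γ j)
    {P : Finset (Fin d → ℤ)} {M₀ : ℝ} (hP : ∀ x ∈ P, ∀ y ∈ P, rWeight α γ (x - y) < M₀ → x = y)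
    {m m' : Fin d → ℕ} (hPm : ∀ h ∈ P, ∀ j, |h j| < 2 ^ m j) (hm : ∀ j, m' j ≤ m j)
    (hm' : ∑ j, m' j = 0 ∨ upConst d γ * ((2 : ℝ) ^ α) ^ ∑ j, m' j < M₀) :
    P.card ≤ 2 ^ d * 2 ^ (∑ j, m j - ∑ j, m' j) := by
  classical
  have hcard : (Fintype.piFinset fun j : Fin d =>
      Finset.Ico (-2 ^ (m j - m' j) : ℤ) (2 ^ (m j - m' j))).card =
      2 ^ d * 2 ^ (∑ j, m j - ∑ j, m' j) := by
    have hs : ∑ j, m j - ∑ j, m' j = ∑ j, (m j - m' j) :=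
      (Finset.sum_tsub_distrib _ fun j _ => hm j).symm
    rw [Fintype.card_piFinset, hs, ← Finset.prod_pow_eq_pow_sum]
    conv_rhs => rw [show (2 : ℕ) ^ d = ∏ _j : Fin d, 2 by simp]
    rw [← Finset.prod_mul_distrib]
    refine Finset.prod_congr rfl fun j _ => ?_
    rw [Int.card_Ico]
    zify
    have h0 : (0 : ℤ) ≤ 2 ^ (m j - m' j) := by positivity
    rw [Int.toNat_of_nonneg (by linarith)]
    ring
  rw [← hcard]
  refine Finset.card_le_card_of_injOn (fun h j => h j / 2 ^ m' j) ?_ ?_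
  · intro h hh
    rw [Finset.mem_coe, Fintype.mem_piFinset]
    intro j
    have h1 := abs_lt.mp (hPm h hh j)
    have h2 : (2 : ℤ) ^ m j = 2 ^ (m j - m' j) * 2 ^ m' j := by
      rw [← pow_add, Nat.sub_add_cancel (hm j)]
    have h3 : (0 : ℤ) < 2 ^ m' j := by positivity
    rw [Finset.mem_Ico]
    constructor
    · rw [Int.le_ediv_iff_mul_le h3]
      linarith
    · rw [Int.ediv_lt_iff_lt_mul h3]
      linarith
  · intro x hx y hy hxy
    have hlt : ∀ j, |(x - y) j| < 2 ^ m' j := by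
      intro j
      have h1 : x j / 2 ^ m' j = y j / 2 ^ m' j := congrFun hxy j
      have h3 : (0 : ℤ) < 2 ^ m' j := by positivity
      have hx1 := Int.emod_nonneg (x j) h3.ne'
      have hy1 := Int.emod_nonneg (y j) h3.ne'
      have hx2 := Int.emod_lt_of_pos (x j) h3
      have hy2 := Int.emod_lt_of_pos (y j) h3
      have hx3 := Int.mul_ediv_add_emod (x j) (2 ^ m' j)
      have hy3 := Int.mul_ediv_add_emod (y j) (2 ^ m' j)
      rw [h1] at hx3
      rw [Pi.sub_apply, abs_lt]
      constructor <;> linarith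
    -- If all `m' j` vanish, the sub-boxes are single points and separation is not needed.
    rcases hm' with h0 | h0
    · funext j
      have hj : m' j = 0 := (Finset.sum_eq_zero_iff.mp h0) j (Finset.mem_univ j)
      have := hlt j
      rw [hj, pow_zero, Int.abs_lt_one_iff, Pi.sub_apply] at this
      lia
    · exact hP x hx y hy ((rWeight_le_of_abs_lt hα hγ hlt).trans_lt h0)

theorem two_pow_eq_rpow {α : ℝ} (hα : 0 < α) (n : ℕ) :
    (2 : ℝ) ^ n = (((2 : ℝ) ^ α) ^ n) ^ (1 / α) := by
  rw [← Real.rpow_natCast ((2 : ℝ) ^ α) n, ← Real.rpow_mul two_pos.le, ← Real.rpow_mul two_pos.le,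
    show α * n * (1 / α) = n by field_simp, Real.rpow_natCast]

/-- A dyadic box contains few points of a set whose distinct elements have differences of large
weight. -/
theorem card_le_of_separated {d : ℕ} {α : ℝ} (hα : 0 < α) {γ : ℕ → ℝ} (hγ : ∀ j, 0 < γ j)
    {P : Finset (Fin d → ℤ)} {M₀ : ℝ} (hM₀ : 0 < M₀)
    (hP : ∀ x ∈ P, ∀ y ∈ P, rWeight α γ (x - y) < M₀ → x = y)
    {m : Fin d → ℕ} (hPm : ∀ h ∈ P, ∀ j, |h j| < 2 ^ m j) :
    (P.card : ℝ) ≤ 2 ^ d * max 1 (2 ^ (∑ j, m j) * (2 * (upConst d γ / M₀) ^ (1 / α))) := by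
  classical
  -- The sub-boxes are taken as large as separation permits; `n = 0` is always admissible.
  -- Maximality bounds `2^(n+1)` from below.
  set p : ℕ → Prop := fun n => n = 0 ∨ upConst d γ * ((2 : ℝ) ^ α) ^ n < M₀ with hp
  set n := Nat.findGreatest p (∑ j, m j) with hn
  have hnp : p n := Nat.findGreatest_spec (Nat.zero_le _) (Or.inl rfl)
  have hnm : n ≤ ∑ j, m j := Nat.findGreatest_le _
  obtain ⟨m', h1, h2⟩ := exists_le_sum_eq m n hnm
  have hc := card_le_of_separated_aux hα hγ hP hPm h1 (by rw [h2]; exact hnp)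
  rw [h2] at hc
  have hc' : (P.card : ℝ) ≤ 2 ^ d * 2 ^ (∑ j, m j - n) := by exact_mod_cast hc
  refine hc'.trans ?_
  gcongr
  rcases hnm.eq_or_lt with he | hlt
  · rw [← he]
    simp
  · refine le_trans ?_ (le_max_right _ _)
    have h3 : ¬ p (n + 1) := Nat.findGreatest_is_greatest (Nat.lt_succ_self n) hlt
    rw [hp] at h3
    push Not at h3
    have h4 : M₀ / upConst d γ ≤ ((2 : ℝ) ^ α) ^ (n + 1) := by
      rw [div_le_iff₀ (upConst_pos d γ), mul_comm]
      exact h3.2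
    have h5 : (M₀ / upConst d γ) ^ (1 / α) ≤ 2 ^ (n + 1) := by
      rw [two_pow_eq_rpow hα]
      exact Real.rpow_le_rpow (div_nonneg hM₀.le (upConst_pos d γ).le) h4 (by positivity)
    have h6 : (upConst d γ / M₀) ^ (1 / α) = ((M₀ / upConst d γ) ^ (1 / α))⁻¹ := by
      rw [← Real.inv_rpow (div_nonneg hM₀.le (upConst_pos d γ).le), inv_div]
    have h7 : 0 < (M₀ / upConst d γ) ^ (1 / α) :=
      Real.rpow_pos_of_pos (div_pos hM₀ (upConst_pos d γ)) _
    have h8 : (2 : ℝ) ^ (∑ j, m j) = 2 ^ (∑ j, m j - n) * 2 ^ n := by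
      rw [← pow_add, Nat.sub_add_cancel hnm]
    rw [h6, h8]
    have h9 : 1 ≤ 2 ^ n * (2 * ((M₀ / upConst d γ) ^ (1 / α))⁻¹) := by
      rw [← mul_assoc, ← pow_succ, ← div_eq_mul_inv, le_div_iff₀ h7, one_mul]
      exact h5
    calc (2 : ℝ) ^ (∑ j, m j - n) = 2 ^ (∑ j, m j - n) * 1 := by ring
      _ ≤ 2 ^ (∑ j, m j - n) * (2 ^ n * (2 * ((M₀ / upConst d γ) ^ (1 / α))⁻¹)) := by gcongr
      _ = _ := by ring

/-- The last entry is determined by the others. This is where the exponent `d - 1` of the fiber size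
comes from. -/
theorem card_piAntidiag_le {d : ℕ} (hd : 1 ≤ d) (n : ℕ) :
    (Finset.piAntidiag (Finset.univ : Finset (Fin d)) n).card ≤ (n + 1) ^ (d - 1) := by
  obtain ⟨d, rfl⟩ := Nat.exists_eq_add_of_le' hd
  have hc : (Fintype.piFinset fun _ : Fin d => Finset.range (n + 1)).card = (n + 1) ^ d := by
    simp
  rw [Nat.add_sub_cancel, ← hc]
  refine Finset.card_le_card_of_injOn (fun m i => m i.castSucc) ?_ ?_
  · intro m hm
    rw [Finset.mem_coe, Finset.mem_piAntidiag, Fin.sum_univ_castSucc] at hm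
    rw [Finset.mem_coe, Fintype.mem_piFinset]
    intro i
    rw [Finset.mem_range]
    have := Finset.single_le_sum (f := fun i : Fin d => m i.castSucc)
      (fun _ _ => Nat.zero_le _) (Finset.mem_univ i)
    have := hm.1
    lia
  · intro m hm m' hm' h
    rw [Finset.mem_coe, Finset.mem_piAntidiag, Fin.sum_univ_castSucc] at hm hm'
    have h1 : ∀ i : Fin d, m i.castSucc = m' i.castSucc := fun i => congrFun h i
    funext i
    refine Fin.lastCases ?_ h1 i
    have := hm.1.trans hm'.1.symm
    simp only [h1] at this
    exact Nat.add_left_cancel this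

/-- A separated subset of a hyperbolic cross has only logarithmically many elements. -/
theorem card_le_of_separated_cross {d : ℕ} (hd : 1 ≤ d) {α : ℝ} (hα : 0 < α) {γ : ℕ → ℝ}
    (hγ : ∀ j, 0 < γ j) {P : Finset (Fin d → ℤ)} {M c : ℝ} (hc : 0 < c)
    (hP : ∀ x ∈ P, ∀ y ∈ P, rWeight α γ (x - y) < c * M → x = y)
    (hPM : ∀ h ∈ P, rWeight α γ h < M) {L : ℕ} (hL : lowConst d α γ * ((2 : ℝ) ^ α) ^ L ≤ M)
    (hL' : M < lowConst d α γ * ((2 : ℝ) ^ α) ^ (L + 1)) :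
    (P.card : ℝ) ≤ ((L : ℝ) + 1) ^ (d - 1) *
      (2 ^ d * max 1 (2 * (upConst d γ / (c * lowConst d α γ)) ^ (1 / α))) := by
  classical
  have hlow := lowConst_pos d α hγ
  have hup := upConst_pos d γ
  have hM : 0 < M := lt_of_lt_of_le (by positivity) hL
  have hb : (1 : ℝ) < 2 ^ α := Real.one_lt_rpow one_lt_two hα
  set K : ℝ := 2 ^ d * max 1 (2 * (upConst d γ / (c * lowConst d α γ)) ^ (1 / α)) with hK
  -- Dyadic types may be enlarged until their entries add up to exactly `L`, so the boxes with `|m|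
  -- = L` already cover the cross.
  have hsub : P ⊆ (Finset.piAntidiag (Finset.univ : Finset (Fin d)) L).biUnion
      fun m => P.filter fun h => ∀ j, |h j| < 2 ^ m j := by
    intro h hh
    have h1 : ∑ j, dyad h j ≤ L := by
      have h2 := (le_rWeight_dyad hα hγ h).trans_lt ((hPM h hh).trans hL')
      have h3 := lt_of_mul_lt_mul_left h2 hlow.le
      exact Nat.lt_succ_iff.mp ((pow_lt_pow_iff_right₀ hb).mp h3)
    obtain ⟨m, hm, hm'⟩ := exists_ge_sum_eq hd (dyad h) h1
    rw [Finset.mem_biUnion]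
    refine ⟨m, by simp [Finset.mem_piAntidiag, hm'], Finset.mem_filter.mpr ⟨hh, fun j => ?_⟩⟩
    exact (abs_lt_two_pow_dyad h j).trans_le (pow_le_pow_right₀ one_le_two (hm j))
  have hbox : ∀ m ∈ Finset.piAntidiag (Finset.univ : Finset (Fin d)) L,
      ((P.filter fun h => ∀ j, |h j| < 2 ^ m j).card : ℝ) ≤ K := by
    intro m hm
    have hm : ∑ j, m j = L := (Finset.mem_piAntidiag.mp hm).1
    refine (card_le_of_separated hα hγ (M₀ := c * M) (by positivity) (m := m) ?_ ?_).trans ?_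
    · intro x hx y hy
      exact hP x (Finset.mem_filter.mp hx).1 y (Finset.mem_filter.mp hy).1
    · intro h hh
      exact (Finset.mem_filter.mp hh).2
    · rw [hK, hm]
      gcongr 2 ^ d * max 1 ?_
      -- The volume `2^L` and the separation scale are both proportional to `M^(1/α)`, so `M`
      -- cancels and each box holds boundedly many points.
      have h1 : (2 : ℝ) ^ L ≤ (M / lowConst d α γ) ^ (1 / α) := by
        rw [two_pow_eq_rpow hα]
        refine Real.rpow_le_rpow (by positivity) ?_ (by positivity)
        rw [le_div_iff₀ hlow, mul_comm]
        exact hL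
      calc (2 : ℝ) ^ L * (2 * (upConst d γ / (c * M)) ^ (1 / α))
          ≤ (M / lowConst d α γ) ^ (1 / α) * (2 * (upConst d γ / (c * M)) ^ (1 / α)) := by
            gcongr
        _ = 2 * ((M / lowConst d α γ) * (upConst d γ / (c * M))) ^ (1 / α) := by
            rw [Real.mul_rpow (by positivity) (by positivity)]
            ring
        _ = _ := by
            congr 2
            field_simp
  calc (P.card : ℝ) ≤ ∑ m ∈ Finset.piAntidiag (Finset.univ : Finset (Fin d)) L,
        ((P.filter fun h => ∀ j, |h j| < 2 ^ m j).card : ℝ) := by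
        exact_mod_cast (Finset.card_le_card hsub).trans Finset.card_biUnion_le
    _ ≤ (Finset.piAntidiag (Finset.univ : Finset (Fin d)) L).card • K :=
        Finset.sum_le_card_nsmul _ _ _ hbox
    _ ≤ ((L : ℝ) + 1) ^ (d - 1) * K := by
        rw [nsmul_eq_mul]
        gcongr
        exact_mod_cast card_piAntidiag_le hd L

/-- The tail of the weight sum over a separated set. -/
theorem tsum_wgt_separated_le (d : ℕ) {α : ℝ} (hα : 0 < α) {γ : ℕ → ℝ} (hγ : ∀ j, 0 < γ j)
    {c : ℝ} (hc : 0 < c) (hc1 : c ≤ 1) {q : ℝ} (hq : 1 < α * q) (hq2 : q ≤ 2) :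
    ∃ K : ℝ, 0 < K ∧ ∀ M : ℝ, 0 < M → ∀ P : (Fin d → ℤ) → Prop, DecidablePred P →
      (∀ x, P x → ∀ y, P y → rWeight α γ (x - y) < c * M → x = y) →
      (∀ h, P h → M ≤ rWeight α γ h) →
      ∑' h, Set.indicator {h | P h} (wgt α γ 2) h ≤
        ENNReal.ofReal (K * M ^ (q - 2 - 1 / α)) := by
  classical
  have hlow := lowConst_pos d α hγ
  have hup := upConst_pos d γ
  have hq0 : 0 < q := by
    by_contra h
    nlinarith
  set D : ℝ := 2 ^ d * (2 * (upConst d γ / c) ^ (1 / α)) * lowConst d α γ ^ (-q) with hD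
  have hD0 : 0 < D := by positivity
  -- The ratio of the geometric series over the dyadic types: `2^|m|` bounds the growth of the point
  -- count, `2^(-αq|m|)` the decay of the weights. It is below `1` since `αq > 1`.
  set ρ : ℝ := 2 * ((2 : ℝ) ^ α) ^ (-q) with hρ
  have hρ0 : 0 < ρ := by positivity
  have hρ1 : ρ < 1 := by
    rw [hρ, ← Real.rpow_mul two_pos.le]
    calc (2 : ℝ) * 2 ^ (α * -q) = 2 ^ (1 + α * -q) := by
          rw [Real.rpow_add two_pos, Real.rpow_one]
      _ < 1 := Real.rpow_lt_one_of_one_lt_of_neg one_lt_two (by linarith)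
  have hgeo : ∑' m : Fin d → ℕ, ENNReal.ofReal (ρ ^ ∑ j, m j) =
      ENNReal.ofReal (((1 - ρ)⁻¹) ^ d) := by
    have h1 : ∀ m : Fin d → ℕ, ENNReal.ofReal (ρ ^ ∑ j, m j) =
        ∏ j, ENNReal.ofReal (ρ ^ m j) := by
      intro m
      rw [← Finset.prod_pow_eq_pow_sum, ENNReal.ofReal_prod_of_nonneg]
      intro j _
      positivity
    simp_rw [h1]
    rw [tsum_pi_prod fun (_ : Fin d) n => ENNReal.ofReal (ρ ^ n)]
    rw [← ENNReal.ofReal_tsum_of_nonneg (fun n => by positivity)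
      (summable_geometric_of_lt_one hρ0.le hρ1), tsum_geometric_of_lt_one hρ0.le hρ1,
      Finset.prod_const, Finset.card_univ, Fintype.card_fin,
      ENNReal.ofReal_pow (inv_nonneg.mpr (by linarith))]
  refine ⟨D * ((1 - ρ)⁻¹) ^ d, mul_pos hD0 (pow_pos (inv_pos.mpr (by linarith)) _),
    fun M hM P _ hP hPM => ?_⟩
  set E : ℝ := D * M ^ (q - 2 - 1 / α) with hE
  have hE0 : 0 < E := by positivity
  have hinner : ∀ m : Fin d → ℕ,
      (∑' h : Fin d → ℤ, if m = dyad h then Set.indicator {h | P h} (wgt α γ 2) h else 0) ≤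
        ENNReal.ofReal (E * ρ ^ ∑ j, m j) := by
    intro m
    set F : Finset (Fin d → ℤ) :=
      (Fintype.piFinset fun j => Finset.Ioo (-2 ^ m j : ℤ) (2 ^ m j)).filter
        fun h => P h ∧ m = dyad h with hF
    have hbox : ∀ h : Fin d → ℤ, m = dyad h → h ∈
        Fintype.piFinset fun j => Finset.Ioo (-2 ^ m j : ℤ) (2 ^ m j) := by
      intro h hm
      rw [Fintype.mem_piFinset]
      intro j
      rw [Finset.mem_Ioo, ← abs_lt, hm]
      exact abs_lt_two_pow_dyad h j
    rw [tsum_eq_sum (s := F)]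
    · rcases F.eq_empty_or_nonempty with hemp | ⟨h₀, hh₀⟩
      · rw [hemp, Finset.sum_empty]
        exact zero_le
      · have hlt : ∀ h ∈ F, ∀ j, |h j| < 2 ^ m j := by
          intro h hh j
          have h2 := (Finset.mem_filter.mp hh).2.2
          rw [h2]
          exact abs_lt_two_pow_dyad h j
        have hcard := card_le_of_separated hα hγ (P := F) (M₀ := c * M) (by positivity)
          (fun x hx y hy => hP x (Finset.mem_filter.mp hx).2.1 y (Finset.mem_filter.mp hy).2.1) hlt
        -- A box that contains a point of weight at least `M` is so large, as `c ≤ 1`, that the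
        -- maximum in the packing bound is not `1`.
        have hone : (1 : ℝ) ≤ 2 ^ (∑ j, m j) * (2 * (upConst d γ / (c * M)) ^ (1 / α)) := by
          have h1 := (hPM h₀ (Finset.mem_filter.mp hh₀).2.1).trans
            (rWeight_le_of_abs_lt hα hγ (hlt h₀ hh₀))
          have h2 : 1 ≤ ((2 : ℝ) ^ α) ^ (∑ j, m j) * (upConst d γ / (c * M)) := by
            rw [← mul_div_assoc, le_div_iff₀ (by positivity)]
            nlinarith
          have h3 := Real.one_le_rpow h2 (z := 1 / α) (by positivity)
          rw [Real.mul_rpow (by positivity) (by positivity), ← two_pow_eq_rpow hα] at h3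
          nlinarith
        rw [max_eq_right hone] at hcard
        have hterm : ∀ h ∈ F,
            (if m = dyad h then Set.indicator {h | P h} (wgt α γ 2) h else 0) ≤
            ENNReal.ofReal (M ^ (q - 2) *
              (lowConst d α γ ^ (-q) * (((2 : ℝ) ^ α) ^ (-q)) ^ ∑ j, m j)) := by
          intro h hh
          obtain ⟨-, h1, h2⟩ := Finset.mem_filter.mp hh
          rw [if_pos h2, Set.indicator_of_mem (by exact h1), wgt]
          apply ENNReal.ofReal_le_ofReal
          have hr := rWeight_pos α γ h
          -- Splitting `r⁻² = r^(q-2) r^(-q)`: the first factor is small outside the cross, the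
          -- second is summable over the dyadic types. The remaining power `M^(-1/α)` comes from the
          -- packing count.
          calc rWeight α γ h ^ (-2 : ℝ) = rWeight α γ h ^ (q - 2) * rWeight α γ h ^ (-q) := by
                rw [← Real.rpow_add hr]
                ring_nf
            _ ≤ M ^ (q - 2) * (lowConst d α γ * ((2 : ℝ) ^ α) ^ ∑ j, m j) ^ (-q) := by
                refine mul_le_mul ?_ ?_ (by positivity) (by positivity)
                · exact Real.rpow_le_rpow_of_nonpos hM (hPM h h1) (by linarith)
                · refine Real.rpow_le_rpow_of_nonpos (by positivity) ?_ (by linarith)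
                  rw [h2]
                  exact le_rWeight_dyad hα hγ h
            _ = _ := by
                rw [Real.mul_rpow hlow.le (by positivity), Real.rpow_pow_comm (by positivity) (-q)]
        refine (Finset.sum_le_card_nsmul _ _ _ hterm).trans ?_
        rw [nsmul_eq_mul, ← ENNReal.ofReal_natCast, ← ENNReal.ofReal_mul (by positivity)]
        apply ENNReal.ofReal_le_ofReal
        calc _ ≤ 2 ^ d * (2 ^ (∑ j, m j) * (2 * (upConst d γ / (c * M)) ^ (1 / α))) *
              (M ^ (q - 2) * (lowConst d α γ ^ (-q) * (((2 : ℝ) ^ α) ^ (-q)) ^ ∑ j, m j)) := by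
              gcongr
          _ = E * ρ ^ ∑ j, m j := by
              rw [hE, hD, hρ, mul_pow, show upConst d γ / (c * M) = upConst d γ / c * M⁻¹ by
                field_simp, Real.mul_rpow (by positivity) (by positivity), Real.inv_rpow hM.le,
                ← Real.rpow_neg hM.le, sub_eq_add_neg (q - 2), Real.rpow_add hM]
              ring
    · intro h hh
      by_cases hm : m = dyad h
      · rw [if_pos hm, Set.indicator_of_notMem]
        intro hPh
        exact hh (Finset.mem_filter.mpr ⟨hbox h hm, hPh, hm⟩)
      · rw [if_neg hm]
  calc ∑' h, Set.indicator {h | P h} (wgt α γ 2) h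
      = ∑' h : Fin d → ℤ, ∑' m : Fin d → ℕ,
          if m = dyad h then Set.indicator {h | P h} (wgt α γ 2) h else 0 := by
        refine tsum_congr fun h => ?_
        rw [tsum_ite_eq]
    _ = ∑' m : Fin d → ℕ, ∑' h : Fin d → ℤ,
          if m = dyad h then Set.indicator {h | P h} (wgt α γ 2) h else 0 := ENNReal.tsum_comm
    _ ≤ ∑' m : Fin d → ℕ, ENNReal.ofReal (E * ρ ^ ∑ j, m j) := ENNReal.tsum_le_tsum hinner
    _ = ENNReal.ofReal (D * ((1 - ρ)⁻¹) ^ d * M ^ (q - 2 - 1 / α)) := by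
        simp_rw [ENNReal.ofReal_mul hE0.le]
        rw [ENNReal.tsum_mul_left, hgeo, ← ENNReal.ofReal_mul hE0.le, hE]
        ring_nf

/-! ### Primes -/

/-- The number of primes up to `x` is at most a constant multiple of `x / log x`. -/
theorem primeCounting_le_div_log {p : ℕ} (hp : 2 ≤ p) :
    (Nat.primeCounting p : ℝ) ≤ 5 * (p / Real.log p) := by
  have hp1 : (1 : ℝ) < p := by exact_mod_cast hp
  have h := Chebyshev.pi_le_log4_mul_div hp1
  have hlog : 0 < Real.log p := Real.log_pos hp1
  rw [Nat.floor_natCast, Real.log_sqrt (by positivity)] at h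
  have h4 : Real.log 4 ≤ 1.4 := by
    rw [show (4 : ℝ) = 2 ^ 2 by norm_num, Real.log_pow]
    have := Real.log_two_lt_d9
    push_cast
    linarith
  have h5 : √(p : ℝ) ≤ 2 * (p / Real.log p) := by
    have h6 : Real.log p ≤ 2 * √(p : ℝ) := by
      have h7 : Real.log √(p : ℝ) ≤ √(p : ℝ) - 1 := Real.log_le_sub_one_of_pos (by positivity)
      rw [Real.log_sqrt (by positivity)] at h7
      linarith
    rw [← mul_div_assoc, le_div_iff₀ hlog]
    have h8 := Real.mul_self_sqrt (show (0 : ℝ) ≤ p by positivity)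
    nlinarith [Real.sqrt_nonneg (p : ℝ)]
  have h9 : Real.log 4 * p / (Real.log p / 2) = 2 * Real.log 4 * (p / Real.log p) := by
    field_simp
  rw [h9] at h
  have h10 : 0 < p / Real.log p := by positivity
  nlinarith

/-- Chebyshev's lower bound. As `log (1024 p) ≤ 11 log p`, it is enough that its numerator exceed
`66 p`, for which `1024` is ample. -/
theorem lt_primeCounting_mul {p : ℕ} (hp : 2 ≤ p) :
    6 * (p / Real.log p) < Nat.primeCounting (1024 * p) := by
  have hp1 : (1 : ℝ) < p := by exact_mod_cast hp
  have hp2 : (2 : ℝ) ≤ p := by exact_mod_cast hp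
  have hlog : Real.log 2 ≤ Real.log p := Real.log_le_log two_pos hp2
  have hl2 := Real.log_two_gt_d9
  have hl3 := Real.log_two_lt_d9
  have h := Chebyshev.pi_ge (1024 * p)
  push_cast at h
  have h1 : Real.log (1024 * p) ≤ 11 * Real.log p := by
    rw [Real.log_mul (by norm_num) (by positivity), show (1024 : ℝ) = 2 ^ 10 by norm_num,
      Real.log_pow]
    push_cast
    linarith
  have h2 : Real.log (1024 * p + 1) ≤ 64 * p + 3 := by
    have h3 : Real.log ((1024 * p + 1) / 2 ^ 4) ≤ (1024 * p + 1) / 2 ^ 4 - 1 :=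
      Real.log_le_sub_one_of_pos (by positivity)
    rw [Real.log_div (by positivity) (by positivity), Real.log_pow] at h3
    push_cast at h3
    linarith
  have h0 : 0 < Real.log (1024 * p) := Real.log_pos (by linarith)
  refine lt_of_lt_of_le ?_ h
  rw [lt_div_iff₀ h0]
  have hlp : 0 < Real.log p := by linarith
  calc 6 * (p / Real.log p) * Real.log (1024 * p)
      ≤ 6 * (p / Real.log p) * (11 * Real.log p) := by gcongr
    _ = 66 * p := by field_simp; ring
    _ < _ := by nlinarith

/-- Short runs of consecutive primes stay within a constant factor. -/
theorem nth_prime_add_le {i k : ℕ}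
    (hk : (k : ℝ) ≤ 0.32 * (Nat.nth Nat.Prime i / Real.log (Nat.nth Nat.Prime i))) :
    Nat.nth Nat.Prime (i + k) ≤ 1024 * Nat.nth Nat.Prime i := by
  set p := Nat.nth Nat.Prime i with hp
  have hpp : p.Prime := Nat.prime_nth_prime i
  have h1 := primeCounting_le_div_log hpp.two_le
  have h2 := lt_primeCounting_mul hpp.two_le
  have hi : i ≤ Nat.primeCounting p := by
    have h3 : Nat.primeCounting' p = i := Nat.primeCounting'_nth_eq i
    rw [← h3]
    exact Nat.monotone_primeCounting' (Nat.le_succ p)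
  -- The constants close up because `5 + 0.32 < 6`.
  have hlt : i + k < Nat.primeCounting (1024 * p) := by
    have hi' : (i : ℝ) ≤ Nat.primeCounting p := by exact_mod_cast hi
    have hpos : (0 : ℝ) ≤ p / Real.log p :=
      div_nonneg (by positivity) (Real.log_natCast_nonneg p)
    have : ((i + k : ℕ) : ℝ) < Nat.primeCounting (1024 * p) := by
      push_cast
      linarith
    exact_mod_cast this
  exact Nat.lt_succ_iff.mp (Nat.nth_lt_of_lt_count hlt)

/-- Bertrand's postulate; the summand `2` takes care of `n = 0`. -/
theorem nth_count_prime_le (n : ℕ) : Nat.nth Nat.Prime (Nat.primeCounting' n) ≤ 2 * n + 2 := by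
  obtain ⟨q, hq, h1, h2⟩ : ∃ q : ℕ, q.Prime ∧ n ≤ q ∧ q ≤ 2 * n + 2 := by
    rcases Nat.eq_zero_or_pos n with rfl | hn
    · exact ⟨2, Nat.prime_two, by lia, by lia⟩
    · obtain ⟨q, hq, h1, h2⟩ := Nat.exists_prime_lt_and_le_two_mul n hn.ne'
      exact ⟨q, hq, h1.le, by lia⟩
  calc Nat.nth Nat.Prime (Nat.primeCounting' n)
      ≤ Nat.nth Nat.Prime (Nat.primeCounting' q) :=
        Nat.nth_monotone Nat.infinite_setOfPred_prime (Nat.monotone_primeCounting' h1)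
    _ = q := Nat.nth_count hq
    _ ≤ _ := h2

/-- A positive number `≤ V` has at most `log V / log b` divisors in a set of primes `≥ b`. -/
theorem card_prime_dvd_mul_log_le {b n V : ℕ} (hb : 1 ≤ b) (hn : n ≠ 0) (hnV : n ≤ V)
    (s : Finset ℕ) (p : ℕ → ℕ) (hp : ∀ j, (p j).Prime) (hinj : Function.Injective p)
    (hbp : ∀ j, b ≤ p j) :
    ((s.filter fun j => p j ∣ n).card : ℝ) * Real.log b ≤ Real.log V := by
  have h1 : ∏ j ∈ s.filter (fun j => p j ∣ n), p j ∣ n := by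
    refine Finset.prod_dvd_of_isRelPrime ?_ fun j hj => (Finset.mem_filter.mp hj).2
    intro i _ j _ hij
    exact Nat.coprime_iff_isRelPrime.mp
      ((Nat.coprime_primes (hp i) (hp j)).mpr fun h => hij (hinj h))
  have h2 : b ^ (s.filter fun j => p j ∣ n).card ≤ V := by
    refine le_trans ?_ ((Nat.le_of_dvd (Nat.pos_of_ne_zero hn) h1).trans hnV)
    exact Finset.pow_card_le_prod _ _ _ fun j _ => hbp j
  rw [← Real.log_pow]
  refine Real.log_le_log (by positivity) ?_
  exact_mod_cast h2

/-! ### The primes of the initial shift set -/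

/-- The lower bound `2 (R-1) ln V / (0.32 t)` for the first prime. -/
def crtBound (R V : ℕ) (t : ℝ) : ℝ := 2 * ((R : ℝ) - 1) * Real.log V / (0.32 * t)

/-- The primes from `p_1` on. -/
def crtPrime (R V : ℕ) (t : ℝ) (j : ℕ) : ℕ := Nat.nth Nat.Prime (crtIndex R V t + j)

/-- The number of primes. -/
def crtCount (R V : ℕ) (t : ℝ) : ℕ :=
  max 1 ⌈2 * ((R : ℝ) - 1) * Real.log V / (t * Real.log (crtPrime R V t 0))⌉₊

theorem crtPrimes_eq (R V : ℕ) (t : ℝ) :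
    crtPrimes R V t = (List.range (crtCount R V t)).map (crtPrime R V t) := rfl

theorem crtPrime_prime (R V : ℕ) (t : ℝ) (j : ℕ) : (crtPrime R V t j).Prime :=
  Nat.prime_nth_prime _

theorem crtPrime_strictMono (R V : ℕ) (t : ℝ) : StrictMono (crtPrime R V t) := fun _ _ h =>
  Nat.nth_strictMono Nat.infinite_setOfPred_prime (Nat.add_lt_add_left h _)

theorem crtBound_nonneg {R : ℕ} (hR : 1 ≤ R) (V : ℕ) {t : ℝ} (ht : 0 < t) :
    0 ≤ crtBound R V t := by
  have h1 : (1 : ℝ) ≤ R := by exact_mod_cast hR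
  have h2 := Real.log_natCast_nonneg V
  have h3 : (0 : ℝ) ≤ R - 1 := by linarith
  rw [crtBound]
  positivity

theorem crtBound_le (R V : ℕ) (t : ℝ) : crtBound R V t ≤ crtPrime R V t 0 := by
  have h : ⌈crtBound R V t⌉₊ ≤ crtPrime R V t 0 :=
    Nat.le_nth_count Nat.infinite_setOfPred_prime _
  exact (Nat.le_ceil _).trans (by exact_mod_cast h)

theorem crtPrime_zero_le {R : ℕ} (hR : 1 ≤ R) (V : ℕ) {t : ℝ} (ht : 0 < t) :
    (crtPrime R V t 0 : ℝ) ≤ 2 * crtBound R V t + 4 := by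
  have h1 : crtPrime R V t 0 ≤ 2 * ⌈crtBound R V t⌉₊ + 2 := nth_count_prime_le _
  have h2 := Nat.ceil_lt_add_one (crtBound_nonneg hR V ht)
  have h3 : (crtPrime R V t 0 : ℝ) ≤ 2 * ⌈crtBound R V t⌉₊ + 2 := by exact_mod_cast h1
  linarith

theorem log_crtPrime_pos (R V : ℕ) (t : ℝ) : 0 < Real.log (crtPrime R V t 0) :=
  Real.log_pos (by exact_mod_cast (crtPrime_prime R V t 0).one_lt)

theorem crtCount_arg_eq (R V : ℕ) {t : ℝ} (ht : 0 < t) :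
    2 * ((R : ℝ) - 1) * Real.log V / (t * Real.log (crtPrime R V t 0)) =
      0.32 * (crtBound R V t / Real.log (crtPrime R V t 0)) := by
  have := log_crtPrime_pos R V t
  rw [crtBound]
  field_simp

/-- The constant `0.32` in the lower bound for the first prime makes the run of primes just short
enough for `nth_prime_add_le`. -/
theorem crtCount_sub_one_le {R : ℕ} (hR : 1 ≤ R) (V : ℕ) {t : ℝ} (ht : 0 < t) :
    ((crtCount R V t - 1 : ℕ) : ℝ) ≤
      0.32 * (crtPrime R V t 0 / Real.log (crtPrime R V t 0)) := by
  have hlog := log_crtPrime_pos R V t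
  have h0 : 0 ≤ 0.32 * (crtBound R V t / Real.log (crtPrime R V t 0)) := by
    have := crtBound_nonneg hR V ht
    positivity
  have h1 : 0.32 * (crtBound R V t / Real.log (crtPrime R V t 0)) ≤
      0.32 * (crtPrime R V t 0 / Real.log (crtPrime R V t 0)) := by
    have := crtBound_le R V t
    gcongr
  refine le_trans ?_ h1
  rw [crtCount, crtCount_arg_eq R V ht]
  have h2 := Nat.ceil_lt_add_one h0
  rcases le_total 1 ⌈0.32 * (crtBound R V t / Real.log (crtPrime R V t 0))⌉₊ with h | h
  · rw [max_eq_right h, Nat.cast_sub h]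
    push_cast
    linarith
  · rw [max_eq_left h]
    simpa using h0

theorem crtPrime_le {R : ℕ} (hR : 1 ≤ R) (V : ℕ) {t : ℝ} (ht : 0 < t) {j : ℕ}
    (hj : j < crtCount R V t) : crtPrime R V t j ≤ 1024 * crtPrime R V t 0 := by
  refine nth_prime_add_le (le_trans ?_ (crtCount_sub_one_le hR V ht))
  exact_mod_cast (by lia : j ≤ crtCount R V t - 1)

theorem sum_crtPrimes_eq (R V : ℕ) (t : ℝ) :
    (crtPrimes R V t).sum = ∑ j ∈ Finset.range (crtCount R V t), crtPrime R V t j := by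
  rw [crtPrimes_eq]
  rfl

theorem sum_crtPrimes_le {R : ℕ} (hR : 1 ≤ R) (V : ℕ) {t : ℝ} (ht : 0 < t) :
    (crtPrimes R V t).sum ≤ crtCount R V t * (1024 * crtPrime R V t 0) := by
  rw [sum_crtPrimes_eq]
  refine (Finset.sum_le_card_nsmul _ _ _ fun j hj =>
    crtPrime_le hR V ht (Finset.mem_range.mp hj)).trans ?_
  simp

theorem one_le_crtCount (R V : ℕ) (t : ℝ) : 1 ≤ crtCount R V t := le_max_left _ _

/-- There are at most `p₁` primes, each at most `1024 p₁`, and `p₁` is linear in `crtBound`. The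
square becomes the exponent `2d` of the number of shifts. -/
theorem sum_crtPrimes_le_sq {R : ℕ} (hR : 1 ≤ R) (V : ℕ) {t : ℝ} (ht : 0 < t) :
    ((crtPrimes R V t).sum : ℝ) ≤ 1024 * (2 * crtBound R V t + 4) ^ 2 := by
  have h1 : ((crtPrimes R V t).sum : ℝ) ≤ crtCount R V t * (1024 * crtPrime R V t 0) := by
    exact_mod_cast sum_crtPrimes_le hR V ht
  have h2 := crtCount_sub_one_le hR V ht
  rw [Nat.cast_sub (one_le_crtCount R V t)] at h2
  have hp : (2 : ℝ) ≤ crtPrime R V t 0 := by exact_mod_cast (crtPrime_prime R V t 0).two_le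
  have hlog : (0.69 : ℝ) ≤ Real.log (crtPrime R V t 0) := by
    have := Real.log_le_log two_pos hp
    have := Real.log_two_gt_d9
    linarith
  -- Since `log p₁ ≥ 0.69`, the count is at most `1 + p₁/2 ≤ p₁`.
  have h3 : 0.32 * ((crtPrime R V t 0 : ℝ) / Real.log (crtPrime R V t 0)) ≤
      0.5 * crtPrime R V t 0 := by
    have : (crtPrime R V t 0 : ℝ) / Real.log (crtPrime R V t 0) ≤ 1.5 * crtPrime R V t 0 := by
      rw [div_le_iff₀ (log_crtPrime_pos R V t)]
      nlinarith
    linarith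
  have h4 := crtPrime_zero_le hR V ht
  have h5 : (crtCount R V t : ℝ) ≤ crtPrime R V t 0 := by
    push_cast at h2
    linarith
  calc ((crtPrimes R V t).sum : ℝ) ≤ crtCount R V t * (1024 * crtPrime R V t 0) := h1
    _ ≤ crtPrime R V t 0 * (1024 * crtPrime R V t 0) := by gcongr
    _ = 1024 * (crtPrime R V t 0 : ℝ) ^ 2 := by ring
    _ ≤ _ := by gcongr

/-- Few of the primes of the initial shift set divide a given small number. -/
theorem card_crtPrime_dvd_le {R : ℕ} (V : ℕ) {t : ℝ} (ht : 0 < t)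
    {n : ℕ} (hn : n ≠ 0) (hnV : n ≤ V) (hR : 1 ≤ R) :
    2 * ((R : ℝ) - 1) *
      (((Finset.range (crtCount R V t)).filter fun j => crtPrime R V t j ∣ n).card : ℝ) ≤
      t * crtCount R V t := by
  have h1 := card_prime_dvd_mul_log_le (b := crtPrime R V t 0) (crtPrime_prime R V t 0).one_le hn
    hnV (Finset.range (crtCount R V t)) (crtPrime R V t) (crtPrime_prime R V t)
    (crtPrime_strictMono R V t).injective fun j => (crtPrime_strictMono R V t).monotone j.zero_le
  have hlog := log_crtPrime_pos R V t
  have h2 : 2 * ((R : ℝ) - 1) * Real.log V / (t * Real.log (crtPrime R V t 0)) ≤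
      crtCount R V t := (Nat.le_ceil _).trans (Nat.cast_le.mpr (le_max_right _ _))
  rw [div_le_iff₀ (by positivity)] at h2
  have hR' : (0 : ℝ) ≤ (R : ℝ) - 1 := by
    have : (1 : ℝ) ≤ R := by exact_mod_cast hR
    linarith
  refine le_of_mul_le_mul_right ?_ hlog
  calc _ = 2 * ((R : ℝ) - 1) * ((((Finset.range (crtCount R V t)).filter
        fun j => crtPrime R V t j ∣ n).card : ℝ) * Real.log (crtPrime R V t 0)) := by ring
    _ ≤ 2 * ((R : ℝ) - 1) * Real.log V := by gcongr
    _ ≤ _ := by linarith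

/-! ### The projection vector -/

theorem mem_candidates {n : ℕ} {x : ℤ} :
    x ∈ candidates n ↔ x.natAbs ≤ (n + 1) / 2 := by
  simp only [candidates, List.mem_cons, List.mem_flatMap, List.mem_range, List.not_mem_nil,
    or_false, List.bind_eq_flatMap, List.pure_def]
  constructor
  · rintro (rfl | ⟨_, ⟨i, hi, rfl⟩, rfl | rfl⟩)
    · simp
    · lia
    · lia
  · intro h
    by_cases hx : x = 0
    · exact Or.inl hx
    · refine Or.inr ⟨_, ⟨x.natAbs - 1, by lia, rfl⟩, ?_⟩
      rcases Int.natAbs_eq x with h' | h' <;> lia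

/-- Pigeonhole: the candidates fill an interval of `2⌈n/2⌉ + 1 > n` integers. -/
theorem exists_candidate {n : ℕ} (F : Finset ℤ) (hF : F.card ≤ n) :
    ∃ x ∈ candidates n, x ∉ F := by
  by_contra! h
  have hsub : Finset.Icc (-(((n + 1) / 2 : ℕ) : ℤ)) ((n + 1) / 2 : ℕ) ⊆ F := by
    intro x hx
    rw [Finset.mem_Icc] at hx
    exact h x (mem_candidates.mpr (by lia))
  have := Finset.card_le_card hsub
  rw [Int.card_Icc] at this
  lia

/-- The value that the symmetric component-by-component construction chooses for entry `j`. -/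
def projStep {d : ℕ} (H : Finset (Fin d → ℤ)) (z : Fin d → ℤ) (j : Fin d) : ℤ :=
  ((candidates (activeSet H j).card).find? fun x => decide (x ∉ forbidden H z j)).getD 0

theorem projStep_spec {d : ℕ} (H : Finset (Fin d → ℤ)) (z : Fin d → ℤ) (j : Fin d) :
    projStep H z j ∉ forbidden H z j ∧ (projStep H z j).natAbs ≤ H.card + 1 := by
  have hcard : (forbidden H z j).card ≤ (activeSet H j).card :=
    Finset.card_image_le.trans (Finset.card_filter_le _ _)
  obtain ⟨x, hx, hx'⟩ := exists_candidate _ hcard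
  -- The search succeeds, so the default value of `getD` is never returned.
  have hsome : ((candidates (activeSet H j).card).find?
      fun x => decide (x ∉ forbidden H z j)).isSome := by
    rw [List.find?_isSome]
    exact ⟨x, hx, by simpa using hx'⟩
  obtain ⟨y, hy⟩ := Option.isSome_iff_exists.mp hsome
  have h1 : projStep H z j = y := by
    rw [projStep, hy]
    rfl
  rw [h1]
  refine ⟨by simpa using List.find?_some hy, ?_⟩
  have h2 := mem_candidates.mp (List.mem_of_find?_eq_some hy)
  have h3 : (activeSet H j).card ≤ H.card := Finset.card_filter_le _ _
  lia

/-- Each entry is written once, when all smaller entries already have their final values. The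
intermediate vector `z'` thus agrees with the result below `j`. -/
theorem foldl_update_spec {d : ℕ} (v : (Fin d → ℤ) → Fin d → ℤ) :
    ∀ (L : List (Fin d)) (z₀ : Fin d → ℤ), L.Pairwise (· < ·) →
      (∀ i ∉ L, L.foldl (fun z j => Function.update z j (v z j)) z₀ i = z₀ i) ∧
      ∀ j ∈ L, ∃ z' : Fin d → ℤ,
        (∀ i < j, z' i = L.foldl (fun z j => Function.update z j (v z j)) z₀ i) ∧
        L.foldl (fun z j => Function.update z j (v z j)) z₀ j = v z' j
  | [], z₀, _ => ⟨fun _ _ => rfl, fun j hj => absurd hj List.not_mem_nil⟩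
  | a :: L, z₀, hL => by
    rw [List.pairwise_cons] at hL
    obtain ⟨h1, h2⟩ := foldl_update_spec v L (Function.update z₀ a (v z₀ a)) hL.2
    simp only [List.foldl_cons]
    constructor
    · intro i hi
      rw [List.mem_cons, not_or] at hi
      rw [h1 i hi.2, Function.update_of_ne hi.1]
    · intro j hj
      rcases List.mem_cons.mp hj with rfl | hj
      · refine ⟨z₀, fun i hi => ?_, ?_⟩
        · rw [h1 i fun hi' => lt_asymm hi (hL.1 i hi'), Function.update_of_ne hi.ne]
        · rw [h1 j fun hj' => lt_irrefl _ (hL.1 j hj'), Function.update_self]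
      · exact h2 j hj

theorem projVec_spec {d : ℕ} (H : Finset (Fin d → ℤ)) (j : Fin d) :
    projVec H j ∉ forbidden H (projVec H) j ∧ (projVec H j).natAbs ≤ H.card + 1 := by
  obtain ⟨z', h1, h2⟩ := (foldl_update_spec (projStep H) (List.finRange d) 0
    (List.pairwise_lt_finRange d)).2 j (List.mem_finRange j)
  change ∀ i < j, z' i = projVec H i at h1
  change projVec H j = projStep H z' j at h2
  -- The forbidden set at `j` only sees entries below `j`.
  have h3 : forbidden H z' j = forbidden H (projVec H) j := by
    have hs : ∀ h : Fin d → ℤ, ∑ l ∈ Finset.Iio j, h l * z' l =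
        ∑ l ∈ Finset.Iio j, h l * projVec H l := fun h =>
      Finset.sum_congr rfl fun l hl => by rw [h1 l (Finset.mem_Iio.mp hl)]
    simp only [forbidden, hs]
  rw [h2, ← h3]
  exact projStep_spec H z' j

/-- If `j` is the last index with `h j ≠ 0`, then `h · z = 0` would make `z_j` exactly the value
that `h` forbids. -/
theorem idot_projVec_ne_zero {d : ℕ} {H : Finset (Fin d → ℤ)} {h : Fin d → ℤ} (hh : h ∈ H)
    (h0 : h ≠ 0) : idot h (projVec H) ≠ 0 := by
  intro hz
  obtain ⟨i₀, hi₀⟩ := Function.ne_iff.mp h0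
  obtain ⟨j, hj⟩ := (Finset.univ.filter fun i => h i ≠ 0).exists_maximal
    ⟨i₀, by simpa using hi₀⟩
  have hj0 : h j ≠ 0 := (Finset.mem_filter.mp hj.prop).2
  have hgt : ∀ i, j < i → h i = 0 := by
    intro i hi
    by_contra hne
    exact absurd hi (hj.not_gt (Finset.mem_filter.mpr ⟨Finset.mem_univ _, hne⟩))
  have hsum : idot h (projVec H) = ∑ l ∈ Finset.Iio j, h l * projVec H l + h j * projVec H j := by
    rw [idot, ← Finset.sum_subset (Finset.subset_univ (Finset.Iic j)) fun i _ hi => ?_,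
      ← Finset.Iio_insert, Finset.sum_insert (by simp), add_comm]
    rw [hgt i (by simpa using hi), zero_mul]
  rw [hsum] at hz
  refine (projVec_spec H j).1 ?_
  rw [forbidden, Finset.mem_image]
  refine ⟨h, ?_, ?_⟩
  · rw [Finset.mem_filter, activeSet, Finset.mem_filter]
    refine ⟨⟨hh, hj0, hgt⟩, ⟨-projVec H j, by linarith⟩⟩
  · rw [show -(∑ l ∈ Finset.Iio j, h l * projVec H l) = h j * projVec H j by linarith,
      Int.mul_ediv_cancel_left _ hj0]

/-! ### Exponentials -/

theorem expi_add (x y : ℝ) : expi (x + y) = expi x * expi y := by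
  rw [expi, expi, expi, ← Complex.exp_add]
  push_cast
  ring_nf

theorem expi_zero : expi 0 = 1 := by simp [expi]

theorem expi_int (n : ℤ) : expi n = 1 := by
  rw [expi, Complex.ofReal_intCast, mul_comm]
  exact Complex.exp_int_mul_two_pi_mul_I n

theorem norm_expi (x : ℝ) : ‖expi x‖ = 1 := by
  rw [expi, show 2 * (Real.pi : ℂ) * Complex.I * x = ((2 * Real.pi * x : ℝ) : ℂ) * Complex.I by
    push_cast; ring]
  exact Complex.norm_exp_ofReal_mul_I _

theorem conj_expi (x : ℝ) : (starRingEnd ℂ) (expi x) = expi (-x) := by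
  rw [expi, expi, ← Complex.exp_conj, show 2 * (Real.pi : ℂ) * Complex.I * x =
    ((2 * Real.pi * x : ℝ) : ℂ) * Complex.I by push_cast; ring, map_mul, Complex.conj_ofReal,
    Complex.conj_I]
  push_cast
  ring_nf

theorem expi_nat_mul (n : ℕ) (x : ℝ) : expi (n * x) = expi x ^ n := by
  rw [expi, expi, ← Complex.exp_nat_mul]
  push_cast
  ring_nf

theorem continuous_expi : Continuous expi := by
  unfold expi
  fun_prop

theorem rdot_add {d : ℕ} (h : Fin d → ℤ) (x y : Fin d → ℝ) :
    rdot h (fun j => x j + y j) = rdot h x + rdot h y := by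
  simp [rdot, mul_add, Finset.sum_add_distrib]

theorem rdot_sub_left {d : ℕ} (h l : Fin d → ℤ) (x : Fin d → ℝ) :
    rdot (h - l) x = rdot h x - rdot l x := by
  simp [rdot, sub_mul, Finset.sum_sub_distrib]

theorem idot_sub_left {d : ℕ} (h l z : Fin d → ℤ) : idot (h - l) z = idot h z - idot l z := by
  simp [idot, sub_mul, Finset.sum_sub_distrib]

theorem expi_rdot_fract {d : ℕ} (h : Fin d → ℤ) (x : Fin d → ℝ) :
    expi (rdot h fun j => Int.fract (x j)) = expi (rdot h x) := by
  have h1 : rdot h x = rdot h (fun j => Int.fract (x j)) + ((idot h fun j => ⌊x j⌋ : ℤ) : ℝ) := by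
    rw [rdot, rdot, idot]
    push_cast
    rw [← Finset.sum_add_distrib]
    refine Finset.sum_congr rfl fun j _ => ?_
    rw [← mul_add, Int.fract_add_floor]
  rw [h1, expi_add, expi_int, mul_one]

theorem rdot_mul_div {d : ℕ} (h z : Fin d → ℤ) (i : ℝ) (p : ℝ) :
    rdot h (fun j => i * z j / p) = i * ((idot h z : ℝ) / p) := by
  rw [rdot, idot]
  push_cast
  rw [Finset.sum_div, Finset.mul_sum]
  refine Finset.sum_congr rfl fun j _ => ?_
  ring

theorem expi_int_div_eq_one_iff {p : ℕ} (hp : 0 < p) (n : ℤ) :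
    expi ((n : ℝ) / p) = 1 ↔ (p : ℤ) ∣ n := by
  have hp0 : (p : ℂ) ≠ 0 := by exact_mod_cast hp.ne'
  rw [expi, Complex.exp_eq_one_iff]
  constructor
  · rintro ⟨m, hm⟩
    refine ⟨m, ?_⟩
    have h2 : (2 * Real.pi * Complex.I : ℂ) ≠ 0 := Complex.two_pi_I_ne_zero
    push_cast at hm
    have h3 : (n : ℂ) / p = m := by
      apply mul_left_cancel₀ h2
      rw [hm]
      ring
    rw [div_eq_iff hp0] at h3
    have h4 : (n : ℂ) = (((p : ℤ) * m : ℤ) : ℂ) := by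
      rw [h3]
      push_cast
      ring
    exact_mod_cast h4
  · rintro ⟨m, rfl⟩
    refine ⟨m, ?_⟩
    push_cast
    field_simp

theorem sum_expi_div {p : ℕ} (hp : 0 < p) (n : ℤ) :
    ∑ i ∈ Finset.range p, expi ((i : ℝ) * ((n : ℝ) / p)) = if (p : ℤ) ∣ n then (p : ℂ) else 0 := by
  simp_rw [expi_nat_mul]
  split_ifs with h
  · rw [(expi_int_div_eq_one_iff hp n).mpr h]
    simp
  · have h1 : expi ((n : ℝ) / p) ≠ 1 := fun h' => h ((expi_int_div_eq_one_iff hp n).mp h')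
    rw [geom_sum_eq h1, ← expi_nat_mul]
    have hp0 : (p : ℝ) ≠ 0 := by exact_mod_cast hp.ne'
    rw [mul_div_cancel₀ _ hp0, expi_int, sub_self, zero_div]

/-! ### Stability of shift sets -/

/-- The exponential sum of a list of shifts. -/
def expSum {d : ℕ} (Y : List (Fin d → ℝ)) (h : Fin d → ℤ) : ℂ :=
  (Y.map fun y => expi (rdot h y)).sum

/-- The energy of a trigonometric polynomial on a list of shifts. -/
def energy {d : ℕ} (Y : List (Fin d → ℝ)) (F : Finset (Fin d → ℤ)) (x : (Fin d → ℤ) → ℂ) : ℝ :=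
  (Y.map fun y => ‖∑ m ∈ F, x m * expi (rdot m y)‖ ^ 2).sum

/-- Trigonometric polynomials with frequencies in `F` are bounded below on the shifts. -/
def IsStable {d : ℕ} (κ : ℝ) (Y : List (Fin d → ℝ)) (F : Finset (Fin d → ℤ)) : Prop :=
  ∀ x : (Fin d → ℤ) → ℂ, κ * Y.length * ∑ m ∈ F, ‖x m‖ ^ 2 ≤ energy Y F x

theorem energy_nonneg {d : ℕ} (Y : List (Fin d → ℝ)) (F : Finset (Fin d → ℤ))
    (x : (Fin d → ℤ) → ℂ) : 0 ≤ energy Y F x := by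
  refine List.sum_nonneg ?_
  simp only [List.mem_map]
  rintro _ ⟨y, -, rfl⟩
  positivity

/-- Expanding the squares: the energy is the quadratic form of the Gram matrix, whose entries are
exponential sums at the frequency differences. -/
theorem energy_eq {d : ℕ} (Y : List (Fin d → ℝ)) (F : Finset (Fin d → ℤ))
    (x : (Fin d → ℤ) → ℂ) : (energy Y F x : ℂ) =
      ∑ m ∈ F, ∑ n ∈ F, x m * (starRingEnd ℂ) (x n) * expSum Y (m - n) := by
  induction Y with
  | nil => simp [energy, expSum]
  | cons y Y ih =>
    have h1 : energy (y :: Y) F x = ‖∑ m ∈ F, x m * expi (rdot m y)‖ ^ 2 + energy Y F x := by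
      simp [energy]
    have h2 : ∀ h, expSum (y :: Y) h = expi (rdot h y) + expSum Y h := by
      intro h
      simp [expSum]
    rw [h1, Complex.ofReal_add, ih, Complex.ofReal_pow, ← Complex.mul_conj', map_sum,
      Finset.sum_mul_sum, ← Finset.sum_add_distrib]
    refine Finset.sum_congr rfl fun m _ => ?_
    rw [← Finset.sum_add_distrib]
    refine Finset.sum_congr rfl fun n _ => ?_
    rw [h2, map_mul, conj_expi, rdot_sub_left, sub_eq_add_neg (rdot m y), expi_add]
    ring

theorem expSum_zero {d : ℕ} (Y : List (Fin d → ℝ)) : expSum Y 0 = Y.length := by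
  simp [expSum, rdot, expi_zero]

/-- Diagonal dominance: the diagonal entries of the Gram matrix equal the number of shifts, and a
row has at most `R - 1` off-diagonal entries, which together make up at most the fraction `t` of it.
-/
theorem isStable_of_expSum_le {d : ℕ} {Y : List (Fin d → ℝ)} {F : Finset (Fin d → ℤ)} {R : ℕ}
    {t : ℝ} (ht : 0 ≤ t) (hR : 2 ≤ R) (hF : F.card ≤ R)
    (h : ∀ m ∈ F, ∀ n ∈ F, m ≠ n → ‖expSum Y (m - n)‖ ≤ t * Y.length / ((R : ℝ) - 1)) :
    IsStable (1 - t) Y F := by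
  classical
  intro x
  have hR' : (2 : ℝ) ≤ R := by exact_mod_cast hR
  set B := t * Y.length / ((R : ℝ) - 1) with hB
  have hB0 : 0 ≤ B := div_nonneg (by positivity) (by linarith)
  set a : (Fin d → ℤ) → ℝ := fun m => ‖x m‖ ^ 2 with ha
  have hre : energy Y F x =
      ∑ m ∈ F, ∑ n ∈ F, (x m * (starRingEnd ℂ) (x n) * expSum Y (m - n)).re := by
    have := congrArg Complex.re (energy_eq Y F x)
    rw [Complex.ofReal_re] at this
    rw [this]
    simp [Complex.re_sum]
  have hinner : ∀ m ∈ F, (Y.length : ℝ) * a m - ∑ n ∈ F.erase m, B * ((a m + a n) / 2) ≤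
      ∑ n ∈ F, (x m * (starRingEnd ℂ) (x n) * expSum Y (m - n)).re := by
    intro m hm
    rw [← Finset.add_sum_erase _ _ hm, sub_eq_add_neg, ← Finset.sum_neg_distrib]
    refine add_le_add (le_of_eq ?_) (Finset.sum_le_sum fun n hn => ?_)
    · rw [sub_self, expSum_zero, Complex.mul_conj', ha]
      rw [mul_comm, ← Complex.ofReal_pow, ← Complex.ofReal_natCast, ← Complex.ofReal_mul,
        Complex.ofReal_re]
    · obtain ⟨hne, hnF⟩ := Finset.mem_erase.mp hn
      have h1 := Complex.abs_re_le_norm (x m * (starRingEnd ℂ) (x n) * expSum Y (m - n))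
      rw [norm_mul, norm_mul, RCLike.norm_conj] at h1
      have h2 := h m hm n hnF hne.symm
      have h3 : ‖x m‖ * ‖x n‖ ≤ (a m + a n) / 2 := by
        rw [ha]
        nlinarith [sq_nonneg (‖x m‖ - ‖x n‖)]
      have h4 : ‖x m‖ * ‖x n‖ * ‖expSum Y (m - n)‖ ≤ (a m + a n) / 2 * B :=
        mul_le_mul h3 h2 (norm_nonneg _) (by positivity)
      have h5 := (abs_le.mp h1).1
      linarith
  have hsum : ∑ m ∈ F, ∑ n ∈ F.erase m, B * ((a m + a n) / 2) =
      B * ((F.card : ℝ) - 1) * ∑ m ∈ F, a m := by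
    have h1 : ∀ m ∈ F, ∑ n ∈ F.erase m, B * ((a m + a n) / 2) =
        B / 2 * ((F.card : ℝ) * a m + ∑ n ∈ F, a n) - B * a m := by
      intro m hm
      have h2 := Finset.add_sum_erase F (fun n => B * ((a m + a n) / 2)) hm
      have h3 : ∑ n ∈ F, B * ((a m + a n) / 2) =
          B / 2 * ((F.card : ℝ) * a m + ∑ n ∈ F, a n) := by
        rw [← Finset.mul_sum, ← Finset.sum_div, Finset.sum_add_distrib, Finset.sum_const,
          nsmul_eq_mul]
        ring
      have h4 : B * ((a m + a m) / 2) = B * a m := by ring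
      linarith
    rw [Finset.sum_congr rfl h1, Finset.sum_sub_distrib, ← Finset.mul_sum, ← Finset.mul_sum,
      Finset.sum_add_distrib, ← Finset.mul_sum, Finset.sum_const, nsmul_eq_mul]
    ring
  have hA : 0 ≤ ∑ m ∈ F, a m := Finset.sum_nonneg fun m _ => by positivity
  have hfin : B * ((F.card : ℝ) - 1) ≤ t * Y.length := by
    have h1 : (F.card : ℝ) ≤ R := by exact_mod_cast hF
    calc B * ((F.card : ℝ) - 1) ≤ B * ((R : ℝ) - 1) := by gcongr
      _ = t * Y.length := by
        rw [hB, div_mul_cancel₀]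
        linarith
  calc (1 - t) * Y.length * ∑ m ∈ F, a m
      = Y.length * ∑ m ∈ F, a m - t * Y.length * ∑ m ∈ F, a m := by ring
    _ ≤ Y.length * ∑ m ∈ F, a m - B * ((F.card : ℝ) - 1) * ∑ m ∈ F, a m := by gcongr
    _ = ∑ m ∈ F, ((Y.length : ℝ) * a m - ∑ n ∈ F.erase m, B * ((a m + a n) / 2)) := by
        rw [Finset.sum_sub_distrib, hsum, Finset.mul_sum]
    _ ≤ energy Y F x := by
        rw [hre]
        exact Finset.sum_le_sum hinner

theorem sum_map_list_range {M : Type*} [AddCommMonoid M] (f : ℕ → M) (n : ℕ) :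
    ((List.range n).map f).sum = ∑ i ∈ Finset.range n, f i := rfl

theorem expSum_latticeShifts {d : ℕ} (z : Fin d → ℤ) {p : ℕ} (hp : 0 < p) (h : Fin d → ℤ) :
    expSum (latticeShifts z p) h = if (p : ℤ) ∣ idot h z then (p : ℂ) else 0 := by
  rw [expSum, latticeShifts, List.map_map, sum_map_list_range, ← sum_expi_div hp]
  refine Finset.sum_congr rfl fun i _ => ?_
  rw [Function.comp_apply, expi_rdot_fract h fun j => (i : ℝ) * z j / p, rdot_mul_div]

theorem length_latticeShifts {d : ℕ} (z : Fin d → ℤ) (p : ℕ) :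
    (latticeShifts z p).length = p := by simp [latticeShifts]

theorem length_multiShifts {d : ℕ} (z : Fin d → ℤ) (ps : List ℕ) :
    (multiShifts z ps).length = ps.sum := by
  induction ps with
  | nil => rfl
  | cons p ps ih =>
    rw [multiShifts, List.flatMap_cons, List.length_append, length_latticeShifts,
      List.sum_cons, ← ih]
    rfl

theorem expSum_append {d : ℕ} (Y Y' : List (Fin d → ℝ)) (h : Fin d → ℤ) :
    expSum (Y ++ Y') h = expSum Y h + expSum Y' h := by
  simp [expSum]

theorem energy_append {d : ℕ} (Y Y' : List (Fin d → ℝ)) (F : Finset (Fin d → ℤ))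
    (x : (Fin d → ℤ) → ℂ) : energy (Y ++ Y') F x = energy Y F x + energy Y' F x := by
  simp [energy]

theorem expSum_multiShifts {d : ℕ} (z : Fin d → ℤ) (ps : List ℕ) (hps : ∀ p ∈ ps, 0 < p)
    (h : Fin d → ℤ) : expSum (multiShifts z ps) h =
      ((ps.filter fun q : ℕ => decide ((q : ℤ) ∣ idot h z)).sum : ℕ) := by
  induction ps with
  | nil => simp [multiShifts, expSum]
  | cons p ps ih =>
    rw [multiShifts, List.flatMap_cons, expSum_append, List.filter_cons,
      expSum_latticeShifts z (hps p List.mem_cons_self),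
      show List.flatMap (latticeShifts z) ps = multiShifts z ps from rfl,
      ih fun q hq => hps q (List.mem_cons_of_mem _ hq)]
    by_cases hd : (p : ℤ) ∣ idot h z
    · simp [hd]
    · simp [hd]

theorem energy_multiShifts {d : ℕ} (z : Fin d → ℤ) (ps : List ℕ) (F : Finset (Fin d → ℤ))
    (x : (Fin d → ℤ) → ℂ) : energy (multiShifts z ps) F x =
      (ps.map fun p => energy (latticeShifts z p) F x).sum := by
  induction ps with
  | nil => simp [multiShifts, energy]
  | cons p ps ih =>
    rw [multiShifts, List.flatMap_cons, energy_append, List.map_cons, List.sum_cons, ← ih]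
    rfl

/-- On the lattice shifts of one prime, the energy controls the coefficients of all frequencies
that do not alias. -/
theorem energy_latticeShifts_ge {d : ℕ} (z : Fin d → ℤ) {p : ℕ} (hp : 0 < p)
    (F : Finset (Fin d → ℤ)) (x : (Fin d → ℤ) → ℂ) :
    (p : ℝ) * ∑ m ∈ F with ∀ n ∈ F, n ≠ m → ¬ (p : ℤ) ∣ idot (m - n) z, ‖x m‖ ^ 2 ≤
      energy (latticeShifts z p) F x := by
  classical
  set good : (Fin d → ℤ) → Prop := fun m => ∀ n ∈ F, n ≠ m → ¬ (p : ℤ) ∣ idot (m - n) z with hgood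
  set Y := latticeShifts z p
  set T : (Fin d → ℤ) → (Fin d → ℤ) → ℂ := fun m n =>
    x m * (starRingEnd ℂ) (x n) * expSum Y (m - n) with hT
  have hzero : ∀ m n, ¬ (p : ℤ) ∣ idot (m - n) z → T m n = 0 := by
    intro m n hmn
    simp only [hT, Y]
    rw [expSum_latticeShifts z hp, if_neg hmn, mul_zero]
  have hdiag : ∀ m, T m m = (((p : ℝ) * ‖x m‖ ^ 2 : ℝ) : ℂ) := by
    intro m
    simp only [hT]
    rw [sub_self, expSum_zero, length_latticeShifts, Complex.mul_conj']
    push_cast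
    ring
  have hrow : ∀ m ∈ F, good m → ∑ n ∈ F, T m n = (((p : ℝ) * ‖x m‖ ^ 2 : ℝ) : ℂ) := by
    intro m hm hg
    rw [Finset.sum_eq_single m, hdiag]
    · intro n hn hne
      exact hzero m n (hg n hn hne)
    · exact fun h => absurd hm h
  have hbad : ∀ m ∈ F, ¬ good m → ∑ n ∈ F, T m n = ∑ n ∈ F with ¬ good n, T m n := by
    intro m hm hg
    rw [Finset.sum_filter]
    refine Finset.sum_congr rfl fun n hn => ?_
    by_cases hgn : good n
    · rw [if_neg (not_not.mpr hgn)]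
      refine hzero m n fun hdvd => ?_
      have hne : m ≠ n := fun h => hg (h ▸ hgn)
      refine hgn m hm hne ?_
      rw [idot_sub_left] at hdvd ⊢
      exact (dvd_sub_comm).mp hdvd
    · rw [if_pos hgn]
  -- A non-aliasing frequency is orthogonal to all others on the shifts. So the Gram matrix splits
  -- into a diagonal block and the block of the remaining frequencies, itself an energy and hence
  -- nonnegative.
  have hsplit : (energy Y F x : ℂ) =
      (((p : ℝ) * ∑ m ∈ F with good m, ‖x m‖ ^ 2 : ℝ) : ℂ) +
        (energy Y (F.filter fun m => ¬ good m) x : ℂ) := by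
    rw [energy_eq, energy_eq, ← Finset.sum_filter_add_sum_filter_not F good]
    congr 1
    · rw [Finset.mul_sum, Complex.ofReal_sum]
      exact Finset.sum_congr rfl fun m hm =>
        hrow m (Finset.mem_filter.mp hm).1 (Finset.mem_filter.mp hm).2
    · exact Finset.sum_congr rfl fun m hm =>
        hbad m (Finset.mem_filter.mp hm).1 (Finset.mem_filter.mp hm).2
  have hsplit' : energy Y F x = (p : ℝ) * ∑ m ∈ F with good m, ‖x m‖ ^ 2 +
      energy Y (F.filter fun m => ¬ good m) x := by exact_mod_cast hsplit
  have := energy_nonneg Y (F.filter fun m => ¬ good m) x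
  linarith

/-- The primes are not equal, so counting the aliasing primes does not bound the exponential sums
well enough. Instead the energies are added prime by prime: each frequency is good for at least half
of the `k` primes, and each good prime contributes at least `p₁ ‖x m‖²`. Against a total length of
at most `1024 k p₁` this leaves `1/2048`. -/
theorem isStable_initial {d : ℕ} {z : Fin d → ℤ} {F : Finset (Fin d → ℤ)} {R V : ℕ} {t : ℝ}
    (ht0 : 0 < t) (ht1 : t ≤ 1) (hR : 2 ≤ R) (hF : F.card ≤ R)
    (hz : ∀ m ∈ F, ∀ n ∈ F, n ≠ m → idot (m - n) z ≠ 0 ∧ (idot (m - n) z).natAbs ≤ V) :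
    IsStable (1 / 2048) (multiShifts z (crtPrimes R V t)) F := by
  classical
  intro x
  have hR1 : 1 ≤ R := by lia
  have hR' : (2 : ℝ) ≤ R := by exact_mod_cast hR
  set k := crtCount R V t with hk
  set p := crtPrime R V t with hp
  have hlen : ((multiShifts z (crtPrimes R V t)).length : ℝ) ≤ k * (1024 * p 0) := by
    rw [length_multiShifts]
    exact_mod_cast sum_crtPrimes_le hR1 V ht0
  set good : ℕ → (Fin d → ℤ) → Prop :=
    fun j m => ∀ n ∈ F, n ≠ m → ¬ ((p j : ℕ) : ℤ) ∣ idot (m - n) z with hgood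
  -- Each of the at most `R - 1` other frequencies spoils at most `t k / (2(R-1))` primes, together
  -- at most half of them.
  have hcount : ∀ m ∈ F, (k : ℝ) / 2 ≤ (((Finset.range k).filter fun j => good j m).card : ℝ) := by
    intro m hm
    have hsub : (Finset.range k).filter (fun j => ¬ good j m) ⊆ (F.erase m).biUnion
        fun n => (Finset.range k).filter fun j => p j ∣ (idot (m - n) z).natAbs := by
      intro j hj
      obtain ⟨hj, hg⟩ := Finset.mem_filter.mp hj
      simp only [hgood] at hg
      push Not at hg
      obtain ⟨n, hn, hne, hdvd⟩ := hg
      rw [Finset.mem_biUnion]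
      exact ⟨n, Finset.mem_erase.mpr ⟨hne, hn⟩, Finset.mem_filter.mpr ⟨hj, Int.natCast_dvd.mp hdvd⟩⟩
    have h1 : (((Finset.range k).filter fun j => ¬ good j m).card : ℝ) ≤
        ∑ n ∈ F.erase m,
          (((Finset.range k).filter fun j => p j ∣ (idot (m - n) z).natAbs).card : ℝ) := by
      exact_mod_cast (Finset.card_le_card hsub).trans Finset.card_biUnion_le
    have h2 : ∀ n ∈ F.erase m, 2 * ((R : ℝ) - 1) *
        (((Finset.range k).filter fun j => p j ∣ (idot (m - n) z).natAbs).card : ℝ) ≤ t * k := by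
      intro n hn
      obtain ⟨hne, hnF⟩ := Finset.mem_erase.mp hn
      obtain ⟨h3, h4⟩ := hz m hm n hnF hne
      exact card_crtPrime_dvd_le V ht0 (Int.natAbs_ne_zero.mpr h3) h4 hR1
    have h5 := Finset.sum_le_card_nsmul _ _ _ h2
    rw [← Finset.mul_sum, nsmul_eq_mul, Finset.card_erase_of_mem hm] at h5
    have hF1 : 1 ≤ F.card := Finset.card_pos.mpr ⟨m, hm⟩
    have h6 : ((F.card - 1 : ℕ) : ℝ) ≤ (R : ℝ) - 1 := by
      rw [Nat.cast_sub hF1]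
      have : (F.card : ℝ) ≤ R := by exact_mod_cast hF
      push_cast
      linarith
    have hbad : 2 * (((Finset.range k).filter fun j => ¬ good j m).card : ℝ) ≤ k := by
      have hk0 : (0 : ℝ) ≤ k := by positivity
      have h7 : ((R : ℝ) - 1) * (2 * (((Finset.range k).filter fun j => ¬ good j m).card : ℝ)) ≤
          ((R : ℝ) - 1) * k := by
        calc _ = 2 * ((R : ℝ) - 1) * (((Finset.range k).filter fun j => ¬ good j m).card : ℝ) := by
              ring
          _ ≤ 2 * ((R : ℝ) - 1) * ∑ n ∈ F.erase m,
              (((Finset.range k).filter fun j => p j ∣ (idot (m - n) z).natAbs).card : ℝ) := by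
              refine mul_le_mul_of_nonneg_left h1 (by linarith)
          _ ≤ ((F.card - 1 : ℕ) : ℝ) * (t * k) := h5
          _ ≤ ((R : ℝ) - 1) * (1 * k) := by gcongr; linarith
          _ = _ := by ring
      exact le_of_mul_le_mul_left h7 (by linarith)
    have h8 : (((Finset.range k).filter fun j => good j m).card : ℝ) +
        (((Finset.range k).filter fun j => ¬ good j m).card : ℝ) = k := by
      have := Finset.card_filter_add_card_filter_not (s := Finset.range k) (fun j => good j m)
      rw [Finset.card_range] at this
      exact_mod_cast this
    linarith
  have hbelow : ∀ j, (p 0 : ℝ) * ∑ m ∈ F with good j m, ‖x m‖ ^ 2 ≤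
      energy (latticeShifts z (p j)) F x := by
    intro j
    refine le_trans ?_ (energy_latticeShifts_ge z (crtPrime_prime R V t j).pos F x)
    refine mul_le_mul_of_nonneg_right ?_ (Finset.sum_nonneg fun m _ => by positivity)
    exact_mod_cast (crtPrime_strictMono R V t).monotone j.zero_le
  have hA : 0 ≤ ∑ m ∈ F, ‖x m‖ ^ 2 := Finset.sum_nonneg fun m _ => by positivity
  calc 1 / 2048 * ((multiShifts z (crtPrimes R V t)).length : ℝ) * ∑ m ∈ F, ‖x m‖ ^ 2
      ≤ 1 / 2048 * (k * (1024 * p 0)) * ∑ m ∈ F, ‖x m‖ ^ 2 := by gcongr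
    _ = (p 0 : ℝ) * ∑ m ∈ F, (k : ℝ) / 2 * ‖x m‖ ^ 2 := by
        rw [← Finset.mul_sum]
        ring
    _ ≤ (p 0 : ℝ) * ∑ m ∈ F,
          (((Finset.range k).filter fun j => good j m).card : ℝ) * ‖x m‖ ^ 2 := by
        gcongr with m hm
        exact hcount m hm
    _ = ∑ j ∈ Finset.range k, (p 0 : ℝ) * ∑ m ∈ F with good j m, ‖x m‖ ^ 2 := by
        rw [← Finset.mul_sum]
        congr 1
        simp_rw [Finset.sum_filter]
        rw [Finset.sum_comm]
        refine Finset.sum_congr rfl fun m _ => ?_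
        rw [← Finset.sum_filter, Finset.sum_const, nsmul_eq_mul]
    _ ≤ ∑ j ∈ Finset.range k, energy (latticeShifts z (p j)) F x :=
        Finset.sum_le_sum fun j _ => hbelow j
    _ = energy (multiShifts z (crtPrimes R V t)) F x := by
        rw [energy_multiShifts, crtPrimes_eq, List.map_map, sum_map_list_range]
        rfl

/-! ### The adaptive search -/

section Search

variable {d : ℕ} {A : Finset (Fin d → ℤ)} {N : ℕ} {g : Fin d → ℤ}

theorem mem_fiber {l k : Fin d → ℤ} :
    k ∈ fiber A N g l ↔ k ∈ A ∧ idot k g ≡ idot l g [ZMOD N] := Finset.mem_filter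

theorem card_fiber_le {l : Fin d → ℤ} (hl : l ∈ A) :
    (fiber A N g l).card ≤ maxFiber A N g :=
  Finset.le_sup (f := fun l => (fiber A N g l).card) hl

theorem sub_mem_diffSet {l m n : Fin d → ℤ} (hl : l ∈ A) (hm : m ∈ fiber A N g l)
    (hn : n ∈ fiber A N g l) (hne : m ≠ n) : m - n ∈ diffSet A N g := by
  rw [diffSet, Finset.mem_erase]
  refine ⟨sub_ne_zero.mpr hne, ?_⟩
  rw [Finset.mem_biUnion]
  exact ⟨l, hl, Finset.mem_image.mpr ⟨(n, m), Finset.mem_product.mpr ⟨hn, hm⟩, rfl⟩⟩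

theorem two_le_maxFiber (h : (diffSet A N g).Nonempty) : 2 ≤ maxFiber A N g := by
  obtain ⟨x, hx⟩ := h
  obtain ⟨h0, hx⟩ := Finset.mem_erase.mp hx
  obtain ⟨l, hl, hx⟩ := Finset.mem_biUnion.mp hx
  obtain ⟨⟨m, n⟩, hmn, rfl⟩ := Finset.mem_image.mp hx
  obtain ⟨hm, hn⟩ := Finset.mem_product.mp hmn
  refine le_trans ?_ (card_fiber_le hl)
  exact Finset.one_lt_card.mpr ⟨m, hm, n, hn, fun h => h0 (sub_eq_zero.mpr h.symm)⟩

/-- A set of shifts that is not longer than `S₀` and stable on all fibers. -/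
def GoodShifts (A : Finset (Fin d → ℤ)) (N : ℕ) (g : Fin d → ℤ) (κ : ℝ) (S₀ : ℕ)
    (Y : List (Fin d → ℝ)) : Prop :=
  1 ≤ Y.length ∧ Y.length ≤ S₀ ∧ ∀ l ∈ A, IsStable κ Y (fiber A N g l)

theorem IsStable.mono {κ κ' : ℝ} {Y : List (Fin d → ℝ)} {F : Finset (Fin d → ℤ)}
    (h : IsStable κ Y F) (hκ : κ' ≤ κ) : IsStable κ' Y F := by
  intro x
  refine le_trans ?_ (h x)
  have : 0 ≤ ∑ m ∈ F, ‖x m‖ ^ 2 := Finset.sum_nonneg fun m _ => by positivity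
  gcongr

theorem isStable_of_forall_mem_diffSet {Y : List (Fin d → ℝ)} {t : ℝ} (ht : 0 ≤ t)
    (hR : 2 ≤ maxFiber A N g)
    (h : ∀ x ∈ diffSet A N g, ‖expSum Y x‖ ≤ t * Y.length / ((maxFiber A N g : ℝ) - 1))
    {l : Fin d → ℤ} (hl : l ∈ A) : IsStable (1 - t) Y (fiber A N g l) :=
  isStable_of_expSum_le ht hR (card_fiber_le hl) fun _ hm _ hn hne =>
    h _ (sub_mem_diffSet hl hm hn hne)

/-- The loop invariant. The guards accept only sets that are shorter than the current one, and each
of the three strategies ensures the hypothesis of `isStable_of_expSum_le`. -/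
theorem searchPass_good {t : ℝ} (ht0 : 0 < t) (hR : 2 ≤ maxFiber A N g) (pmin : ℝ)
    (z : Fin d → ℤ) {κ : ℝ} (hκ : κ ≤ 1 - t) {S₀ : ℕ} {σ : SearchState d}
    (hσ : GoodShifts A N g κ S₀ σ.best ∧ ∀ q ∈ σ.greedy, 0 < q) {p : ℕ} (hp : 0 < p) :
    GoodShifts A N g κ S₀
        (searchPass (diffSet A N g) (maxFiber A N g) t pmin z σ p).best ∧
      ∀ q ∈ (searchPass (diffSet A N g) (maxFiber A N g) t pmin z σ p).greedy, 0 < q := by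
  have hR' : (2 : ℝ) ≤ maxFiber A N g := by exact_mod_cast hR
  obtain ⟨⟨h1, h2, h3⟩, h4⟩ := hσ
  have hQ : ∀ q ∈ σ.greedy ++ [p], 0 < q := by
    intro q hq
    rcases List.mem_append.mp hq with hq | hq
    · exact h4 q hq
    · rw [List.mem_singleton.mp hq]
      exact hp
  rw [searchPass]
  split_ifs with hended hpoly hlat hfound hgreedy hshort
  · exact ⟨⟨h1, h2, h3⟩, h4⟩
  · have hlen : (polyShifts d p).length = p := by simp [polyShifts]
    refine ⟨⟨?_, ?_, fun l hl => (isStable_of_forall_mem_diffSet ht0.le hR ?_ hl).mono hκ⟩, h4⟩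
    · rw [hlen]
      exact hp
    · rw [hlen]
      push Not at hended
      exact hended.2.le.trans h2
    · intro x hx
      rw [hlen]
      exact hpoly x hx
  · refine ⟨⟨?_, ?_, fun l hl => (isStable_of_forall_mem_diffSet ht0.le hR ?_ hl).mono hκ⟩, h4⟩
    · rw [length_latticeShifts]
      exact hp
    · rw [length_latticeShifts]
      push Not at hended
      exact hended.2.le.trans h2
    · intro x hx
      -- For a single lattice that resolves all differences the exponential sums vanish.
      rw [expSum_latticeShifts z hp, if_neg (hlat.2 x hx), norm_zero]
      exact div_nonneg (by positivity) (by linarith)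
  · exact ⟨⟨h1, h2, h3⟩, h4⟩
  · refine ⟨⟨?_, ?_, fun l hl => (isStable_of_forall_mem_diffSet ht0.le hR ?_ hl).mono hκ⟩, hQ⟩
    · rw [length_multiShifts, List.sum_append, List.sum_singleton]
      lia
    · rw [length_multiShifts]
      exact hshort.le.trans h2
    · intro x hx
      have hpos : (0 : ℝ) < (((σ.greedy ++ [p]).sum : ℕ) : ℝ) := by
        rw [List.sum_append, List.sum_singleton]
        exact_mod_cast Nat.lt_of_lt_of_le hp (Nat.le_add_left _ _)
      rw [expSum_multiShifts z _ hQ, length_multiShifts, Complex.norm_natCast, mul_div_right_comm]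
      have := hgreedy x hx
      rwa [div_le_iff₀ hpos] at this
  · exact ⟨⟨h1, h2, h3⟩, hQ⟩
  · exact ⟨⟨h1, h2, h3⟩, hQ⟩

theorem foldl_searchPass_good {t : ℝ} (ht0 : 0 < t) (hR : 2 ≤ maxFiber A N g) (pmin : ℝ)
    (z : Fin d → ℤ) {κ : ℝ} (hκ : κ ≤ 1 - t) {S₀ : ℕ} :
    ∀ (L : List ℕ) (_ : ∀ p ∈ L, 0 < p) (σ : SearchState d)
      (_ : GoodShifts A N g κ S₀ σ.best ∧ ∀ q ∈ σ.greedy, 0 < q),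
      GoodShifts A N g κ S₀
        (L.foldl (searchPass (diffSet A N g) (maxFiber A N g) t pmin z) σ).best
  | [], _, _, hσ => hσ.1
  | p :: L, hL, σ, hσ => by
    rw [List.foldl_cons]
    exact foldl_searchPass_good ht0 hR pmin z hκ L (fun q hq => hL q (List.mem_cons_of_mem _ hq)) _
      (searchPass_good ht0 hR pmin z hκ hσ (hL p List.mem_cons_self))

theorem isStable_singleton_zero {F : Finset (Fin d → ℤ)} (hF : F.card ≤ 1) {κ : ℝ} (hκ : κ ≤ 1) :
    IsStable κ [0] F := by
  intro x
  have h0 : 0 ≤ ∑ m ∈ F, ‖x m‖ ^ 2 := Finset.sum_nonneg fun m _ => by positivity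
  have h1 : energy [0] F x = ‖∑ m ∈ F, x m‖ ^ 2 := by simp [energy, rdot, expi_zero]
  have h2 : ‖∑ m ∈ F, x m‖ ^ 2 = ∑ m ∈ F, ‖x m‖ ^ 2 := by
    rcases F.eq_empty_or_nonempty with rfl | hne
    · simp
    · obtain ⟨a, rfl⟩ := Finset.card_eq_one.mp (le_antisymm hF hne.card_pos)
      simp
  rw [h1, h2, List.length_singleton, Nat.cast_one, mul_one]
  exact mul_le_of_le_one_left h0 hκ

theorem card_fiber_le_one (h : maxFiber A N g = 1 ∨ diffSet A N g = ∅) {l : Fin d → ℤ}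
    (hl : l ∈ A) : (fiber A N g l).card ≤ 1 := by
  rcases h with h | h
  · exact h ▸ card_fiber_le hl
  · rw [Finset.card_le_one]
    intro m hm n hn
    by_contra hne
    have := sub_mem_diffSet hl hm hn hne
    rw [h] at this
    exact absurd this (Finset.notMem_empty _)

/-- The initial number of shifts. -/
def initialCount (A : Finset (Fin d → ℤ)) (N : ℕ) (g : Fin d → ℤ) (t : ℝ) : ℕ :=
  (crtPrimes (maxFiber A N g) (projBound (diffSet A N g) (projVec (diffSet A N g))) t).sum

/-- The two terms of the minimum are the stability constants of the accepted sets and of the initial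
set. The first alternative is the trivial case, where fibers have at most one element. -/
theorem adaptiveShifts_good {t : ℝ} (ht0 : 0 < t) (ht1 : t < 1) (pmin : ℝ) :
    (GoodShifts A N g (min (1 - t) (1 / 2048)) 1
        (adaptiveShifts (diffSet A N g) (maxFiber A N g) t pmin)) ∨
      (1 ≤ maxFiber A N g ∧ GoodShifts A N g (min (1 - t) (1 / 2048)) (initialCount A N g t)
        (adaptiveShifts (diffSet A N g) (maxFiber A N g) t pmin)) := by
  rw [adaptiveShifts]
  split_ifs with h
  · refine Or.inl ⟨le_rfl, le_rfl, fun l hl => isStable_singleton_zero (card_fiber_le_one h hl) ?_⟩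
    exact (min_le_left _ _).trans (by linarith)
  · push Not at h
    have hR := two_le_maxFiber h.2
    refine Or.inr ⟨by lia, ?_⟩
    refine foldl_searchPass_good ht0 hR pmin _ (min_le_left _ _) _ ?_ _ ⟨⟨?_, ?_, fun l hl => ?_⟩, ?_⟩
    · intro p hp
      rw [List.mem_filter] at hp
      have := of_decide_eq_true hp.2
      exact this.2.pos
    · rw [length_multiShifts, crtPrimes_eq, sum_map_list_range]
      refine le_trans (crtPrime_prime _ _ t 0).one_le
        (Finset.single_le_sum (f := crtPrime _ _ t) (fun _ _ => Nat.zero_le _) ?_)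
      exact Finset.mem_range.mpr (one_le_crtCount _ _ t)
    · rw [length_multiShifts]
      rfl
    · refine (isStable_initial ht0 ht1.le hR (card_fiber_le hl) ?_).mono (min_le_right _ _)
      intro m hm n hn hne
      have hmem := sub_mem_diffSet hl hm hn hne.symm
      refine ⟨idot_projVec_ne_zero hmem (sub_ne_zero.mpr hne.symm), ?_⟩
      exact Finset.le_sup (f := fun h => (idot h (projVec (diffSet A N g))).natAbs) hmem
    · intro q hq
      exact absurd hq List.not_mem_nil

end Search

/-! ### The number of shifts -/

/-- A constant is at most a multiple of `log N`. -/
theorem const_le_mul_log {N : ℕ} (hN : 2 ≤ N) {a : ℝ} (ha : 0 ≤ a) :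
    a ≤ a / Real.log 2 * Real.log N := by
  have h2 : 0 < Real.log 2 := Real.log_pos one_lt_two
  have h1 : Real.log 2 ≤ Real.log N := Real.log_le_log two_pos (by exact_mod_cast hN)
  rw [div_mul_eq_mul_div, le_div_iff₀ h2]
  gcongr

/-- Every point of the cross contributes at least `M^(-q)` to the convergent sum of `r^(-q)`. -/
theorem card_cross_le (d : ℕ) {α : ℝ} (hα : 0 < α) {γ : ℕ → ℝ} (hγ : ∀ j, 0 < γ j) {q : ℝ}
    (hq0 : 0 < q) (hq : 1 < α * q) :
    ∃ K : ℝ, 0 < K ∧ ∀ M : ℝ, 0 < M → ((cross d α γ M).card : ℝ) ≤ K * M ^ q := by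
  set T := ∑' k : Fin d → ℤ, wgt α γ q k with hT
  have hTtop : T ≠ ⊤ := tsum_wgt_ne_top hγ hq0 hq
  refine ⟨T.toReal + 1, by positivity, fun M hM => ?_⟩
  have h1 : ∀ k ∈ cross d α γ M, ENNReal.ofReal (M ^ (-q)) ≤ wgt α γ q k := by
    intro k hk
    rw [mem_cross hα hγ] at hk
    exact ENNReal.ofReal_le_ofReal
      (Real.rpow_le_rpow_of_nonpos (rWeight_pos _ _ _) hk.le (by linarith))
  have h2 := (Finset.card_nsmul_le_sum _ _ _ h1).trans (ENNReal.sum_le_tsum _)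
  rw [nsmul_eq_mul, ← ENNReal.ofReal_natCast, ← ENNReal.ofReal_mul (by positivity), ← hT,
    ENNReal.ofReal_le_iff_le_toReal hTtop, Real.rpow_neg hM.le, ← div_eq_mul_inv,
    div_le_iff₀ (by positivity)] at h2
  have : 0 ≤ M ^ q := by positivity
  linarith

theorem abs_le_of_mem_cross {d : ℕ} {α : ℝ} (hα : 0 < α) {γ : ℕ → ℝ} (hγ : ∀ j, 0 < γ j)
    {N : ℕ} {M : ℝ} (hMN : M ≤ (N : ℝ) ^ α) {k : Fin d → ℤ} (hk : k ∈ cross d α γ M)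
    (j : Fin d) : |(k j : ℝ)| ≤ γ j ^ (1 / α) * N := by
  rw [mem_cross hα hγ] at hk
  have h1 : rho α (γ j) (k j) ≤ rWeight α γ k := by
    rw [rWeight_eq_prod, ← Finset.mul_prod_erase _ _ (Finset.mem_univ j)]
    refine le_mul_of_one_le_right (rho_pos _ _ _).le ?_
    calc (1 : ℝ) = ∏ _i ∈ Finset.univ.erase j, (1 : ℝ) := by simp
      _ ≤ _ := Finset.prod_le_prod (fun _ _ => zero_le_one) fun i _ => one_le_rho _ _ _
  have h2 : |(k j : ℝ)| ^ α / γ j ≤ (N : ℝ) ^ α :=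
    (le_max_right _ _).trans (h1.trans (hk.le.trans hMN))
  rw [div_le_iff₀ (hγ j)] at h2
  have h3 := Real.rpow_le_rpow (by positivity) h2 (by positivity : 0 ≤ 1 / α)
  rw [← Real.rpow_mul (abs_nonneg _), mul_one_div_cancel hα.ne', Real.rpow_one,
    Real.mul_rpow (by positivity) (hγ j).le, ← Real.rpow_mul (by positivity),
    mul_one_div_cancel hα.ne', Real.rpow_one] at h3
  linarith

/-- Two frequencies in the same residue class differ by a dual vector. -/
theorem fiber_separated {d : ℕ} {α : ℝ} {γ : ℕ → ℝ} {N : ℕ} {g : Fin d → ℤ} {c M : ℝ}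
    (hdual : ∀ h : Fin d → ℤ, h ≠ 0 → idot h g ≡ 0 [ZMOD N] → c * M ≤ rWeight α γ h)
    {x y : Fin d → ℤ} (hxy : idot x g ≡ idot y g [ZMOD N])
    (hlt : rWeight α γ (x - y) < c * M) : x = y := by
  by_contra hne
  refine absurd (hdual (x - y) (sub_ne_zero.mpr hne) ?_) (not_le.mpr hlt)
  rw [idot_sub_left]
  simpa using hxy.sub_right (idot y g)

/-- A fiber is a separated subset of the cross, and the number `L` of dyadic levels is of order `log
M`, hence at most of order `log N`. -/
theorem exists_maxFiber_le {d : ℕ} (hd : 1 ≤ d) {α : ℝ} (hα : 1 / 2 < α) {γ : ℕ → ℝ}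
    (hγ : ∀ j, 0 < γ j) : ∃ K : ℝ, 0 < K ∧ ∀ N : ℕ, N.Prime → ∀ g : Fin d → ℤ,
      IsGeneratingVector α γ N g →
      (maxFiber (cross d α γ (truncM d α γ N)) N g : ℝ) ≤ K * Real.log N ^ (d - 1) := by
  have hα0 : 0 < α := by linarith
  obtain ⟨c, hc, -, hdual⟩ := exists_truncM_le_rWeight d hα hγ
  have hlow := lowConst_pos d α hγ
  have hup := upConst_pos d γ
  have hlow1 : lowConst d α γ ≤ 1 := by
    calc lowConst d α γ ≤ ∏ _j : Fin d, (1 : ℝ) :=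
          Finset.prod_le_prod (fun j _ => by have := hγ j; positivity) fun j _ => min_le_left _ _
      _ = 1 := by simp
  have hb : (1 : ℝ) < 2 ^ α := Real.one_lt_rpow one_lt_two hα0
  set K₀ : ℝ := 2 ^ d * max 1 (2 * (upConst d γ / (c * lowConst d α γ)) ^ (1 / α)) with hK₀
  have hl2 : 0 < Real.log 2 := Real.log_pos one_lt_two
  set a : ℝ := 1 + -Real.log (lowConst d α γ) / (α * Real.log 2) with ha
  have ha0 : 0 ≤ a := by
    have : 0 ≤ -Real.log (lowConst d α γ) := by
      have := Real.log_nonpos hlow.le hlow1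
      linarith
    positivity
  set K₁ : ℝ := a / Real.log 2 + 1 / Real.log 2 with hK₁
  refine ⟨K₁ ^ (d - 1) * K₀, by positivity, fun N hN g hg => ?_⟩
  set M := truncM d α γ N with hM
  have hlogN : 0 < Real.log N := Real.log_pos (by exact_mod_cast hN.one_lt)
  have hfib : ∀ l ∈ cross d α γ M,
      ((fiber (cross d α γ M) N g l).card : ℝ) ≤ K₁ ^ (d - 1) * K₀ * Real.log N ^ (d - 1) := by
    intro l hl
    rw [mem_cross hα0 hγ] at hl
    have hM1 : 1 < M := (one_le_rWeight α γ l).trans_lt hl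
    obtain ⟨L, hL, hL'⟩ := exists_nat_pow_near (x := M / lowConst d α γ) (y := 2 ^ α)
      (by rw [le_div_iff₀ hlow]; linarith) hb
    rw [le_div_iff₀ hlow, mul_comm] at hL
    rw [div_lt_iff₀ hlow, mul_comm] at hL'
    have hcard := card_le_of_separated_cross hd hα0 hγ (P := fiber (cross d α γ M) N g l) (M := M)
      hc (fun x hx y hy hlt => fiber_separated (hdual N hN g hg)
        ((mem_fiber.mp hx).2.trans (mem_fiber.mp hy).2.symm) hlt)
      (fun h hh => (mem_cross hα0 hγ).mp (mem_fiber.mp hh).1) hL hL'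
    have hLlog : (L : ℝ) + 1 ≤ K₁ * Real.log N := by
      have h1 := hL.trans (truncM_le (d := d) hα hγ hN.one_le)
      have h2 := Real.log_le_log (by positivity) h1
      rw [Real.log_mul hlow.ne' (by positivity), Real.log_pow, Real.log_rpow two_pos,
        Real.log_rpow (by exact_mod_cast hN.pos)] at h2
      have h3 : (L : ℝ) + 1 ≤ a + 1 / Real.log 2 * Real.log N := by
        have h4 : (L : ℝ) * (α * Real.log 2) ≤
            (-Real.log (lowConst d α γ) / (α * Real.log 2) + 1 / Real.log 2 * Real.log N) *
              (α * Real.log 2) := by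
          rw [add_mul, div_mul_cancel₀ _ (by positivity),
            show 1 / Real.log 2 * Real.log N * (α * Real.log 2) = α * Real.log N by field_simp]
          linarith
        have h5 := le_of_mul_le_mul_right h4 (by positivity)
        linarith
      have h6 := const_le_mul_log hN.two_le ha0
      rw [hK₁, add_mul]
      linarith
    calc _ ≤ ((L : ℝ) + 1) ^ (d - 1) * K₀ := hcard
      _ ≤ (K₁ * Real.log N) ^ (d - 1) * K₀ := by gcongr
      _ = _ := by
        rw [mul_pow]
        ring
  -- The cross is empty if `M ≤ 1`; then the supremum is `0`.
  rcases (cross d α γ M).eq_empty_or_nonempty with hemp | hne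
  · rw [maxFiber, hemp, Finset.sup_empty]
    simp only [Nat.bot_eq_zero, Nat.cast_zero]
    positivity
  · obtain ⟨l, hl, hmax⟩ := Finset.exists_mem_eq_sup _ hne
      fun l => (fiber (cross d α γ M) N g l).card
    rw [maxFiber, hmax]
    exact hfib l hl

theorem card_diffSet_le {d : ℕ} (A : Finset (Fin d → ℤ)) (N : ℕ) (g : Fin d → ℤ) :
    (diffSet A N g).card ≤ A.card ^ 3 := by
  rw [diffSet]
  refine (Finset.card_erase_le).trans (Finset.card_biUnion_le.trans ?_)
  refine (Finset.sum_le_card_nsmul _ _ (A.card ^ 2) fun l _ => ?_).trans ?_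
  · refine Finset.card_image_le.trans ?_
    rw [Finset.card_product, sq]
    exact Nat.mul_le_mul (Finset.card_filter_le _ _) (Finset.card_filter_le _ _)
  · rw [smul_eq_mul]
    exact le_of_eq (by ring)

/-- Only `log V` matters, so crude polynomial bounds do: frequencies are `O(N)`, and the entries of
the projection vector are at most `|H| + 1` with `|H| ≤ |A|³`. -/
theorem exists_log_projBound_le (d : ℕ) {α : ℝ} (hα : 1 / 2 < α) {γ : ℕ → ℝ}
    (hγ : ∀ j, 0 < γ j) : ∃ K : ℝ, 0 < K ∧ ∀ N : ℕ, N.Prime → ∀ g : Fin d → ℤ,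
      Real.log (projBound (diffSet (cross d α γ (truncM d α γ N)) N g)
        (projVec (diffSet (cross d α γ (truncM d α γ N)) N g))) ≤ K * Real.log N := by
  have hα0 : 0 < α := by linarith
  obtain ⟨KA, hKA, hcard⟩ := card_cross_le d hα0 hγ (q := 2) two_pos (by linarith)
  set G : ℝ := ∑ j : Fin d, γ j ^ (1 / α) with hG
  have hG0 : 0 ≤ G := Finset.sum_nonneg fun j _ => Real.rpow_nonneg (hγ j).le _
  set D : ℝ := 1 + 2 * G * (KA ^ 3 + 2) with hD
  have hD1 : 1 ≤ D := by
    have : 0 ≤ 2 * G * (KA ^ 3 + 2) := by positivity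
    linarith
  have hlD : 0 ≤ Real.log D := Real.log_nonneg hD1
  have hl2 : 0 < Real.log 2 := Real.log_pos one_lt_two
  refine ⟨Real.log D / Real.log 2 + (1 + 6 * α), by positivity, fun N hN g => ?_⟩
  set M := truncM d α γ N with hM
  set A := cross d α γ M with hA
  set H := diffSet A N g with hH
  have hN1 : (1 : ℝ) ≤ N := by exact_mod_cast hN.one_le
  have hN0 : (0 : ℝ) < N := by linarith
  have hMN : M ≤ (N : ℝ) ^ α := truncM_le hα hγ hN.one_le
  have hM0 : 0 < M := truncM_pos hα hγ hN.one_le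
  have hHcard : (H.card : ℝ) ≤ KA ^ 3 * (N : ℝ) ^ (6 * α) := by
    have h1 : (H.card : ℝ) ≤ (A.card : ℝ) ^ 3 := by exact_mod_cast card_diffSet_le A N g
    have h2 : (A.card : ℝ) ≤ KA * (N : ℝ) ^ (2 * α) := by
      refine (hcard M hM0).trans ?_
      rw [mul_comm 2 α, Real.rpow_mul hN0.le]
      gcongr
    calc (H.card : ℝ) ≤ (KA * (N : ℝ) ^ (2 * α)) ^ 3 := h1.trans (by gcongr)
      _ = _ := by
        rw [mul_pow, ← Real.rpow_natCast ((N : ℝ) ^ (2 * α)), ← Real.rpow_mul hN0.le]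
        norm_num
        left
        ring_nf
  have hN6 : (1 : ℝ) ≤ (N : ℝ) ^ (6 * α) := Real.one_le_rpow hN1 (by positivity)
  have hV : (projBound H (projVec H) : ℝ) ≤ D * (N : ℝ) ^ (1 + 6 * α) := by
    have hall : ∀ h ∈ H, (((idot h (projVec H)).natAbs : ℕ) : ℝ) ≤ D * (N : ℝ) ^ (1 + 6 * α) := by
      intro h hh
      obtain ⟨-, hh'⟩ := Finset.mem_erase.mp hh
      obtain ⟨l, -, hh'⟩ := Finset.mem_biUnion.mp hh'
      obtain ⟨⟨m, n⟩, hmn, rfl⟩ := Finset.mem_image.mp hh'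
      obtain ⟨hm, hn⟩ := Finset.mem_product.mp hmn
      have hm := (mem_fiber.mp hm).1
      have hn := (mem_fiber.mp hn).1
      dsimp only at hm hn ⊢
      rw [Nat.cast_natAbs, Int.cast_abs, idot, Int.cast_sum]
      calc |∑ j, (((n - m) j * projVec H j : ℤ) : ℝ)|
          ≤ ∑ j, |(((n - m) j * projVec H j : ℤ) : ℝ)| := Finset.abs_sum_le_sum_abs _ _
        _ ≤ ∑ j : Fin d, 2 * (γ j ^ (1 / α) * N) * (KA ^ 3 * (N : ℝ) ^ (6 * α) + 2) := by
            refine Finset.sum_le_sum fun j _ => ?_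
            have h1 := abs_le_of_mem_cross hα0 hγ hMN hm j
            have h2 := abs_le_of_mem_cross hα0 hγ hMN hn j
            have h3 : |(projVec H j : ℝ)| ≤ H.card + 1 := by
              rw [← Int.cast_abs, ← Nat.cast_natAbs]
              exact_mod_cast (projVec_spec H j).2
            rw [Int.cast_mul, abs_mul, Pi.sub_apply, Int.cast_sub]
            have h4 : |(n j : ℝ) - m j| ≤ 2 * (γ j ^ (1 / α) * N) :=
              (abs_sub _ _).trans (by linarith)
            have h5 : |(projVec H j : ℝ)| ≤ KA ^ 3 * (N : ℝ) ^ (6 * α) + 2 := by linarith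
            exact mul_le_mul h4 h5 (abs_nonneg _) ((abs_nonneg _).trans h4)
        _ = 2 * G * N * (KA ^ 3 * (N : ℝ) ^ (6 * α) + 2) := by
            rw [hG, ← Finset.sum_mul, ← Finset.mul_sum, ← Finset.sum_mul]
            ring
        _ ≤ 2 * G * N * ((KA ^ 3 + 2) * (N : ℝ) ^ (6 * α)) := by
            gcongr
            linarith
        _ = 2 * G * (KA ^ 3 + 2) * (N : ℝ) ^ (1 + 6 * α) := by
            rw [Real.rpow_add hN0, Real.rpow_one]
            ring
        _ ≤ D * (N : ℝ) ^ (1 + 6 * α) := by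
            gcongr
            rw [hD]
            linarith
    rcases H.eq_empty_or_nonempty with hemp | hne
    · rw [projBound, hemp, Finset.sup_empty]
      simp only [Nat.bot_eq_zero, Nat.cast_zero]
      positivity
    · obtain ⟨h, hh, hmax⟩ := Finset.exists_mem_eq_sup _ hne
        fun h => (idot h (projVec H)).natAbs
      rw [projBound, hmax]
      exact hall h hh
  have hlogN : 0 ≤ Real.log N := Real.log_nonneg hN1
  have hlogV : Real.log (projBound H (projVec H)) ≤ Real.log (D * (N : ℝ) ^ (1 + 6 * α)) := by
    -- For `V = 0` the convention `log 0 = 0` applies.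
    rcases Nat.eq_zero_or_pos (projBound H (projVec H)) with h0 | h0
    · rw [h0, Nat.cast_zero, Real.log_zero]
      refine Real.log_nonneg ?_
      have : (1 : ℝ) ≤ (N : ℝ) ^ (1 + 6 * α) := Real.one_le_rpow hN1 (by positivity)
      nlinarith
    · exact Real.log_le_log (by exact_mod_cast h0) hV
  refine hlogV.trans ?_
  rw [Real.log_mul (by positivity) (by positivity), Real.log_rpow hN0, add_mul]
  have := const_le_mul_log hN.two_le hlD
  linarith

/-- The number of shifts is polylogarithmic, and the shifts are stable on all fibers. -/
theorem exists_shifts_good {d : ℕ} (hd : 1 ≤ d) {α : ℝ} (hα : 1 / 2 < α) {γ : ℕ → ℝ}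
    (hγ : ∀ j, 0 < γ j) {t : ℝ} (ht0 : 0 < t) (ht1 : t < 1) :
    ∃ K : ℝ, 0 < K ∧ ∀ N : ℕ, N.Prime → ∀ g : Fin d → ℤ, IsGeneratingVector α γ N g →
      1 ≤ (shifts α γ t N g).length ∧
      ((shifts α γ t N g).length : ℝ) ≤ K * Real.log N ^ (2 * d) ∧
      ∀ l ∈ cross d α γ (truncM d α γ N), IsStable (min (1 - t) (1 / 2048)) (shifts α γ t N g)
        (fiber (cross d α γ (truncM d α γ N)) N g l) := by
  obtain ⟨KR, hKR, hR⟩ := exists_maxFiber_le hd hα hγ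
  obtain ⟨KV, hKV, hV⟩ := exists_log_projBound_le d hα hγ
  have hl2 : 0 < Real.log 2 := Real.log_pos one_lt_two
  set KB : ℝ := 2 * KR * KV / (0.32 * t) with hKB
  have hKB0 : 0 < KB := by positivity
  set K : ℝ := 1024 * (2 * KB + 4 / Real.log 2 ^ d) ^ 2 with hK
  refine ⟨K, by positivity, fun N hN g hg => ?_⟩
  set A := cross d α γ (truncM d α γ N) with hA
  have hlogN : Real.log 2 ≤ Real.log N :=
    Real.log_le_log two_pos (by exact_mod_cast hN.two_le)
  have hlogN0 : 0 < Real.log N := by linarith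
  -- Additive constants are absorbed into powers of `log N` because `N ≥ 2`.
  have hone : 1 ≤ 1 / Real.log 2 ^ d * Real.log N ^ d := by
    rw [div_mul_eq_mul_div, one_mul, one_le_div₀ (by positivity)]
    gcongr
  rcases adaptiveShifts_good (A := A) (N := N) (g := g) ht0 ht1
    ((⌊(γ 0 * truncM d α γ N) ^ (1 / α)⌋ : ℝ) * (⌊(γ 1 * truncM d α γ N) ^ (1 / α)⌋ : ℝ) / N)
    with h | ⟨hR1, h⟩
  · refine ⟨h.1, ?_, h.2.2⟩
    have h1 : ((shifts α γ t N g).length : ℝ) ≤ 1 := by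
      rw [← Nat.cast_one]
      exact Nat.cast_le.mpr h.2.1
    refine h1.trans ?_
    calc (1 : ℝ) ≤ 1 * (1 / Real.log 2 ^ d * Real.log N ^ d) ^ 2 := by
          rw [one_mul]
          exact one_le_pow₀ hone
      _ ≤ 1024 * ((2 * KB + 4 / Real.log 2 ^ d) * Real.log N ^ d) ^ 2 := by
          gcongr
          · norm_num
          · have : 1 / Real.log 2 ^ d ≤ 4 / Real.log 2 ^ d := by
              gcongr
              norm_num
            linarith
      _ = K * Real.log N ^ (2 * d) := by
          rw [hK, mul_pow, ← pow_mul, mul_comm d 2]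
          ring
  · refine ⟨h.1, ?_, h.2.2⟩
    set R := maxFiber A N g with hRdef
    set V := projBound (diffSet A N g) (projVec (diffSet A N g)) with hVdef
    have h1 : ((shifts α γ t N g).length : ℝ) ≤ (crtPrimes R V t).sum :=
      Nat.cast_le.mpr h.2.1
    have h2 := sum_crtPrimes_le_sq hR1 V ht0
    -- The power `d - 1` stems from `R` and one more from `log V`; the length of the shift set is
    -- quadratic in this bound.
    have h3 : crtBound R V t ≤ KB * Real.log N ^ d := by
      have hd' : Real.log N ^ d = Real.log N ^ (d - 1) * Real.log N := by
        rw [← pow_succ, Nat.sub_add_cancel hd]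
      rw [crtBound, hKB, hd', div_mul_eq_mul_div]
      have h4 : ((R : ℝ) - 1) * Real.log V ≤
          (KR * Real.log N ^ (d - 1)) * (KV * Real.log N) := by
        refine mul_le_mul ?_ (hV N hN g) (Real.log_natCast_nonneg V) (by positivity)
        have := hR N hN g hg
        linarith
      rw [div_le_div_iff_of_pos_right (by positivity)]
      linarith
    have h5 := crtBound_nonneg hR1 V ht0
    calc _ ≤ 1024 * (2 * crtBound R V t + 4) ^ 2 := h1.trans h2
      _ ≤ 1024 * (2 * (KB * Real.log N ^ d) + 4 * (1 / Real.log 2 ^ d * Real.log N ^ d)) ^ 2 := by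
          gcongr
          linarith
      _ = K * Real.log N ^ (2 * d) := by
          rw [hK, mul_comm 2 d, pow_mul]
          ring

open Filter Topology

/-! ### Orthonormal systems on the unit cube -/

theorem summable_norm_mul_of_bounded {ι : Type*} {a w : ι → ℂ} (ha : Summable fun i => ‖a i‖) {B : ℝ}
    (hw : ∀ i, ‖w i‖ ≤ B) : Summable fun i => ‖a i * w i‖ := by
  refine Summable.of_nonneg_of_le (fun i => norm_nonneg _) (fun i => ?_) (ha.mul_right B)
  rw [norm_mul]
  exact mul_le_mul_of_nonneg_left (hw i) (norm_nonneg _)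

theorem integral_norm_sq_sum {Ω ι : Type*} [MeasurableSpace Ω] {μ : Measure Ω} [DecidableEq ι]
    {ψ : ι → Ω → ℂ} (hint : ∀ i j, Integrable (fun x => ψ i x * (starRingEnd ℂ) (ψ j x)) μ)
    (horth : ∀ i j, ∫ x, ψ i x * (starRingEnd ℂ) (ψ j x) ∂μ = if i = j then 1 else 0)
    (a : ι → ℂ) (s : Finset ι) :
    ∫ x, ‖∑ i ∈ s, a i * ψ i x‖ ^ 2 ∂μ = ∑ i ∈ s, ‖a i‖ ^ 2 := by
  have h1 : ∀ x, ((‖∑ i ∈ s, a i * ψ i x‖ ^ 2 : ℝ) : ℂ) = ∑ i ∈ s, ∑ j ∈ s,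
      a i * (starRingEnd ℂ) (a j) * (ψ i x * (starRingEnd ℂ) (ψ j x)) := by
    intro x
    rw [Complex.ofReal_pow, ← Complex.mul_conj', map_sum, Finset.sum_mul_sum]
    refine Finset.sum_congr rfl fun i _ => Finset.sum_congr rfl fun j _ => ?_
    rw [map_mul]
    ring
  have h2 : ((∫ x, ‖∑ i ∈ s, a i * ψ i x‖ ^ 2 ∂μ : ℝ) : ℂ) = ((∑ i ∈ s, ‖a i‖ ^ 2 : ℝ) : ℂ) := by
    rw [← integral_complex_ofReal]
    simp_rw [h1]
    rw [integral_finsetSum _ fun i _ => integrable_finsetSum _ fun j _ => (hint i j).const_mul _]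
    rw [Complex.ofReal_sum]
    refine Finset.sum_congr rfl fun i hi => ?_
    rw [integral_finsetSum _ fun j _ => (hint i j).const_mul _]
    simp_rw [integral_const_mul, horth, mul_ite, mul_one, mul_zero]
    rw [Finset.sum_ite_eq, if_pos hi, Complex.mul_conj', Complex.ofReal_pow]
  exact_mod_cast h2

/-- Parseval's identity for absolutely summable series of a bounded orthonormal system. -/
theorem lintegral_enorm_sq_tsum {Ω ι : Type*} [MeasurableSpace Ω] {μ : Measure Ω}
    [IsFiniteMeasure μ] [Countable ι] {ψ : ι → Ω → ℂ} (hmeas : ∀ i, Measurable (ψ i)) {B : ℝ}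
    (hB : ∀ i x, ‖ψ i x‖ ≤ B) [DecidableEq ι]
    (horth : ∀ i j, ∫ x, ψ i x * (starRingEnd ℂ) (ψ j x) ∂μ = if i = j then 1 else 0)
    {a : ι → ℂ} (ha : Summable fun i => ‖a i‖) (ha2 : Summable fun i => ‖a i‖ ^ 2) :
    ∫⁻ x, ‖∑' i, a i * ψ i x‖ₑ ^ 2 ∂μ = ENNReal.ofReal (∑' i, ‖a i‖ ^ 2) := by
  have hsum : ∀ x, Summable fun i => ‖a i * ψ i x‖ := fun x =>
    summable_norm_mul_of_bounded ha fun i => hB i x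
  have hint : ∀ i j, Integrable (fun x => ψ i x * (starRingEnd ℂ) (ψ j x)) μ := by
    intro i j
    refine Integrable.of_bound (C := B * B) ?_ (ae_of_all _ fun x => ?_)
    · have h1 := hmeas i
      have h2 := hmeas j
      exact (h1.mul (Complex.continuous_conj.measurable.comp h2)).aestronglyMeasurable
    · rw [norm_mul, RCLike.norm_conj]
      exact mul_le_mul (hB i x) (hB j x) (norm_nonneg _) ((norm_nonneg _).trans (hB i x))
  have hfin : ∀ s : Finset ι, ∫⁻ x, ‖∑ i ∈ s, a i * ψ i x‖ₑ ^ 2 ∂μ =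
      ENNReal.ofReal (∑ i ∈ s, ‖a i‖ ^ 2) := by
    intro s
    have hm : Measurable fun x => ∑ i ∈ s, a i * ψ i x :=
      Finset.measurable_fun_sum _ fun i _ => (hmeas i).const_mul _
    rw [← integral_norm_sq_sum hint horth a s, ofReal_integral_eq_lintegral_ofReal]
    · refine lintegral_congr fun x => ?_
      rw [ENNReal.ofReal_pow (norm_nonneg _), ofReal_norm]
    · refine Integrable.of_bound (C := (∑ i ∈ s, ‖a i‖ * B) ^ 2)
        (hm.norm.pow_const 2).aestronglyMeasurable (ae_of_all _ fun x => ?_)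
      rw [Real.norm_of_nonneg (by positivity)]
      gcongr
      refine (norm_sum_le _ _).trans (Finset.sum_le_sum fun i _ => ?_)
      rw [norm_mul]
      exact mul_le_mul_of_nonneg_left (hB i x) (norm_nonneg _)
    · exact ae_of_all _ fun x => by positivity
  -- The finite identity passes to the limit by dominated convergence, with a constant as majorant.
  have hlim1 : Tendsto (fun s : Finset ι => ∫⁻ x, ‖∑ i ∈ s, a i * ψ i x‖ₑ ^ 2 ∂μ) atTop
      (𝓝 (∫⁻ x, ‖∑' i, a i * ψ i x‖ₑ ^ 2 ∂μ)) := by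
    refine tendsto_lintegral_filter_of_dominated_convergence
      (fun _ => ENNReal.ofReal ((∑' i, ‖a i‖ * B) ^ 2)) ?_ ?_ ?_ ?_
    · refine Eventually.of_forall fun s => ?_
      have hm : Measurable fun x => ∑ i ∈ s, a i * ψ i x :=
        Finset.measurable_fun_sum _ fun i _ => (hmeas i).const_mul _
      exact hm.enorm.pow_const 2
    · refine Eventually.of_forall fun s => ae_of_all _ fun x => ?_
      rw [← ofReal_norm, ← ENNReal.ofReal_pow (norm_nonneg _)]
      refine ENNReal.ofReal_le_ofReal ?_
      gcongr
      refine (norm_sum_le _ _).trans ?_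
      -- The sign of `B` is known only if there is an index at all.
      have hB0 : 0 ≤ B ∨ IsEmpty ι := by
        rcases isEmpty_or_nonempty ι with h | ⟨⟨i⟩⟩
        · exact Or.inr h
        · exact Or.inl ((norm_nonneg _).trans (hB i x))
      rcases hB0 with hB0 | hemp
      · refine le_trans (Finset.sum_le_sum fun i _ => ?_)
          ((ha.mul_right B).sum_le_tsum s fun i _ => mul_nonneg (norm_nonneg _) hB0)
        rw [norm_mul]
        exact mul_le_mul_of_nonneg_left (hB i x) (norm_nonneg _)
      · simp [Finset.eq_empty_of_isEmpty s]
    · rw [lintegral_const]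
      exact ENNReal.mul_ne_top ENNReal.ofReal_ne_top (measure_ne_top _ _)
    · refine ae_of_all _ fun x => ?_
      exact ((ENNReal.continuous_pow 2).tendsto _).comp
        ((continuous_enorm.tendsto _).comp (hsum x).of_norm.hasSum)
  have hlim2 : Tendsto (fun s : Finset ι => ∫⁻ x, ‖∑ i ∈ s, a i * ψ i x‖ₑ ^ 2 ∂μ) atTop
      (𝓝 (ENNReal.ofReal (∑' i, ‖a i‖ ^ 2))) := by
    simp_rw [hfin]
    exact (ENNReal.continuous_ofReal.tendsto _).comp ha2.hasSum
  exact tendsto_nhds_unique hlim1 hlim2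

theorem integral_cube_prod {𝕜 : Type*} [RCLike 𝕜] {d : ℕ} (f : Fin d → ℝ → 𝕜) :
    ∫ x in cube d, ∏ j, f j (x j) = ∏ j, ∫ y in Set.Icc (0 : ℝ) 1, f j y := by
  have h : (volume : Measure (Fin d → ℝ)).restrict (cube d) =
      Measure.pi fun _ : Fin d => (volume : Measure ℝ).restrict (Set.Icc 0 1) := by
    rw [cube, ← Set.pi_univ_Icc, volume_pi]
    exact Measure.restrict_pi_pi _ _
  rw [h, integral_fintype_prod_eq_prod]

instance isFiniteMeasure_cube (d : ℕ) :
    IsFiniteMeasure ((volume : Measure (Fin d → ℝ)).restrict (cube d)) :=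
  ⟨by
    rw [Measure.restrict_apply_univ]
    exact (isCompact_Icc : IsCompact (cube d)).measure_lt_top⟩

theorem volume_cube (d : ℕ) : volume (cube d) = 1 := by
  rw [cube, Real.volume_Icc_pi]
  simp

theorem integral_Icc_expi (n : ℤ) :
    ∫ x in Set.Icc (0 : ℝ) 1, expi (n * x) = if n = 0 then 1 else 0 := by
  rw [integral_Icc_eq_integral_Ioc, ← intervalIntegral.integral_of_le zero_le_one]
  split_ifs with h
  · simp [h, expi_zero]
  · have hc : (2 * Real.pi * Complex.I * n : ℂ) ≠ 0 :=
      mul_ne_zero Complex.two_pi_I_ne_zero (by exact_mod_cast h)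
    have h1 : ∀ x : ℝ, expi (n * x) = Complex.exp (2 * Real.pi * Complex.I * n * x) := by
      intro x
      rw [expi]
      push_cast
      ring_nf
    simp_rw [h1]
    rw [integral_exp_mul_complex hc]
    have h2 := h1 1
    rw [mul_one, expi_int] at h2
    rw [← h2]
    simp

theorem expi_rdot_eq_prod {d : ℕ} (h : Fin d → ℤ) (x : Fin d → ℝ) :
    expi (rdot h x) = ∏ j, expi (h j * x j) := by
  simp only [expi, rdot]
  rw [← Complex.exp_sum]
  push_cast
  rw [Finset.mul_sum]

theorem integral_expi_orth {d : ℕ} (h l : Fin d → ℤ) :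
    ∫ x in cube d, expi (rdot h x) * (starRingEnd ℂ) (expi (rdot l x)) =
      if h = l then 1 else 0 := by
  have h1 : ∀ x : Fin d → ℝ, expi (rdot h x) * (starRingEnd ℂ) (expi (rdot l x)) =
      ∏ j, expi ((h - l) j * x j) := by
    intro x
    rw [conj_expi, ← expi_add, ← sub_eq_add_neg, ← rdot_sub_left, expi_rdot_eq_prod]
  simp_rw [h1]
  rw [integral_cube_prod fun j y => expi ((h - l) j * y)]
  simp_rw [integral_Icc_expi]
  rw [Finset.prod_ite_zero, Finset.prod_const_one]
  congr 1
  simp [funext_iff, sub_eq_zero]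

/-- The univariate factor of the cosine basis. -/
def cosFactor (n : ℕ) (x : ℝ) : ℝ := (if n = 0 then 1 else √2) * Real.cos (Real.pi * n * x)

theorem cosBasis_eq_prod {d : ℕ} (k : Fin d → ℕ) (x : Fin d → ℝ) :
    cosBasis k x = ∏ j, cosFactor (k j) (x j) := by
  simp only [cosBasis, cosFactor, nnz]
  rw [Finset.prod_mul_distrib]
  congr 1
  rw [Finset.prod_ite, Finset.prod_const_one, one_mul, Finset.prod_const]

theorem continuous_cosBasis {d : ℕ} (k : Fin d → ℕ) : Continuous (cosBasis k) := by
  unfold cosBasis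
  fun_prop

theorem abs_cosFactor_le (n : ℕ) (x : ℝ) : |cosFactor n x| ≤ √2 := by
  have h2 : (1 : ℝ) ≤ √2 := Real.one_le_sqrt.mpr one_le_two
  rw [cosFactor, abs_mul]
  have h1 := Real.abs_cos_le_one (Real.pi * n * x)
  have h3 : |if n = 0 then (1 : ℝ) else √2| ≤ √2 := by
    split_ifs
    · rwa [abs_one]
    · rw [abs_of_nonneg (Real.sqrt_nonneg _)]
  calc _ ≤ √2 * 1 := mul_le_mul h3 h1 (abs_nonneg _) (Real.sqrt_nonneg _)
    _ = √2 := mul_one _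

theorem abs_cosBasis_le {d : ℕ} (k : Fin d → ℕ) (x : Fin d → ℝ) : |cosBasis k x| ≤ √2 ^ d := by
  rw [cosBasis_eq_prod, Finset.abs_prod]
  calc ∏ j, |cosFactor (k j) (x j)| ≤ ∏ _j : Fin d, √2 :=
        Finset.prod_le_prod (fun _ _ => abs_nonneg _) fun j _ => abs_cosFactor_le _ _
    _ = √2 ^ d := by simp

theorem integral_Icc_cos (n : ℤ) :
    ∫ x in Set.Icc (0 : ℝ) 1, Real.cos (Real.pi * n * x) = if n = 0 then 1 else 0 := by
  rw [integral_Icc_eq_integral_Ioc, ← intervalIntegral.integral_of_le zero_le_one]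
  split_ifs with h
  · simp [h]
  · have hc : Real.pi * n ≠ 0 := mul_ne_zero Real.pi_ne_zero (by exact_mod_cast h)
    rw [intervalIntegral.integral_comp_mul_left (fun x => Real.cos x) hc, integral_cos]
    rw [mul_one, mul_zero, Real.sin_zero, mul_comm Real.pi, Real.sin_int_mul_pi]
    simp

theorem integral_Icc_cosFactor (n m : ℕ) :
    ∫ x in Set.Icc (0 : ℝ) 1, cosFactor n x * cosFactor m x = if n = m then 1 else 0 := by
  have h1 : ∀ x : ℝ, cosFactor n x * cosFactor m x =
      (if n = 0 then 1 else √2) * (if m = 0 then 1 else √2) / 2 *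
        (Real.cos (Real.pi * ((n - m : ℤ) : ℝ) * x) +
          Real.cos (Real.pi * ((n + m : ℤ) : ℝ) * x)) := by
    intro x
    have h2 := Real.two_mul_cos_mul_cos (Real.pi * n * x) (Real.pi * m * x)
    push_cast
    rw [show Real.pi * ((n : ℝ) - m) * x = Real.pi * n * x - Real.pi * m * x by ring,
      show Real.pi * ((n : ℝ) + m) * x = Real.pi * n * x + Real.pi * m * x by ring, ← h2,
      cosFactor, cosFactor]
    ring
  have hcont : ∀ c : ℝ, IntegrableOn (fun x => Real.cos (Real.pi * c * x)) (Set.Icc (0 : ℝ) 1) :=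
    fun c => (by fun_prop : Continuous fun x => Real.cos (Real.pi * c * x)).integrableOn_Icc
  simp_rw [h1]
  rw [integral_const_mul, integral_add (hcont _) (hcont _), integral_Icc_cos, integral_Icc_cos]
  have hs : √2 * √2 = 2 := Real.mul_self_sqrt two_pos.le
  by_cases hnm : n = m
  · subst hnm
    by_cases hn : n = 0
    · norm_num [hn]
    · have : ((n : ℤ) + n) ≠ 0 := by lia
      simp [hn, this, hs]
  · have h3 : ((n : ℤ) - m) ≠ 0 := by lia
    have h4 : ((n : ℤ) + m) ≠ 0 := by lia
    simp [hnm, h3, h4]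

theorem integral_cosBasis_orth {d : ℕ} (k l : Fin d → ℕ) :
    ∫ x in cube d, cosBasis k x * cosBasis l x = if k = l then 1 else 0 := by
  simp_rw [cosBasis_eq_prod, ← Finset.prod_mul_distrib]
  rw [integral_cube_prod fun j y => cosFactor (k j) y * cosFactor (l j) y]
  simp_rw [integral_Icc_cosFactor]
  rw [Finset.prod_ite_zero, Finset.prod_const_one]
  congr 1
  simp [funext_iff]

theorem integral_cosBasis_orth_complex {d : ℕ} (k l : Fin d → ℕ) :
    ∫ x in cube d, (cosBasis k x : ℂ) * (starRingEnd ℂ) (cosBasis l x : ℂ) =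
      if k = l then 1 else 0 := by
  simp_rw [Complex.conj_ofReal, ← Complex.ofReal_mul]
  rw [integral_complex_ofReal, integral_cosBasis_orth]
  split_ifs <;> simp

/-! ### Least squares on a fiber -/

/-- The entry at `h` of the least-squares solution for the frequencies in `F`. -/
def lsqCoeff {d : ℕ} (Y : List (Fin d → ℝ)) (F : Finset (Fin d → ℤ)) (v : Fin Y.length → ℂ)
    (h : Fin d → ℤ) : ℂ :=
  if hh : h ∈ F then
    ((((sysMatrix Y F).conjTranspose * sysMatrix Y F)⁻¹).mulVec
      ((sysMatrix Y F).conjTranspose.mulVec v)) ⟨h, hh⟩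
  else 0

theorem coeffEst_eq {d : ℕ} (A : Finset (Fin d → ℤ)) (G : (Fin d → ℝ) → ℂ) (N : ℕ)
    (g : Fin d → ℤ) (Y : List (Fin d → ℝ)) (Δ : Fin d → ℝ) (l : Fin d → ℤ) :
    coeffEst A G N g Y Δ l =
      expi (-(rdot l Δ)) * lsqCoeff Y (fiber A N g l) (observation G N g Y Δ l) l := by
  rw [coeffEst, lsqCoeff]
  split_ifs with h
  · rfl
  · rw [mul_zero]

theorem energy_eq_mulVec {d : ℕ} (Y : List (Fin d → ℝ)) (F : Finset (Fin d → ℤ))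
    (x : (Fin d → ℤ) → ℂ) : energy Y F x =
      ∑ s, ‖((sysMatrix Y F).mulVec fun m => x m.1) s‖ ^ 2 := by
  rw [energy, ← Fin.sum_univ_fun_getElem]
  refine Finset.sum_congr rfl fun s _ => ?_
  congr 2
  rw [Matrix.mulVec, dotProduct, ← Finset.sum_coe_sort F]
  refine Finset.sum_congr rfl fun m _ => ?_
  rw [mul_comm]
  rfl

/-- Least squares reproduces `x` exactly, so the error is the least-squares solution `u` for the
noise. Its image `B u` is the orthogonal projection of the noise, and stability bounds `u` by `B u`.
-/
theorem lsqCoeff_error {d : ℕ} {κ : ℝ} (hκ : 0 < κ) {Y : List (Fin d → ℝ)} (hY : 1 ≤ Y.length)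
    {F : Finset (Fin d → ℤ)} (hst : IsStable κ Y F) {x : (Fin d → ℤ) → ℂ}
    {v η : Fin Y.length → ℂ}
    (hv : ∀ s, v s = ∑ m ∈ F, x m * expi (rdot m (Y.get s)) + η s) :
    ∑ h ∈ F, ‖lsqCoeff Y F v h - x h‖ ^ 2 ≤ (κ * Y.length)⁻¹ * ∑ s, ‖η s‖ ^ 2 := by
  classical
  set B := sysMatrix Y F with hB
  have hYpos : (0 : ℝ) < Y.length := by exact_mod_cast hY
  have hext : ∀ u : F → ℂ, κ * Y.length * ∑ m, ‖u m‖ ^ 2 ≤ ∑ s, ‖(B.mulVec u) s‖ ^ 2 := by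
    intro u
    have h1 := hst fun m => if hm : m ∈ F then u ⟨m, hm⟩ else 0
    rw [energy_eq_mulVec, ← Finset.sum_coe_sort F] at h1
    simpa using h1
  -- The kernel of `Bᴴ B` is that of `B`, which stability makes trivial; so the inverse in the
  -- definition is a true inverse.
  have hinj : Function.Injective (B.conjTranspose * B).mulVec := by
    intro u w huw
    have h0 : (B.conjTranspose * B).mulVec (u - w) = 0 := by
      rw [Matrix.mulVec_sub, huw, sub_self]
    have h1 : B.mulVec (u - w) = 0 := by
      have h2 : star (u - w) ⬝ᵥ (B.conjTranspose * B).mulVec (u - w) = 0 := by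
        rw [h0, dotProduct_zero]
      rw [← Matrix.mulVec_mulVec, Matrix.dotProduct_mulVec, ← Matrix.star_mulVec] at h2
      have h3 : ∑ s, ‖(B.mulVec (u - w)) s‖ ^ 2 = 0 := by
        have h4 : ((∑ s, ‖(B.mulVec (u - w)) s‖ ^ 2 : ℝ) : ℂ) = 0 := by
          rw [← h2, Complex.ofReal_sum, dotProduct]
          refine Finset.sum_congr rfl fun s _ => ?_
          rw [Complex.ofReal_pow, ← Complex.conj_mul']
          rfl
        exact_mod_cast h4
      funext s
      have := (Finset.sum_eq_zero_iff_of_nonneg fun s _ => by positivity).mp h3 s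
        (Finset.mem_univ s)
      simpa using this
    have h5 := hext (u - w)
    rw [h1] at h5
    have h6 : ∑ m, ‖(u - w) m‖ ^ 2 ≤ 0 := by
      simp only [Pi.zero_apply, norm_zero, ne_eq, OfNat.ofNat_ne_zero, not_false_eq_true,
        zero_pow, Finset.sum_const_zero] at h5
      by_contra hpos
      push Not at hpos
      have : 0 < κ * Y.length * ∑ m, ‖(u - w) m‖ ^ 2 := by positivity
      linarith
    have h7 := le_antisymm h6 (Finset.sum_nonneg fun m _ => by positivity)
    funext m
    have := (Finset.sum_eq_zero_iff_of_nonneg fun m _ => by positivity).mp h7 m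
      (Finset.mem_univ m)
    have h8 : (u - w) m = 0 := by simpa using this
    exact sub_eq_zero.mp h8
  have hunit : IsUnit (B.conjTranspose * B) := Matrix.mulVec_injective_iff_isUnit.mp hinj
  have hdet : IsUnit (B.conjTranspose * B).det := (Matrix.isUnit_iff_isUnit_det _).mp hunit
  set u : F → ℂ := ((B.conjTranspose * B)⁻¹).mulVec (B.conjTranspose.mulVec η) with hu
  have hvx : v = B.mulVec (fun m => x m.1) + η := by
    funext s
    rw [hv s, Pi.add_apply, Matrix.mulVec, dotProduct, ← Finset.sum_coe_sort F]
    congr 1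
    refine Finset.sum_congr rfl fun m _ => ?_
    rw [mul_comm]
    rfl
  have hsol : ((B.conjTranspose * B)⁻¹).mulVec (B.conjTranspose.mulVec v) =
      (fun m : F => x m.1) + u := by
    rw [hvx, Matrix.mulVec_add, Matrix.mulVec_add, Matrix.mulVec_mulVec, Matrix.mulVec_mulVec,
      Matrix.mul_assoc, Matrix.nonsing_inv_mul _ hdet, Matrix.one_mulVec]
  have hleft : ∑ h ∈ F, ‖lsqCoeff Y F v h - x h‖ ^ 2 = ∑ m, ‖u m‖ ^ 2 := by
    rw [← Finset.sum_coe_sort F]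
    refine Finset.sum_congr rfl fun m _ => ?_
    rw [lsqCoeff, dif_pos m.2, hsol, Pi.add_apply, add_sub_cancel_left]
  have hnormal : B.conjTranspose.mulVec (B.mulVec u) = B.conjTranspose.mulVec η := by
    rw [hu, Matrix.mulVec_mulVec, Matrix.mulVec_mulVec, Matrix.mul_nonsing_inv _ hdet,
      Matrix.one_mulVec]
  -- By the normal equations `‖B u‖² = ⟨B u, η⟩`.
  have hproj : ∑ s, ‖(B.mulVec u) s‖ ^ 2 ≤ ∑ s, ‖η s‖ ^ 2 := by
    have h1 : star (B.mulVec u) ⬝ᵥ B.mulVec u = star (B.mulVec u) ⬝ᵥ η := by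
      rw [Matrix.star_mulVec, ← Matrix.dotProduct_mulVec, ← Matrix.dotProduct_mulVec, hnormal]
    have h2 : ((∑ s, ‖(B.mulVec u) s‖ ^ 2 : ℝ) : ℂ) = star (B.mulVec u) ⬝ᵥ η := by
      rw [← h1, Complex.ofReal_sum, dotProduct]
      refine Finset.sum_congr rfl fun s _ => ?_
      rw [Complex.ofReal_pow, ← Complex.conj_mul']
      rfl
    have h3 : ∑ s, ‖(B.mulVec u) s‖ ^ 2 ≤ ∑ s, ‖(B.mulVec u) s‖ * ‖η s‖ := by
      have h4 := congrArg norm h2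
      rw [Complex.norm_real, Real.norm_of_nonneg (Finset.sum_nonneg fun s _ => by positivity)] at h4
      rw [h4, dotProduct]
      refine (norm_sum_le _ _).trans (le_of_eq (Finset.sum_congr rfl fun s _ => ?_))
      rw [norm_mul, Pi.star_apply, norm_star]
    have h5 : ∑ s, ‖(B.mulVec u) s‖ * ‖η s‖ ≤
        ∑ s, (‖(B.mulVec u) s‖ ^ 2 / 2 + ‖η s‖ ^ 2 / 2) :=
      Finset.sum_le_sum fun s _ => by nlinarith [sq_nonneg (‖(B.mulVec u) s‖ - ‖η s‖)]
    rw [Finset.sum_add_distrib, ← Finset.sum_div, ← Finset.sum_div] at h5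
    linarith
  rw [hleft, le_inv_mul_iff₀ (by positivity)]
  exact (hext u).trans hproj

/-! ### From cosine series to Fourier series -/

/-- The componentwise absolute value of a frequency. -/
def absIdx {d : ℕ} (h : Fin d → ℤ) : Fin d → ℕ := fun j => (h j).natAbs

/-- The frequencies with componentwise absolute value `k`. -/
def signs {d : ℕ} (k : Fin d → ℕ) : Finset (Fin d → ℤ) :=
  Fintype.piFinset fun j => ({(k j : ℤ), -(k j : ℤ)} : Finset ℤ)

theorem mem_signs {d : ℕ} {k : Fin d → ℕ} {h : Fin d → ℤ} : h ∈ signs k ↔ absIdx h = k := by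
  rw [signs, Fintype.mem_piFinset, funext_iff]
  refine forall_congr' fun j => ?_
  rw [Finset.mem_insert, Finset.mem_singleton, absIdx]
  lia

theorem card_signs {d : ℕ} (k : Fin d → ℕ) : (signs k).card = 2 ^ nnz k := by
  have h1 : ∀ j, ({(k j : ℤ), -(k j : ℤ)} : Finset ℤ).card = if k j ≠ 0 then 2 else 1 := by
    intro j
    split_ifs with h
    · exact Finset.card_pair (by lia)
    · push Not at h
      simp [h]
  rw [signs, Fintype.card_piFinset]
  simp_rw [h1]
  rw [Finset.prod_ite, Finset.prod_const_one, mul_one, Finset.prod_const, nnz]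

theorem coe_signs {d : ℕ} (k : Fin d → ℕ) : absIdx ⁻¹' {k} = (signs k : Set (Fin d → ℤ)) := by
  ext h
  rw [Set.mem_preimage, Set.mem_singleton_iff, Finset.mem_coe, mem_signs]

theorem tsum_signs {M : Type*} [AddCommMonoid M] [TopologicalSpace M] {d : ℕ} (k : Fin d → ℕ)
    (F : (Fin d → ℤ) → M) : ∑' h : absIdx ⁻¹' {k}, F h = ∑ h ∈ signs k, F h := by
  rw [coe_signs]
  exact Finset.tsum_subtype (signs k) F

theorem hasSum_signs {d : ℕ} {E : Type*} [NormedAddCommGroup E] [CompleteSpace E]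
    {F : (Fin d → ℤ) → E} (hF : Summable F) :
    HasSum (fun k => ∑ h ∈ signs k, F h) (∑' h, F h) := by
  have := hF.hasSum.tsum_fiberwise absIdx
  simp_rw [tsum_signs] at this
  exact this

theorem summable_of_signs {d : ℕ} {F : (Fin d → ℤ) → ℝ} (hF0 : ∀ h, 0 ≤ F h)
    (hF : Summable fun k => ∑ h ∈ signs k, F h) : Summable F := by
  have h1 : ∑' k, ∑ h ∈ signs k, ENNReal.ofReal (F h) = ∑' h, ENNReal.ofReal (F h) :=
    (tsum_congr fun k => tsum_signs k fun h => ENNReal.ofReal (F h)).symm.trans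
      (ENNReal.tsum_fiberwise (fun h => ENNReal.ofReal (F h)) (absIdx (d := d)))
  have h2 : ∑' h, ENNReal.ofReal (F h) ≠ ⊤ := by
    rw [← h1]
    have h3 : ∀ k, ∑ h ∈ signs k, ENNReal.ofReal (F h) =
        ENNReal.ofReal (∑ h ∈ signs k, F h) := fun k =>
      (ENNReal.ofReal_sum_of_nonneg fun h _ => hF0 h).symm
    simp_rw [h3]
    exact hF.tsum_ofReal_ne_top
  have h4 := ENNReal.summable_toReal h2
  refine h4.congr fun h => ?_
  exact ENNReal.toReal_ofReal (hF0 h)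

theorem rWeight_absIdx {d : ℕ} (α : ℝ) (γ : ℕ → ℝ) (h : Fin d → ℤ) :
    rWeight α γ (fun j => (absIdx h j : ℤ)) = rWeight α γ h := by
  rw [rWeight, rWeight]
  refine Finset.prod_congr rfl fun j _ => ?_
  rw [absIdx, Int.natCast_natAbs, Int.cast_abs, abs_abs]

theorem rWeight_of_mem_signs {d : ℕ} (α : ℝ) (γ : ℕ → ℝ) {k : Fin d → ℕ} {h : Fin d → ℤ}
    (hh : h ∈ signs k) : rWeight α γ h = rWeight α γ (fun j => (k j : ℤ)) := by
  rw [← rWeight_absIdx, mem_signs.mp hh]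

/-- The Fourier coefficients `c_h = 2^{-|h|_0/2} f̃(|h|)` of `f ∘ ψ`. -/
def expCoeff {d : ℕ} (f : (Fin d → ℝ) → ℝ) (h : Fin d → ℤ) : ℝ :=
  (2 : ℝ) ^ (-(nnz (absIdx h) : ℝ) / 2) * cosCoeff f (absIdx h)

theorem two_rpow_half_sq (n : ℕ) : ((2 : ℝ) ^ (-(n : ℝ) / 2)) ^ 2 * 2 ^ n = 1 := by
  rw [← Real.rpow_natCast ((2 : ℝ) ^ (-(n : ℝ) / 2)), ← Real.rpow_mul two_pos.le,
    ← Real.rpow_natCast 2 n, ← Real.rpow_add two_pos]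
  norm_num

theorem expCoeff_of_mem_signs {d : ℕ} (f : (Fin d → ℝ) → ℝ) {k : Fin d → ℕ} {h : Fin d → ℤ}
    (hh : h ∈ signs k) : expCoeff f h = (2 : ℝ) ^ (-(nnz k : ℝ) / 2) * cosCoeff f k := by
  rw [expCoeff, mem_signs.mp hh]

/-- There are `2^|k|₀` sign patterns, each with the factor `2^(-|k|₀)`, so the weighted norm is
preserved. -/
theorem sum_signs_expCoeff_sq {d : ℕ} (α : ℝ) (γ : ℕ → ℝ) (f : (Fin d → ℝ) → ℝ)
    (k : Fin d → ℕ) : ∑ h ∈ signs k, expCoeff f h ^ 2 * rWeight α γ h ^ 2 =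
      |cosCoeff f k| ^ 2 * rWeight α γ (fun j => (k j : ℤ)) ^ 2 := by
  rw [Finset.sum_congr rfl fun h hh => by
    rw [expCoeff_of_mem_signs f hh, rWeight_of_mem_signs α γ hh], Finset.sum_const, card_signs,
    nsmul_eq_mul, sq_abs, mul_pow]
  push_cast
  calc _ = (((2 : ℝ) ^ (-(nnz k : ℝ) / 2)) ^ 2 * 2 ^ nnz k) *
        (cosCoeff f k ^ 2 * rWeight α γ (fun j => (k j : ℤ)) ^ 2) := by ring
    _ = _ := by rw [two_rpow_half_sq, one_mul]

/-- The cosine coefficient is recovered from the Fourier coefficients. -/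
theorem cosCoeff_eq_sum {d : ℕ} (f : (Fin d → ℝ) → ℝ) (k : Fin d → ℕ) :
    cosCoeff f k = (2 : ℝ) ^ (-(nnz k : ℝ) / 2) * ∑ h ∈ signs k, expCoeff f h := by
  rw [Finset.sum_congr rfl fun h hh => expCoeff_of_mem_signs f hh, Finset.sum_const, card_signs,
    nsmul_eq_mul]
  push_cast
  calc cosCoeff f k = (((2 : ℝ) ^ (-(nnz k : ℝ) / 2)) ^ 2 * 2 ^ nnz k) * cosCoeff f k := by
        rw [two_rpow_half_sq, one_mul]
    _ = _ := by ring

theorem summable_expCoeff_sq {d : ℕ} {α : ℝ} {γ : ℕ → ℝ} {f : (Fin d → ℝ) → ℝ}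
    (hf : MemCosineSpace α γ f) : Summable fun h => expCoeff f h ^ 2 * rWeight α γ h ^ 2 := by
  refine summable_of_signs (fun h => by positivity) ?_
  simp_rw [sum_signs_expCoeff_sq]
  exact hf.1

theorem tsum_expCoeff_sq {d : ℕ} {α : ℝ} {γ : ℕ → ℝ} {f : (Fin d → ℝ) → ℝ}
    (hf : MemCosineSpace α γ f) :
    ∑' h, expCoeff f h ^ 2 * rWeight α γ h ^ 2 = cosineNorm α γ f ^ 2 := by
  have h := hasSum_signs (summable_expCoeff_sq hf)
  simp_rw [sum_signs_expCoeff_sq] at h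
  rw [cosineNorm, Real.sq_sqrt (tsum_nonneg fun k => by positivity), h.tsum_eq]

theorem summable_rWeight {d : ℕ} {α : ℝ} (hα : 1 / 2 < α) {γ : ℕ → ℝ} (hγ : ∀ j, 0 < γ j) :
    Summable fun h : Fin d → ℤ => rWeight α γ h ^ (-2 : ℝ) := by
  have := ENNReal.summable_toReal (tsum_wgt_ne_top (d := d) hγ two_pos
    (by linarith : 1 < α * 2))
  simp_rw [wgt_toReal] at this
  exact this

/-- The coefficient is the product of the square-summable `|c_h| r(h)` and `r(h)⁻¹`; the latter is
square-summable because `α > 1/2`. -/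
theorem summable_abs_expCoeff {d : ℕ} {α : ℝ} (hα : 1 / 2 < α) {γ : ℕ → ℝ} (hγ : ∀ j, 0 < γ j)
    {f : (Fin d → ℝ) → ℝ} (hf : MemCosineSpace α γ f) : Summable fun h => |expCoeff f h| := by
  refine Summable.of_nonneg_of_le (fun h => abs_nonneg _) (fun h => ?_)
    ((summable_expCoeff_sq hf).add (summable_rWeight hα hγ))
  have hr := rWeight_pos α γ h
  have h1 : |expCoeff f h| = (|expCoeff f h| * rWeight α γ h) * (rWeight α γ h)⁻¹ := by
    field_simp
  rw [Real.rpow_neg hr.le, Real.rpow_two, ← inv_pow, ← sq_abs, ← mul_pow]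
  nlinarith [sq_nonneg (|expCoeff f h| * rWeight α γ h - (rWeight α γ h)⁻¹),
    sq_nonneg (|expCoeff f h| * rWeight α γ h), sq_nonneg (rWeight α γ h)⁻¹]

theorem abs_cosCoeff_le {d : ℕ} (f : (Fin d → ℝ) → ℝ) (k : Fin d → ℕ) :
    |cosCoeff f k| ≤ ∑ h ∈ signs k, |expCoeff f h| := by
  rw [cosCoeff_eq_sum, abs_mul]
  have h1 : (2 : ℝ) ^ (-(nnz k : ℝ) / 2) ≤ 1 :=
    Real.rpow_le_one_of_one_le_of_nonpos one_le_two (by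
      have : (0 : ℝ) ≤ nnz k := by positivity
      linarith)
  rw [abs_of_nonneg (by positivity : (0 : ℝ) ≤ (2 : ℝ) ^ (-(nnz k : ℝ) / 2))]
  calc _ ≤ 1 * ∑ h ∈ signs k, |expCoeff f h| :=
        mul_le_mul h1 (Finset.abs_sum_le_sum_abs _ _) (abs_nonneg _) zero_le_one
    _ = _ := one_mul _

theorem summable_abs_cosCoeff {d : ℕ} {α : ℝ} (hα : 1 / 2 < α) {γ : ℕ → ℝ} (hγ : ∀ j, 0 < γ j)
    {f : (Fin d → ℝ) → ℝ} (hf : MemCosineSpace α γ f) : Summable fun k => |cosCoeff f k| :=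
  Summable.of_nonneg_of_le (fun _ => abs_nonneg _) (fun k => abs_cosCoeff_le f k)
    (hasSum_signs (summable_abs_expCoeff hα hγ hf)).summable

theorem hasSum_cosCoeff {d : ℕ} {α : ℝ} {γ : ℕ → ℝ} {f : (Fin d → ℝ) → ℝ}
    (hf : MemCosineSpace α γ f) {x : Fin d → ℝ} (hx : x ∈ cube d) :
    HasSum (fun k => cosCoeff f k * cosBasis k x) (f x) :=
  hf.2.tendsto_at hx

/-- The tent map runs through the half period forth and back, so half-period cosines become cosines
of period one. -/
theorem cos_tent (n : ℕ) (z : ℝ) :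
    Real.cos (Real.pi * n * (1 - |2 * z - 1|)) = Real.cos (2 * Real.pi * n * z) := by
  rcases le_total 0 (2 * z - 1) with h | h
  · rw [abs_of_nonneg h, show Real.pi * n * (1 - (2 * z - 1)) =
      n * (2 * Real.pi) - 2 * Real.pi * n * z by ring, Real.cos_nat_mul_two_pi_sub]
  · rw [abs_of_nonpos h]
    ring_nf

theorem expi_add_neg (x : ℝ) : expi x + expi (-x) = ((2 * Real.cos (2 * Real.pi * x) : ℝ) : ℂ) := by
  have h1 : expi x = Complex.exp ((2 * Real.pi * x : ℝ) * Complex.I) := by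
    rw [expi]
    push_cast
    ring_nf
  have h2 : expi (-x) = Complex.exp (-(2 * Real.pi * x : ℝ) * Complex.I) := by
    rw [expi]
    push_cast
    ring_nf
  rw [h1, h2]
  push_cast
  rw [Complex.two_cos]

theorem cosFactor_tent (n : ℕ) (z : ℝ) : (cosFactor n (1 - |2 * z - 1|) : ℂ) =
    (((if n = 0 then 1 else (2 : ℝ) ^ (-(1 : ℝ) / 2)) : ℝ) : ℂ) *
      ∑ m ∈ ({(n : ℤ), -(n : ℤ)} : Finset ℤ), expi (m * z) := by
  rw [cosFactor, cos_tent]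
  split_ifs with h
  · simp [h, expi_zero]
  · rw [Finset.sum_pair (by lia)]
    have h1 : expi (((n : ℤ) : ℝ) * z) + expi (((-(n : ℤ) : ℤ) : ℝ) * z) =
        ((2 * Real.cos (2 * Real.pi * (n * z)) : ℝ) : ℂ) := by
      rw [← expi_add_neg]
      push_cast
      ring_nf
    rw [h1, ← Complex.ofReal_mul]
    congr 1
    have h2 : (2 : ℝ) ^ (-(1 : ℝ) / 2) * 2 = √2 := by
      rw [Real.sqrt_eq_rpow]
      have h3 := Real.rpow_add two_pos (-(1 : ℝ) / 2) 1
      rw [Real.rpow_one] at h3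
      rw [← h3]
      norm_num
    rw [← mul_assoc, h2]
    ring_nf

theorem prod_half_eq {d : ℕ} (k : Fin d → ℕ) :
    ∏ j, (if k j = 0 then 1 else (2 : ℝ) ^ (-(1 : ℝ) / 2)) = (2 : ℝ) ^ (-(nnz k : ℝ) / 2) := by
  rw [Finset.prod_ite, Finset.prod_const_one, one_mul, Finset.prod_const,
    ← Real.rpow_natCast, ← Real.rpow_mul two_pos.le, nnz]
  ring_nf

theorem cosBasis_tent {d : ℕ} (k : Fin d → ℕ) (z : Fin d → ℝ) : (cosBasis k (tent z) : ℂ) =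
    (((2 : ℝ) ^ (-(nnz k : ℝ) / 2) : ℝ) : ℂ) * ∑ h ∈ signs k, expi (rdot h z) := by
  rw [cosBasis_eq_prod, Complex.ofReal_prod]
  simp only [tent, cosFactor_tent]
  rw [Finset.prod_mul_distrib, ← Complex.ofReal_prod, prod_half_eq, Finset.prod_univ_sum, signs]
  congr 1
  refine Finset.sum_congr rfl fun h _ => ?_
  rw [expi_rdot_eq_prod]

theorem tent_mem_cube {d : ℕ} {z : Fin d → ℝ} (hz : z ∈ cube d) : tent z ∈ cube d := by
  have h : ∀ j, 0 ≤ 1 - |2 * z j - 1| ∧ 1 - |2 * z j - 1| ≤ 1 := by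
    intro j
    have h0 := hz.1 j
    have h1 := hz.2 j
    simp only [Pi.zero_apply, Pi.one_apply] at h0 h1
    have h2 : |2 * z j - 1| ≤ 1 := abs_le.mpr ⟨by linarith, by linarith⟩
    have h3 := abs_nonneg (2 * z j - 1)
    constructor <;> linarith
  exact ⟨fun j => (h j).1, fun j => (h j).2⟩

theorem summable_expCoeff_mul {d : ℕ} {f : (Fin d → ℝ) → ℝ}
    (hsum : Summable fun h => |expCoeff f h|) (z : Fin d → ℝ) :
    Summable fun h => (expCoeff f h : ℂ) * expi (rdot h z) := by
  refine Summable.of_norm (summable_norm_mul_of_bounded (B := 1) ?_ fun h => (norm_expi _).le)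
  simpa using hsum

/-- The Fourier series of `f ∘ ψ`. -/
theorem apply_tent_eq_tsum {d : ℕ} {α : ℝ} (hα : 1 / 2 < α) {γ : ℕ → ℝ} (hγ : ∀ j, 0 < γ j)
    {f : (Fin d → ℝ) → ℝ} (hf : MemCosineSpace α γ f) {z : Fin d → ℝ} (hz : z ∈ cube d) :
    (f (tent z) : ℂ) = ∑' h, (expCoeff f h : ℂ) * expi (rdot h z) := by
  have h1 := hasSum_signs (summable_expCoeff_mul (summable_abs_expCoeff hα hγ hf) z)
  have h2 : ∀ k, ∑ h ∈ signs k, (expCoeff f h : ℂ) * expi (rdot h z) =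
      ((cosCoeff f k * cosBasis k (tent z) : ℝ) : ℂ) := by
    intro k
    rw [Finset.sum_congr rfl fun h hh => by rw [expCoeff_of_mem_signs f hh], ← Finset.mul_sum,
      Complex.ofReal_mul (cosCoeff f k), cosBasis_tent]
    push_cast
    ring
  simp_rw [h2] at h1
  have h3 := Complex.hasSum_ofReal.mpr (hasSum_cosCoeff hf (tent_mem_cube hz))
  exact h3.unique h1

theorem fract_mem_cube {d : ℕ} (x : Fin d → ℝ) : (fun j => Int.fract (x j)) ∈ cube d :=
  ⟨fun j => Int.fract_nonneg (x j), fun j => (Int.fract_lt_one (x j)).le⟩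

theorem apply_tent_fract {d : ℕ} {α : ℝ} (hα : 1 / 2 < α) {γ : ℕ → ℝ} (hγ : ∀ j, 0 < γ j)
    {f : (Fin d → ℝ) → ℝ} (hf : MemCosineSpace α γ f) (x : Fin d → ℝ) :
    (f (tent fun j => Int.fract (x j)) : ℂ) = ∑' h, (expCoeff f h : ℂ) * expi (rdot h x) := by
  rw [apply_tent_eq_tsum hα hγ hf (fract_mem_cube x)]
  simp_rw [expi_rdot_fract]

open scoped Classical in
/-- The observations see the aliases of `l`. -/
theorem observation_eq {d : ℕ} {α : ℝ} (hα : 1 / 2 < α) {γ : ℕ → ℝ} (hγ : ∀ j, 0 < γ j)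
    {f : (Fin d → ℝ) → ℝ} (hf : MemCosineSpace α γ f) {N : ℕ} (hN : 0 < N) (g : Fin d → ℤ)
    (Y : List (Fin d → ℝ)) (Δ : Fin d → ℝ) (l : Fin d → ℤ) (s : Fin Y.length) :
    observation (fun z => (f (tent z) : ℂ)) N g Y Δ l s =
      ∑' h, (if idot h g ≡ idot l g [ZMOD N] then (expCoeff f h : ℂ) else 0) *
        expi (rdot h fun j => Y.get s j + Δ j) := by
  have hN0 : (N : ℂ) ≠ 0 := by exact_mod_cast hN.ne'
  have hsum := summable_expCoeff_mul (summable_abs_expCoeff hα hγ hf)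
  have hterm : ∀ n ∈ Finset.range N,
      (f (tent fun j => Int.fract ((n : ℝ) * g j / N + Y.get s j + Δ j)) : ℂ) *
        expi (-(rdot l fun j => (n : ℝ) * g j / N)) =
      ∑' h, (expCoeff f h : ℂ) * expi (rdot h fun j => Y.get s j + Δ j) *
        expi ((n : ℝ) * ((idot (h - l) g : ℝ) / N)) := by
    intro n _
    rw [apply_tent_fract hα hγ hf fun j => (n : ℝ) * g j / N + Y.get s j + Δ j, ← tsum_mul_right]
    refine tsum_congr fun h => ?_
    have h1 : rdot h (fun j => (n : ℝ) * g j / N + Y.get s j + Δ j) =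
        rdot h (fun j => (n : ℝ) * g j / N) + rdot h fun j => Y.get s j + Δ j := by
      rw [← rdot_add]
      simp only [add_assoc]
    have h2 : (n : ℝ) * ((idot (h - l) g : ℝ) / N) =
        rdot h (fun j => (n : ℝ) * g j / N) + -(rdot l fun j => (n : ℝ) * g j / N) := by
      rw [rdot_mul_div, rdot_mul_div, idot_sub_left]
      push_cast
      ring
    rw [h1, h2, expi_add, expi_add]
    ring
  have hsummable : ∀ n ∈ Finset.range N, Summable fun h =>
      (expCoeff f h : ℂ) * expi (rdot h fun j => Y.get s j + Δ j) *
        expi ((n : ℝ) * ((idot (h - l) g : ℝ) / N)) := by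
    intro n _
    refine Summable.of_norm (summable_norm_mul_of_bounded (B := 1) ?_ fun h => (norm_expi _).le)
    exact (hsum _).norm
  -- After the interchange of the sums, the sum over the lattice points is a character sum that
  -- keeps only the aliases of `l`.
  rw [observation, Finset.sum_congr rfl hterm, ← Summable.tsum_finsetSum hsummable,
    ← tsum_mul_left]
  refine tsum_congr fun h => ?_
  rw [← Finset.mul_sum, sum_expi_div hN]
  have hiff : (N : ℤ) ∣ idot (h - l) g ↔ idot h g ≡ idot l g [ZMOD N] := by
    rw [idot_sub_left, ← Int.modEq_iff_dvd]
    exact ⟨Int.ModEq.symm, Int.ModEq.symm⟩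
  by_cases hc : idot h g ≡ idot l g [ZMOD N]
  · rw [if_pos (hiff.mpr hc), if_pos hc]
    field_simp
  · rw [if_neg (hiff.not.mpr hc), if_neg hc]
    simp

/-! ### The aliasing error of the recovered coefficients -/

/-- The Fourier coefficients outside the cross in one residue class. -/
def aliasCoeff {d : ℕ} (α : ℝ) (γ : ℕ → ℝ) (M : ℝ) (N : ℕ) (g : Fin d → ℤ)
    (f : (Fin d → ℝ) → ℝ) (r : ZMod N) (h : Fin d → ℤ) : ℝ :=
  if (idot h g : ZMod N) = r ∧ M ≤ rWeight α γ h then expCoeff f h else 0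

/-- The part of the Fourier series of `f ∘ ψ` outside the cross in one residue class. -/
def aliasSum {d : ℕ} (α : ℝ) (γ : ℕ → ℝ) (M : ℝ) (N : ℕ) (g : Fin d → ℤ)
    (f : (Fin d → ℝ) → ℝ) (r : ZMod N) (x : Fin d → ℝ) : ℂ :=
  ∑' h, (aliasCoeff α γ M N g f r h : ℂ) * expi (rdot h x)

section

variable {d : ℕ} {α : ℝ} {γ : ℕ → ℝ} {M : ℝ} {N : ℕ} {g : Fin d → ℤ} {f : (Fin d → ℝ) → ℝ}

theorem abs_aliasCoeff_le (r : ZMod N) (h : Fin d → ℤ) :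
    |aliasCoeff α γ M N g f r h| ≤ |expCoeff f h| := by
  rw [aliasCoeff]
  split_ifs
  · exact le_rfl
  · rw [abs_zero]
    exact abs_nonneg _

theorem summable_abs_aliasCoeff (hsum : Summable fun h => |expCoeff f h|) (r : ZMod N) :
    Summable fun h => |aliasCoeff α γ M N g f r h| :=
  Summable.of_nonneg_of_le (fun _ => abs_nonneg _) (abs_aliasCoeff_le r) hsum

theorem summable_aliasCoeff_sq_mul
    (hsq : Summable fun h => expCoeff f h ^ 2 * rWeight α γ h ^ 2) (r : ZMod N) :
    Summable fun h => aliasCoeff α γ M N g f r h ^ 2 * rWeight α γ h ^ 2 := by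
  refine Summable.of_nonneg_of_le (fun _ => by positivity) (fun h => ?_) hsq
  gcongr 1
  exact sq_le_sq.mpr (abs_aliasCoeff_le r h)

theorem continuous_aliasSum (hsum : Summable fun h => |expCoeff f h|) (r : ZMod N) :
    Continuous (aliasSum α γ M N g f r) := by
  refine continuous_tsum (fun h => ?_) (summable_abs_aliasCoeff (M := M) (α := α) (γ := γ) (g := g)
    hsum r) fun h x => ?_
  · refine continuous_const.mul (continuous_expi.comp ?_)
    unfold rdot
    fun_prop
  · rw [norm_mul, norm_expi, mul_one, Complex.norm_real, Real.norm_eq_abs]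

theorem sum_aliasCoeff_sq_le [NeZero N] (h : Fin d → ℤ) :
    ∑ r : ZMod N, aliasCoeff α γ M N g f r h ^ 2 ≤
      if M ≤ rWeight α γ h then expCoeff f h ^ 2 else 0 := by
  rw [Finset.sum_eq_single (idot h g : ZMod N)]
  · rw [aliasCoeff]
    simp only [true_and]
    split_ifs <;> simp
  · intro r _ hr
    rw [aliasCoeff, if_neg (fun h => hr h.1.symm)]
    simp
  · simp

/-- Of the aliases of `l`, those in the cross form the fiber and carry the unknowns; all others act
as noise. -/
theorem observation_split (hα : 1 / 2 < α) (hγ : ∀ j, 0 < γ j) (hf : MemCosineSpace α γ f)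
    (hN : 0 < N) (Y : List (Fin d → ℝ)) (Δ : Fin d → ℝ) (l : Fin d → ℤ) (s : Fin Y.length) :
    observation (fun z => (f (tent z) : ℂ)) N g Y Δ l s =
      ∑ m ∈ fiber (cross d α γ M) N g l,
        (expCoeff f m : ℂ) * expi (rdot m Δ) * expi (rdot m (Y.get s)) +
      aliasSum α γ M N g f (idot l g : ZMod N) (fun j => Y.get s j + Δ j) := by
  classical
  have hα0 : 0 < α := by linarith
  have hsum := summable_abs_expCoeff hα hγ hf
  set F := fiber (cross d α γ M) N g l with hF
  have hmem : ∀ h, h ∈ F ↔ idot h g ≡ idot l g [ZMOD N] ∧ ¬ M ≤ rWeight α γ h := by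
    intro h
    rw [hF, mem_fiber, mem_cross hα0 hγ, not_le, and_comm]
  set x : Fin d → ℝ := fun j => Y.get s j + Δ j with hx
  rw [observation_eq hα hγ hf hN g Y Δ l s, ← hx]
  have h1 : ∀ h, (if idot h g ≡ idot l g [ZMOD N] then (expCoeff f h : ℂ) else 0) *
      expi (rdot h x) = (if h ∈ F then (expCoeff f h : ℂ) * expi (rdot h x) else 0) +
        (aliasCoeff α γ M N g f (idot l g : ZMod N) h : ℂ) * expi (rdot h x) := by
    intro h
    rw [aliasCoeff]
    by_cases ha : idot h g ≡ idot l g [ZMOD N] <;> by_cases hb : M ≤ rWeight α γ h <;>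
      simp [hmem, ZMod.intCast_eq_intCast_iff, ha, hb]
  simp_rw [h1]
  have hs1 : Summable fun h => if h ∈ F then (expCoeff f h : ℂ) * expi (rdot h x) else 0 :=
    summable_of_ne_finset_zero (s := F) fun h hh => if_neg hh
  have hs2 : Summable fun h => (aliasCoeff α γ M N g f (idot l g : ZMod N) h : ℂ) *
      expi (rdot h x) := by
    refine Summable.of_norm (summable_norm_mul_of_bounded (B := 1) ?_ fun h => (norm_expi _).le)
    simpa using summable_abs_aliasCoeff hsum (idot l g : ZMod N)
  rw [hs1.tsum_add hs2, aliasSum, tsum_eq_sum (s := F) fun h hh => if_neg hh]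
  congr 1
  refine Finset.sum_congr rfl fun h hh => ?_
  rw [if_pos hh, mul_assoc, ← expi_add, add_comm (rdot h Δ), ← rdot_add]

theorem sum_fiber_coeffEst_error (hα : 1 / 2 < α) (hγ : ∀ j, 0 < γ j)
    (hf : MemCosineSpace α γ f) (hN : 0 < N) {κ : ℝ} (hκ : 0 < κ) {Y : List (Fin d → ℝ)}
    (hY : 1 ≤ Y.length) (Δ : Fin d → ℝ) (l : Fin d → ℤ)
    (hst : IsStable κ Y (fiber (cross d α γ M) N g l)) :
    ∑ h ∈ fiber (cross d α γ M) N g l,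
      ‖coeffEst (cross d α γ M) (fun z => (f (tent z) : ℂ)) N g Y Δ h - expCoeff f h‖ ^ 2 ≤
      (κ * Y.length)⁻¹ *
        ∑ s, ‖aliasSum α γ M N g f (idot l g : ZMod N) (fun j => Y.get s j + Δ j)‖ ^ 2 := by
  refine le_trans (le_of_eq ?_) (lsqCoeff_error hκ hY hst
    (x := fun m => (expCoeff f m : ℂ) * expi (rdot m Δ))
    (observation_split hα hγ hf hN Y Δ l))
  refine Finset.sum_congr rfl fun h hh => ?_
  have hc := (mem_fiber.mp hh).2
  -- All frequencies of a fiber share the fiber and the observations, so a single least-squares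
  -- problem serves them all.
  have hF : fiber (cross d α γ M) N g h = fiber (cross d α γ M) N g l := by
    ext k
    rw [mem_fiber, mem_fiber]
    exact and_congr_right fun _ => ⟨fun h1 => h1.trans hc, fun h1 => h1.trans hc.symm⟩
  have hobs : observation (fun z => (f (tent z) : ℂ)) N g Y Δ h =
      observation (fun z => (f (tent z) : ℂ)) N g Y Δ l := by
    funext s
    rw [observation_split (M := M) hα hγ hf hN, observation_split (M := M) hα hγ hf hN, hF,
      (ZMod.intCast_eq_intCast_iff _ _ _).mpr hc]
  -- The factors of `D(-Δ)` have modulus one and do not change the error.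
  have h1 : (expCoeff f h : ℂ) = expi (-(rdot h Δ)) * (expCoeff f h * expi (rdot h Δ)) := by
    rw [mul_left_comm, ← expi_add, neg_add_cancel, expi_zero, mul_one]
  rw [coeffEst_eq, hF, hobs]
  nth_rw 1 [h1]
  rw [← mul_sub, norm_mul, norm_expi, one_mul]

/-- The fibers are the intersections of the cross with the residue classes. Classes that miss the
cross only enlarge the right-hand side. -/
theorem sum_coeffEst_error [NeZero N] (hα : 1 / 2 < α) (hγ : ∀ j, 0 < γ j)
    (hf : MemCosineSpace α γ f) {κ : ℝ} (hκ : 0 < κ) {Y : List (Fin d → ℝ)}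
    (hY : 1 ≤ Y.length) (Δ : Fin d → ℝ)
    (hst : ∀ l ∈ cross d α γ M, IsStable κ Y (fiber (cross d α γ M) N g l)) :
    ∑ h ∈ cross d α γ M,
      ‖coeffEst (cross d α γ M) (fun z => (f (tent z) : ℂ)) N g Y Δ h - expCoeff f h‖ ^ 2 ≤
      (κ * Y.length)⁻¹ *
        ∑ s, ∑ r, ‖aliasSum α γ M N g f r (fun j => Y.get s j + Δ j)‖ ^ 2 := by
  classical
  rw [← Finset.sum_fiberwise (cross d α γ M) fun h => (idot h g : ZMod N), Finset.sum_comm,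
    Finset.mul_sum]
  refine Finset.sum_le_sum fun r _ => ?_
  by_cases hr : ∃ l ∈ cross d α γ M, (idot l g : ZMod N) = r
  · obtain ⟨l, hl, rfl⟩ := hr
    have hF : (cross d α γ M).filter (fun h => (idot h g : ZMod N) = (idot l g : ZMod N)) =
        fiber (cross d α γ M) N g l := by
      rw [fiber]
      refine Finset.filter_congr fun h _ => ?_
      rw [ZMod.intCast_eq_intCast_iff]
    rw [hF]
    exact sum_fiber_coeffEst_error hα hγ hf (NeZero.pos N) hκ hY Δ l (hst l hl)
  · rw [Finset.filter_false_of_mem fun h hh he => hr ⟨h, hh, he⟩, Finset.sum_empty]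
    positivity

theorem tsum_tail_sq_le (hf : MemCosineSpace α γ f) (hM : 0 < M) :
    (Summable fun h => if M ≤ rWeight α γ h then expCoeff f h ^ 2 else 0) ∧
    ∑' h, (if M ≤ rWeight α γ h then expCoeff f h ^ 2 else 0) ≤
      (M ^ 2)⁻¹ * cosineNorm α γ f ^ 2 := by
  have h1 : ∀ h, (if M ≤ rWeight α γ h then expCoeff f h ^ 2 else 0) ≤
      (M ^ 2)⁻¹ * (expCoeff f h ^ 2 * rWeight α γ h ^ 2) := by
    intro h
    split_ifs with hr
    · rw [le_inv_mul_iff₀ (by positivity), mul_comm]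
      gcongr
    · positivity
  have h2 := (summable_expCoeff_sq hf).mul_left (M ^ 2)⁻¹
  have h3 : Summable fun h => if M ≤ rWeight α γ h then expCoeff f h ^ 2 else 0 :=
    Summable.of_nonneg_of_le (fun h => by split_ifs <;> positivity) h1 h2
  refine ⟨h3, (h3.tsum_le_tsum h1 h2).trans ?_⟩
  rw [tsum_mul_left, tsum_expCoeff_sq hf]

/-- The mean square of the aliasing error over the global shift. -/
theorem lintegral_sum_aliasSum_le [NeZero N] (hα : 1 / 2 < α) (hγ : ∀ j, 0 < γ j)
    (hf : MemCosineSpace α γ f) (hM : 0 < M) (y : Fin d → ℝ) :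
    ∫⁻ Δ in cube d, ∑ r : ZMod N, ‖aliasSum α γ M N g f r (fun j => y j + Δ j)‖ₑ ^ 2 ≤
      ENNReal.ofReal ((M ^ 2)⁻¹ * cosineNorm α γ f ^ 2) := by
  classical
  have hsum := summable_abs_expCoeff hα hγ hf
  have hsq : ∀ r : ZMod N, Summable fun h => aliasCoeff α γ M N g f r h ^ 2 := by
    intro r
    refine Summable.of_nonneg_of_le (fun _ => by positivity) (fun h => ?_)
      (summable_aliasCoeff_sq_mul (M := M) (g := g) (summable_expCoeff_sq hf) r)
    exact le_mul_of_one_le_right (by positivity) (one_le_pow₀ (one_le_rWeight α γ h))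
  rw [lintegral_finsetSum _ fun r _ => by
    have := (continuous_aliasSum (M := M) (α := α) (γ := γ) (g := g) hsum r).comp
      (by fun_prop : Continuous fun Δ : Fin d → ℝ => fun j => y j + Δ j)
    exact (this.measurable.enorm).pow_const 2]
  -- Translation by `y` merely rotates the coefficients, so Parseval's identity in `Δ` gives the
  -- same value for every shift.
  have h1 : ∀ r : ZMod N,
      ∫⁻ Δ in cube d, ‖aliasSum α γ M N g f r (fun j => y j + Δ j)‖ₑ ^ 2 =
        ENNReal.ofReal (∑' h, aliasCoeff α γ M N g f r h ^ 2) := by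
    intro r
    have hn : ∀ h, ‖(aliasCoeff α γ M N g f r h : ℂ) * expi (rdot h y)‖ =
        |aliasCoeff α γ M N g f r h| := by
      intro h
      rw [norm_mul, norm_expi, mul_one, Complex.norm_real, Real.norm_eq_abs]
    have h2 := lintegral_enorm_sq_tsum (μ := volume.restrict (cube d))
      (ψ := fun (h : Fin d → ℤ) x => expi (rdot h x)) (B := 1)
      (a := fun h => (aliasCoeff α γ M N g f r h : ℂ) * expi (rdot h y))
      (fun h => (continuous_expi.comp (by unfold rdot; fun_prop)).measurable)
      (fun h x => (norm_expi _).le) (fun h l => integral_expi_orth h l)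
      (by simp_rw [hn]; exact summable_abs_aliasCoeff hsum r)
      (by simp_rw [hn, sq_abs]; exact hsq r)
    simp_rw [hn, sq_abs] at h2
    rw [← h2]
    refine lintegral_congr fun Δ => ?_
    rw [aliasSum]
    congr 3
    funext h
    rw [mul_assoc, ← expi_add, ← rdot_add]
  simp_rw [h1]
  rw [← ENNReal.ofReal_sum_of_nonneg fun r _ => tsum_nonneg fun h => by positivity]
  refine ENNReal.ofReal_le_ofReal ?_
  -- Each frequency lies in one residue class, so the tail is counted once.
  rw [← Summable.tsum_finsetSum fun r _ => hsq r]
  refine le_trans ?_ (tsum_tail_sq_le hf hM).2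
  exact (summable_sum fun r _ => hsq r).tsum_le_tsum sum_aliasCoeff_sq_le (tsum_tail_sq_le hf hM).1

theorem tsum_abs_sq_le {ι : Type*} {a r : ι → ℝ} (hr : ∀ i, 0 < r i)
    (h1 : Summable fun i => a i ^ 2 * r i ^ 2) {s : Set ι}
    (hs : ∀ i, i ∉ s → a i = 0) (h2 : Summable (s.indicator fun i => r i ^ (-2 : ℝ))) :
    Summable (fun i => |a i|) ∧
    (∑' i, |a i|) ^ 2 ≤ (∑' i, a i ^ 2 * r i ^ 2) *
      ∑' i, s.indicator (fun i => r i ^ (-2 : ℝ)) i := by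
  have hb : ∀ i, 0 ≤ s.indicator (fun i => r i ^ (-2 : ℝ)) i := fun i =>
    Set.indicator_nonneg (fun i _ => Real.rpow_nonneg (hr i).le _) i
  have hkey : ∀ i, |a i| = (|a i| * r i) * √(s.indicator (fun i => r i ^ (-2 : ℝ)) i) := by
    intro i
    by_cases hi : i ∈ s
    · rw [Set.indicator_of_mem hi, Real.rpow_neg (hr i).le, Real.rpow_two, Real.sqrt_inv,
        Real.sqrt_sq (hr i).le, mul_assoc, mul_inv_cancel₀ (hr i).ne', mul_one]
    · simp [hs i hi]
  have hfin : ∀ t : Finset ι, (∑ i ∈ t, |a i|) ^ 2 ≤ (∑' i, a i ^ 2 * r i ^ 2) *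
      ∑' i, s.indicator (fun i => r i ^ (-2 : ℝ)) i := by
    intro t
    rw [Finset.sum_congr rfl fun i _ => hkey i]
    refine (Finset.sum_mul_sq_le_sq_mul_sq t _ _).trans ?_
    have e1 : ∀ i, (|a i| * r i) ^ 2 = a i ^ 2 * r i ^ 2 := fun i => by rw [mul_pow, sq_abs]
    simp_rw [e1, Real.sq_sqrt (hb _)]
    exact mul_le_mul (h1.sum_le_tsum t fun i _ => by positivity)
      (h2.sum_le_tsum t fun i _ => hb i) (Finset.sum_nonneg fun i _ => hb i)
      (tsum_nonneg fun i => by positivity)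
  have hfin' : ∀ t : Finset ι, ∑ i ∈ t, |a i| ≤ √((∑' i, a i ^ 2 * r i ^ 2) *
      ∑' i, s.indicator (fun i => r i ^ (-2 : ℝ)) i) := fun t =>
    Real.le_sqrt_of_sq_le (hfin t)
  refine ⟨summable_of_sum_le (fun _ => abs_nonneg _) hfin', ?_⟩
  have h3 := Real.tsum_le_of_sum_le (fun i => abs_nonneg (a i)) hfin'
  calc _ ≤ (√((∑' i, a i ^ 2 * r i ^ 2) *
      ∑' i, s.indicator (fun i => r i ^ (-2 : ℝ)) i)) ^ 2 :=
        pow_le_pow_left₀ (tsum_nonneg fun _ => abs_nonneg _) h3 2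
    _ = _ := Real.sq_sqrt (mul_nonneg (tsum_nonneg fun i => by positivity) (tsum_nonneg hb))

/-- The aliasing error is bounded uniformly in the evaluation point. -/
theorem sum_aliasSum_sq_le [NeZero N] (hf : MemCosineSpace α γ f) {W : ℝ}
    (hW : ∀ r : ZMod N, ∑' h, Set.indicator {h | (idot h g : ZMod N) = r ∧ M ≤ rWeight α γ h}
      (wgt α γ 2) h ≤ ENNReal.ofReal W) (hW0 : 0 ≤ W) (x : Fin d → ℝ) :
    ∑ r : ZMod N, ‖aliasSum α γ M N g f r x‖ ^ 2 ≤ W * cosineNorm α γ f ^ 2 := by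
  have hsq := fun r : ZMod N =>
    summable_aliasCoeff_sq_mul (M := M) (g := g) (summable_expCoeff_sq hf) r
  -- Cauchy-Schwarz inside each class. The classes then share the norm of `f` among themselves, so
  -- `W` is not multiplied by their number `N`.
  have h1 : ∀ r : ZMod N, ‖aliasSum α γ M N g f r x‖ ^ 2 ≤
      W * ∑' h, aliasCoeff α γ M N g f r h ^ 2 * rWeight α γ h ^ 2 := by
    intro r
    set P : Set (Fin d → ℤ) := {h | (idot h g : ZMod N) = r ∧ M ≤ rWeight α γ h} with hP
    have hind : ∀ h, P.indicator (fun h => rWeight α γ h ^ (-2 : ℝ)) h =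
        (P.indicator (wgt α γ 2) h).toReal := by
      intro h
      by_cases hh : h ∈ P
      · rw [Set.indicator_of_mem hh, Set.indicator_of_mem hh, wgt_toReal]
      · rw [Set.indicator_of_notMem hh, Set.indicator_of_notMem hh, ENNReal.toReal_zero]
    have htop : ∑' h, P.indicator (wgt α γ 2) h ≠ ⊤ :=
      ((hW r).trans_lt ENNReal.ofReal_lt_top).ne
    have hs2 : Summable (P.indicator fun h => rWeight α γ h ^ (-2 : ℝ)) := by
      refine (ENNReal.summable_toReal htop).congr fun h => (hind h).symm
    have hle : ∑' h, P.indicator (fun h => rWeight α γ h ^ (-2 : ℝ)) h ≤ W := by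
      simp_rw [hind]
      rw [← ENNReal.tsum_toReal_eq fun h => ENNReal.ne_top_of_tsum_ne_top htop h]
      exact ENNReal.toReal_le_of_le_ofReal hW0 (hW r)
    obtain ⟨hs, hb⟩ := tsum_abs_sq_le (a := aliasCoeff α γ M N g f r)
      (fun h => rWeight_pos α γ h) (hsq r) (s := P)
      (fun h hh => if_neg hh) hs2
    have hn : ∀ h, ‖(aliasCoeff α γ M N g f r h : ℂ) * expi (rdot h x)‖ =
        |aliasCoeff α γ M N g f r h| := by
      intro h
      rw [norm_mul, norm_expi, mul_one, Complex.norm_real, Real.norm_eq_abs]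
    have h2 : ‖aliasSum α γ M N g f r x‖ ≤ ∑' h, |aliasCoeff α γ M N g f r h| := by
      rw [aliasSum]
      refine (norm_tsum_le_tsum_norm (by simp_rw [hn]; exact hs)).trans (le_of_eq ?_)
      simp_rw [hn]
    calc _ ≤ (∑' h, |aliasCoeff α γ M N g f r h|) ^ 2 :=
          pow_le_pow_left₀ (norm_nonneg _) h2 2
      _ ≤ _ := hb
      _ ≤ (∑' h, aliasCoeff α γ M N g f r h ^ 2 * rWeight α γ h ^ 2) * W :=
          mul_le_mul_of_nonneg_left hle (tsum_nonneg fun h => by positivity)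
      _ = _ := mul_comm _ _
  refine (Finset.sum_le_sum fun r _ => h1 r).trans ?_
  rw [← Finset.mul_sum, ← Summable.tsum_finsetSum fun r _ => hsq r, ← tsum_expCoeff_sq hf]
  refine mul_le_mul_of_nonneg_left ?_ hW0
  refine (summable_sum fun r _ => hsq r).tsum_le_tsum (fun h => ?_) (summable_expCoeff_sq hf)
  rw [← Finset.sum_mul]
  gcongr
  refine (sum_aliasCoeff_sq_le h).trans ?_
  split_ifs
  · exact le_rfl
  · positivity

end

/-! ### The error of the recovered cosine coefficients -/

section

variable {d : ℕ} {α : ℝ} {γ : ℕ → ℝ} {M : ℝ} {N : ℕ} {g : Fin d → ℤ} {f : (Fin d → ℝ) → ℝ}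

/-- The error of the recovered Fourier coefficient at `h`. -/
def fourierErr (α : ℝ) (γ : ℕ → ℝ) (M : ℝ) (N : ℕ) (g : Fin d → ℤ) (f : (Fin d → ℝ) → ℝ)
    (Y : List (Fin d → ℝ)) (Δ : Fin d → ℝ) (h : Fin d → ℤ) : ℂ :=
  coeffEst (cross d α γ M) (fun z => (f (tent z) : ℂ)) N g Y Δ h - expCoeff f h

theorem coeffEst_of_notMem {A : Finset (Fin d → ℤ)} (G : (Fin d → ℝ) → ℂ)
    (Y : List (Fin d → ℝ)) (Δ : Fin d → ℝ) {h : Fin d → ℤ} (hh : h ∉ A) :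
    coeffEst A G N g Y Δ h = 0 := by
  rw [coeffEst_eq, lsqCoeff, dif_neg fun h1 => hh (mem_fiber.mp h1).1, mul_zero]

theorem fourierErr_of_notMem (Y : List (Fin d → ℝ)) (Δ : Fin d → ℝ) {h : Fin d → ℤ}
    (hh : h ∉ cross d α γ M) : fourierErr α γ M N g f Y Δ h = -(expCoeff f h : ℂ) := by
  rw [fourierErr, coeffEst_of_notMem _ _ _ hh, zero_sub]

/-- Off the cross the recovered coefficient is `0` and the error is the coefficient itself. The
power `p` covers both `ℓ¹` and `ℓ²`. -/
theorem hasSum_fourierErr (hα : 1 / 2 < α) (hγ : ∀ j, 0 < γ j) (Y : List (Fin d → ℝ))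
    (Δ : Fin d → ℝ) {p : ℕ}
    (hs : Summable fun h => if M ≤ rWeight α γ h then |expCoeff f h| ^ p else 0) :
    HasSum (fun h => ‖fourierErr α γ M N g f Y Δ h‖ ^ p)
      (∑ h ∈ cross d α γ M, ‖fourierErr α γ M N g f Y Δ h‖ ^ p +
        ∑' h, if M ≤ rWeight α γ h then |expCoeff f h| ^ p else 0) := by
  classical
  have hα0 : 0 < α := by linarith
  have h1 : HasSum (fun h => if h ∈ cross d α γ M then ‖fourierErr α γ M N g f Y Δ h‖ ^ p else 0)
      (∑ h ∈ cross d α γ M, ‖fourierErr α γ M N g f Y Δ h‖ ^ p) := by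
    rw [← Finset.sum_congr rfl fun h hh => if_pos hh]
    exact hasSum_sum_of_ne_finset_zero fun h hh => if_neg hh
  convert h1.add hs.hasSum using 2 with h
  by_cases hh : M ≤ rWeight α γ h
  · have hn : h ∉ cross d α γ M := by rwa [mem_cross hα0 hγ, not_lt]
    rw [if_neg hn, if_pos hh, fourierErr_of_notMem Y Δ hn, norm_neg, Complex.norm_real,
      Real.norm_eq_abs, zero_add]
  · have hn : h ∈ cross d α γ M := by rwa [mem_cross hα0 hγ, ← not_le]
    rw [if_pos hn, if_neg hh, add_zero]

theorem summable_tail_abs (hα : 1 / 2 < α) (hγ : ∀ j, 0 < γ j) (hf : MemCosineSpace α γ f)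
    (M : ℝ) : Summable fun h => if M ≤ rWeight α γ h then |expCoeff f h| ^ 1 else 0 := by
  refine Summable.of_nonneg_of_le (fun h => by positivity) (fun h => ?_)
    (summable_abs_expCoeff hα hγ hf)
  split_ifs
  · rw [pow_one]
  · exact abs_nonneg _

theorem summable_tail_sq (hf : MemCosineSpace α γ f) (hM : 0 < M) :
    Summable fun h => if M ≤ rWeight α γ h then |expCoeff f h| ^ 2 else 0 := by
  simp_rw [sq_abs]
  exact (tsum_tail_sq_le hf hM).1

/-- Weighted Cauchy-Schwarz, with `r⁻² ≤ r^(-q) M^(q-2)` outside the cross. -/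
theorem tsum_tail_abs_le (hα : 1 / 2 < α) (hγ : ∀ j, 0 < γ j) (hf : MemCosineSpace α γ f)
    (hM : 0 < M) {q : ℝ} (hq : 1 < α * q) (hq2 : q ≤ 2) :
    ∑' h, (if M ≤ rWeight α γ h then |expCoeff f h| ^ 1 else 0) ≤
      √((∑' h : Fin d → ℤ, rWeight α γ h ^ (-q)) * M ^ (q - 2)) * cosineNorm α γ f := by
  have hq0 : 0 < q := by
    by_contra h
    nlinarith
  set a : (Fin d → ℤ) → ℝ := fun h => if M ≤ rWeight α γ h then expCoeff f h else 0 with ha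
  have hT : Summable fun h : Fin d → ℤ => rWeight α γ h ^ (-q) := by
    have := ENNReal.summable_toReal (tsum_wgt_ne_top (d := d) hγ hq0 hq)
    simp_rw [wgt_toReal] at this
    exact this
  have ha2 : ∀ h, a h ^ 2 * rWeight α γ h ^ 2 ≤ expCoeff f h ^ 2 * rWeight α γ h ^ 2 := by
    intro h
    simp only [ha]
    split_ifs
    · exact le_rfl
    · rw [zero_pow two_ne_zero, zero_mul]
      positivity
  have hs1 : Summable fun h => a h ^ 2 * rWeight α γ h ^ 2 :=
    Summable.of_nonneg_of_le (fun h => by positivity) ha2 (summable_expCoeff_sq hf)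
  have hle : ∀ h : Fin d → ℤ, Set.indicator {h | M ≤ rWeight α γ h} (fun h => rWeight α γ h ^ (-2 : ℝ)) h ≤
      rWeight α γ h ^ (-q) * M ^ (q - 2) := by
    intro h
    have hr := rWeight_pos α γ h
    by_cases hh : M ≤ rWeight α γ h
    · rw [Set.indicator_of_mem (by exact hh), show (-2 : ℝ) = -q + (q - 2) by ring,
        Real.rpow_add hr]
      exact mul_le_mul_of_nonneg_left (Real.rpow_le_rpow_of_nonpos hM hh (by linarith))
        (Real.rpow_nonneg hr.le _)
    · rw [Set.indicator_of_notMem (by exact hh)]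
      positivity
  have hs2 : Summable (Set.indicator {h : Fin d → ℤ | M ≤ rWeight α γ h}
      fun h => rWeight α γ h ^ (-2 : ℝ)) :=
    Summable.of_nonneg_of_le
      (fun h => Set.indicator_nonneg (fun h _ => Real.rpow_nonneg (rWeight_pos α γ h).le _) h)
      hle (hT.mul_right _)
  have h1 := (tsum_abs_sq_le (fun h => rWeight_pos α γ h) hs1 (fun h hh => if_neg hh) hs2).2
  have h2 : ∑' h, a h ^ 2 * rWeight α γ h ^ 2 ≤ cosineNorm α γ f ^ 2 := by
    rw [← tsum_expCoeff_sq hf]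
    exact hs1.tsum_le_tsum ha2 (summable_expCoeff_sq hf)
  have h3 := hs2.tsum_le_tsum hle (hT.mul_right _)
  rw [tsum_mul_right] at h3
  have h4 : ∀ h, (if M ≤ rWeight α γ h then |expCoeff f h| ^ 1 else 0) = |a h| := by
    intro h
    simp only [ha]
    split_ifs <;> simp
  simp_rw [h4]
  have hn : 0 ≤ cosineNorm α γ f := Real.sqrt_nonneg _
  refine (Real.le_sqrt_of_sq_le (h1.trans (mul_le_mul h2 h3 (tsum_nonneg fun h =>
    Set.indicator_nonneg (fun h _ => Real.rpow_nonneg (rWeight_pos α γ h).le _) h)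
    (sq_nonneg _)))).trans (le_of_eq ?_)
  rw [Real.sqrt_mul (sq_nonneg _), Real.sqrt_sq hn, mul_comm]

theorem tsum_fourierErr_sq_le [NeZero N] (hα : 1 / 2 < α) (hγ : ∀ j, 0 < γ j)
    (hf : MemCosineSpace α γ f) (hM : 0 < M) {κ : ℝ} (hκ : 0 < κ) {Y : List (Fin d → ℝ)}
    (hY : 1 ≤ Y.length) (Δ : Fin d → ℝ)
    (hst : ∀ l ∈ cross d α γ M, IsStable κ Y (fiber (cross d α γ M) N g l)) :
    ∑' h, ‖fourierErr α γ M N g f Y Δ h‖ ^ 2 ≤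
      (κ * Y.length)⁻¹ * ∑ s, ∑ r, ‖aliasSum α γ M N g f r (fun j => Y.get s j + Δ j)‖ ^ 2 +
        (M ^ 2)⁻¹ * cosineNorm α γ f ^ 2 := by
  rw [(hasSum_fourierErr hα hγ Y Δ (summable_tail_sq hf hM)).tsum_eq]
  refine add_le_add (sum_coeffEst_error hα hγ hf hκ hY Δ hst) ?_
  simp_rw [sq_abs]
  exact (tsum_tail_sq_le hf hM).2

theorem lintegral_tsum_fourierErr_le [NeZero N] (hα : 1 / 2 < α) (hγ : ∀ j, 0 < γ j)
    (hf : MemCosineSpace α γ f) (hM : 0 < M) {κ : ℝ} (hκ : 0 < κ) {Y : List (Fin d → ℝ)}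
    (hY : 1 ≤ Y.length)
    (hst : ∀ l ∈ cross d α γ M, IsStable κ Y (fiber (cross d α γ M) N g l)) :
    ∫⁻ Δ in cube d, ENNReal.ofReal (∑' h, ‖fourierErr α γ M N g f Y Δ h‖ ^ 2) ≤
      ENNReal.ofReal ((κ⁻¹ + 1) * ((M ^ 2)⁻¹ * cosineNorm α γ f ^ 2)) := by
  set E : ℝ := (M ^ 2)⁻¹ * cosineNorm α γ f ^ 2 with hE
  have hE0 : 0 ≤ E := by positivity
  have hYpos : (0 : ℝ) < Y.length := by exact_mod_cast hY
  have hmeas : ∀ s : Fin Y.length, Measurable fun Δ : Fin d → ℝ =>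
      ∑ r : ZMod N, ‖aliasSum α γ M N g f r (fun j => Y.get s j + Δ j)‖ₑ ^ 2 := by
    intro s
    refine Finset.measurable_fun_sum _ fun r _ => ?_
    have := (continuous_aliasSum (M := M) (α := α) (γ := γ) (g := g)
      (summable_abs_expCoeff hα hγ hf) r).comp
      (by fun_prop : Continuous fun Δ : Fin d → ℝ => fun j => Y.get s j + Δ j)
    exact (this.measurable.enorm).pow_const 2
  calc _ ≤ ∫⁻ Δ in cube d, (ENNReal.ofReal (κ * Y.length)⁻¹ * ∑ s, ∑ r : ZMod N,
          ‖aliasSum α γ M N g f r (fun j => Y.get s j + Δ j)‖ₑ ^ 2 + ENNReal.ofReal E) := by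
        refine lintegral_mono fun Δ => ?_
        refine (ENNReal.ofReal_le_ofReal
          (tsum_fourierErr_sq_le hα hγ hf hM hκ hY Δ hst)).trans (le_of_eq ?_)
        rw [ENNReal.ofReal_add (by positivity) hE0, ENNReal.ofReal_mul (by positivity),
          ENNReal.ofReal_sum_of_nonneg fun s _ => by positivity]
        congr 2
        refine Finset.sum_congr rfl fun s _ => ?_
        rw [ENNReal.ofReal_sum_of_nonneg fun r _ => by positivity]
        refine Finset.sum_congr rfl fun r _ => ?_
        rw [ENNReal.ofReal_pow (norm_nonneg _), ofReal_norm]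
    _ = ENNReal.ofReal (κ * Y.length)⁻¹ * ∑ s, (∫⁻ Δ in cube d, ∑ r : ZMod N,
          ‖aliasSum α γ M N g f r (fun j => Y.get s j + Δ j)‖ₑ ^ 2) + ENNReal.ofReal E := by
        rw [lintegral_add_right _ measurable_const, lintegral_const,
          lintegral_const_mul _ (Finset.measurable_fun_sum _ fun s _ => hmeas s),
          lintegral_finsetSum _ fun s _ => hmeas s, Measure.restrict_apply_univ, volume_cube,
          mul_one]
    _ ≤ ENNReal.ofReal (κ * Y.length)⁻¹ * ∑ _s : Fin Y.length, ENNReal.ofReal E +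
          ENNReal.ofReal E := by
        gcongr with s
        exact lintegral_sum_aliasSum_le hα hγ hf hM (Y.get s)
    _ = _ := by
        rw [Finset.sum_const, Finset.card_univ, Fintype.card_fin, nsmul_eq_mul,
          ← ENNReal.ofReal_natCast, ← ENNReal.ofReal_mul (by positivity),
          ← ENNReal.ofReal_mul (by positivity), ← ENNReal.ofReal_add (by positivity) hE0]
        congr 1
        field_simp

/-- The `ℓ²` bound on the cross is turned into an `ℓ¹` bound at the cost of the root of its
cardinality; the second root is the truncation error. -/
theorem tsum_fourierErr_le [NeZero N] (hα : 1 / 2 < α) (hγ : ∀ j, 0 < γ j)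
    (hf : MemCosineSpace α γ f) (hM : 0 < M) {κ : ℝ} (hκ : 0 < κ) {Y : List (Fin d → ℝ)}
    (hY : 1 ≤ Y.length) (Δ : Fin d → ℝ)
    (hst : ∀ l ∈ cross d α γ M, IsStable κ Y (fiber (cross d α γ M) N g l))
    {W : ℝ} (hW0 : 0 ≤ W)
    (hW : ∀ r : ZMod N, ∑' h, Set.indicator {h | (idot h g : ZMod N) = r ∧ M ≤ rWeight α γ h}
      (wgt α γ 2) h ≤ ENNReal.ofReal W) {q : ℝ} (hq : 1 < α * q) (hq2 : q ≤ 2) :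
    Summable (fun h => ‖fourierErr α γ M N g f Y Δ h‖) ∧
    ∑' h, ‖fourierErr α γ M N g f Y Δ h‖ ≤
      (√((cross d α γ M).card * (κ⁻¹ * W)) +
        √((∑' h : Fin d → ℤ, rWeight α γ h ^ (-q)) * M ^ (q - 2))) * cosineNorm α γ f := by
  have hYpos : (0 : ℝ) < Y.length := by exact_mod_cast hY
  have hn : 0 ≤ cosineNorm α γ f := Real.sqrt_nonneg _
  have h0 := hasSum_fourierErr (N := N) (g := g) hα hγ Y Δ
    (summable_tail_abs hα hγ hf M)
  simp_rw [pow_one ‖fourierErr _ _ _ _ _ _ _ _ _‖] at h0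
  refine ⟨h0.summable, ?_⟩
  rw [h0.tsum_eq, add_mul]
  refine add_le_add ?_ (tsum_tail_abs_le hα hγ hf hM hq hq2)
  have h1 : ∑ h ∈ cross d α γ M, ‖fourierErr α γ M N g f Y Δ h‖ ^ 2 ≤
      κ⁻¹ * W * cosineNorm α γ f ^ 2 := by
    refine (sum_coeffEst_error hα hγ hf hκ hY Δ hst).trans ?_
    calc _ ≤ (κ * Y.length)⁻¹ * ∑ _s : Fin Y.length, W * cosineNorm α γ f ^ 2 := by
          gcongr with s
          exact sum_aliasSum_sq_le hf hW hW0 _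
      _ = _ := by
          rw [Finset.sum_const, Finset.card_univ, Fintype.card_fin, nsmul_eq_mul]
          field_simp
  have h2 : (∑ h ∈ cross d α γ M, ‖fourierErr α γ M N g f Y Δ h‖) ^ 2 ≤
      (cross d α γ M).card * (κ⁻¹ * W) * cosineNorm α γ f ^ 2 := by
    refine sq_sum_le_card_mul_sum_sq.trans ?_
    rw [mul_assoc]
    gcongr
  refine (Real.le_sqrt_of_sq_le h2).trans (le_of_eq ?_)
  rw [Real.sqrt_mul (by positivity), Real.sqrt_sq hn]

/-- The error of the recovered cosine coefficients. -/
def cosErr (α : ℝ) (γ : ℕ → ℝ) (t : ℝ) (N : ℕ) (g : Fin d → ℤ) (f : (Fin d → ℝ) → ℝ)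
    (Δ : Fin d → ℝ) (k : Fin d → ℕ) : ℂ :=
  cosCoeffEst α γ t N g f Δ k - cosCoeff f k

variable {t : ℝ}

theorem cosErr_eq (Δ : Fin d → ℝ) (k : Fin d → ℕ) : cosErr α γ t N g f Δ k =
    (((2 : ℝ) ^ (-(nnz k : ℝ) / 2) : ℝ) : ℂ) *
      ∑ h ∈ signs k, fourierErr α γ (truncM d α γ N) N g f (shifts α γ t N g) Δ h := by
  simp only [fourierErr]
  rw [cosErr, cosCoeffEst, cosCoeff_eq_sum, Finset.sum_sub_distrib, mul_sub]
  push_cast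
  rfl

/-- Cauchy-Schwarz over the sign patterns costs `2^|k|₀`, which the squared prefactor cancels. -/
theorem norm_cosErr_sq_le (Δ : Fin d → ℝ) (k : Fin d → ℕ) : ‖cosErr α γ t N g f Δ k‖ ^ 2 ≤
    ∑ h ∈ signs k, ‖fourierErr α γ (truncM d α γ N) N g f (shifts α γ t N g) Δ h‖ ^ 2 := by
  rw [cosErr_eq, norm_mul, mul_pow, Complex.norm_real, Real.norm_of_nonneg (by positivity)]
  calc _ ≤ ((2 : ℝ) ^ (-(nnz k : ℝ) / 2)) ^ 2 * (((signs k).card : ℝ) * ∑ h ∈ signs k,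
          ‖fourierErr α γ (truncM d α γ N) N g f (shifts α γ t N g) Δ h‖ ^ 2) := by
        gcongr
        exact (pow_le_pow_left₀ (norm_nonneg _) (norm_sum_le _ _) 2).trans
          sq_sum_le_card_mul_sum_sq
    _ = _ := by
        rw [card_signs, ← mul_assoc]
        push_cast
        rw [two_rpow_half_sq, one_mul]

theorem norm_cosErr_le (Δ : Fin d → ℝ) (k : Fin d → ℕ) : ‖cosErr α γ t N g f Δ k‖ ≤
    ∑ h ∈ signs k, ‖fourierErr α γ (truncM d α γ N) N g f (shifts α γ t N g) Δ h‖ := by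
  have h1 : (2 : ℝ) ^ (-(nnz k : ℝ) / 2) ≤ 1 :=
    Real.rpow_le_one_of_one_le_of_nonpos one_le_two (by
      have : (0 : ℝ) ≤ nnz k := by positivity
      linarith)
  rw [cosErr_eq, norm_mul, Complex.norm_real, Real.norm_of_nonneg (by positivity)]
  exact (mul_le_of_le_one_left (norm_nonneg _) h1).trans (norm_sum_le _ _)

theorem cosCoeffEst_of_notMem (hα : 1 / 2 < α) (hγ : ∀ j, 0 < γ j) (Δ : Fin d → ℝ) {k : Fin d → ℕ}
    (hk : k ∉ crossPlus d α γ (truncM d α γ N)) :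
    cosCoeffEst α γ t N g f Δ k = 0 := by
  have hα0 : 0 < α := by linarith
  rw [cosCoeffEst, Finset.sum_eq_zero, mul_zero]
  intro h hh
  refine coeffEst_of_notMem _ _ _ fun h1 => hk ?_
  rw [mem_crossPlus hα0 hγ, ← rWeight_of_mem_signs α γ hh]
  exact (mem_cross hα0 hγ).mp h1

end

/-! ### Completeness of the cosine system -/

instance compactSpace_cube (d : ℕ) : CompactSpace (cube d) :=
  isCompact_iff_compactSpace.mp isCompact_Icc

theorem measurableSet_cube (d : ℕ) : MeasurableSet (cube d) := measurableSet_Icc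

/-- The unnormalized cosine products as continuous functions on the cube. -/
def cosProd {d : ℕ} (k : Fin d → ℤ) : C(cube d, ℝ) :=
  ⟨fun x => ∏ j, Real.cos (Real.pi * k j * x.1 j), by
    refine continuous_finsetProd _ fun j _ => Real.continuous_cos.comp ?_
    exact continuous_const.mul ((continuous_apply j).comp continuous_subtype_val)⟩

theorem cosProd_apply {d : ℕ} (k : Fin d → ℤ) (x : cube d) :
    cosProd k x = ∏ j, Real.cos (Real.pi * k j * x.1 j) := rfl

theorem sqrt_two_pow_mul_cosProd {d : ℕ} (k : Fin d → ℤ) (x : cube d) :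
    √2 ^ nnz (absIdx k) * cosProd k x = cosBasis (absIdx k) x.1 := by
  rw [cosBasis, cosProd_apply]
  congr 1
  refine Finset.prod_congr rfl fun j _ => ?_
  rw [absIdx, Nat.cast_natAbs, Int.cast_abs]
  rcases abs_choice (k j : ℝ) with h | h
  · rw [h]
  · rw [h, mul_neg, neg_mul, Real.cos_neg]

/-- The product-to-sum formula in one coordinate. Integer rather than natural indices keep `k - e_i`
meaningful. -/
theorem cosProd_single_mul {d : ℕ} (i : Fin d) (k : Fin d → ℤ) :
    cosProd (Pi.single i 1) * cosProd k =
      (1 / 2 : ℝ) • (cosProd (k + Pi.single i 1) + cosProd (k - Pi.single i 1)) := by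
  ext x
  have h1 : ∀ l : Fin d → ℤ, cosProd l x = Real.cos (Real.pi * l i * x.1 i) *
      ∏ j ∈ Finset.univ.erase i, Real.cos (Real.pi * l j * x.1 j) := fun l => by
    rw [cosProd_apply]
    exact (Finset.mul_prod_erase _ (fun j => Real.cos (Real.pi * l j * x.1 j))
      (Finset.mem_univ i)).symm
  have h2 : cosProd (Pi.single i 1) x = Real.cos (Real.pi * x.1 i) := by
    rw [h1, Finset.prod_eq_one fun j hj => by simp [Finset.ne_of_mem_erase hj]]
    simp
  have h3 : ∀ l : Fin d → ℤ, (∀ j, j ≠ i → l j = k j) →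
      ∏ j ∈ Finset.univ.erase i, Real.cos (Real.pi * l j * x.1 j) =
        ∏ j ∈ Finset.univ.erase i, Real.cos (Real.pi * k j * x.1 j) := fun l hl =>
    Finset.prod_congr rfl fun j hj => by rw [hl j (Finset.ne_of_mem_erase hj)]
  simp only [ContinuousMap.mul_apply, ContinuousMap.smul_apply, ContinuousMap.add_apply,
    smul_eq_mul]
  rw [h2, h1 k, h1 (k + _), h1 (k - _), h3 (k + _) fun j hj => by simp [hj],
    h3 (k - _) fun j hj => by simp [hj]]
  have h4 := Real.two_mul_cos_mul_cos (Real.pi * k i * x.1 i) (Real.pi * x.1 i)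
  simp only [Pi.add_apply, Pi.sub_apply, Pi.single_eq_same]
  push_cast
  rw [show Real.pi * ((k i : ℝ) + 1) * x.1 i = Real.pi * k i * x.1 i + Real.pi * x.1 i by ring,
    show Real.pi * ((k i : ℝ) - 1) * x.1 i = Real.pi * k i * x.1 i - Real.pi * x.1 i by ring]
  linear_combination (1 / 2) *
    (∏ j ∈ Finset.univ.erase i, Real.cos (Real.pi * k j * x.1 j)) * h4

theorem separatesPoints_cosProd (d : ℕ) :
    (Algebra.adjoin ℝ (Set.range fun i : Fin d => cosProd (Pi.single i 1))).SeparatesPoints := by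
  intro x y hxy
  obtain ⟨i, hi⟩ : ∃ i, x.1 i ≠ y.1 i := by
    by_contra h
    push Not at h
    exact hxy (Subtype.ext (funext h))
  refine ⟨cosProd (Pi.single i 1), ⟨cosProd (Pi.single i 1),
    Algebra.subset_adjoin ⟨i, rfl⟩, rfl⟩, ?_⟩
  have h2 : ∀ x : cube d, cosProd (Pi.single i 1) x = Real.cos (Real.pi * x.1 i) := by
    intro x
    rw [cosProd_apply, ← Finset.mul_prod_erase _ _ (Finset.mem_univ i),
      Finset.prod_eq_one fun j hj => by simp [Finset.ne_of_mem_erase hj]]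
    simp
  have hmem : ∀ x : cube d, Real.pi * x.1 i ∈ Set.Icc 0 Real.pi := by
    intro x
    have h0 : 0 ≤ x.1 i := x.2.1 i
    have h1 : x.1 i ≤ 1 := x.2.2 i
    exact ⟨by positivity, mul_le_of_le_one_right Real.pi_pos.le h1⟩
  rw [h2, h2]
  intro h
  exact hi (mul_left_cancel₀ Real.pi_ne_zero (Real.injOn_cos (hmem x) (hmem y) h))

/-- The span of the cosine products is stable under multiplication by the generators, hence by the
whole algebra, and it contains `1`. -/
theorem adjoin_cosProd_le {d : ℕ} {p : C(cube d, ℝ)}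
    (hp : p ∈ Algebra.adjoin ℝ (Set.range fun i : Fin d => cosProd (Pi.single i 1))) :
    p ∈ Submodule.span ℝ (Set.range (cosProd (d := d))) := by
  set V := Submodule.span ℝ (Set.range (cosProd (d := d))) with hV
  have key : ∀ v ∈ V, p * v ∈ V := by
    refine Algebra.adjoin_induction (p := fun p _ => ∀ v ∈ V, p * v ∈ V) ?_ ?_ ?_ ?_ hp
    · rintro _ ⟨i, rfl⟩ v hv
      refine Submodule.span_induction (p := fun v _ => cosProd (Pi.single i 1) * v ∈ V)
        ?_ ?_ ?_ ?_ hv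
      · rintro _ ⟨k, rfl⟩
        rw [cosProd_single_mul]
        exact V.smul_mem _ (V.add_mem (Submodule.subset_span ⟨_, rfl⟩)
          (Submodule.subset_span ⟨_, rfl⟩))
      · rw [mul_zero]
        exact V.zero_mem
      · intro a b _ _ ha hb
        rw [mul_add]
        exact V.add_mem ha hb
      · intro r a _ ha
        rw [mul_smul_comm]
        exact V.smul_mem _ ha
    · intro r v hv
      rw [← Algebra.smul_def]
      exact V.smul_mem _ hv
    · intro a b _ _ ha hb v hv
      rw [add_mul]
      exact V.add_mem (ha v hv) (hb v hv)
    · intro a b _ _ ha hb v hv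
      rw [mul_assoc]
      exact ha _ (hb v hv)
  have h1 : cosProd (0 : Fin d → ℤ) = 1 := by
    ext x
    simp [cosProd_apply]
  have h2 := key (cosProd 0) (Submodule.subset_span ⟨0, rfl⟩)
  rwa [h1, mul_one] at h2

/-- By Stone-Weierstrass every continuous function on the cube is a uniform limit of combinations of
cosine products, and integration against `w` is continuous for uniform convergence. -/
theorem integral_mul_continuousMap_eq_zero {d : ℕ} {w : (Fin d → ℝ) → ℝ}
    (hw : IntegrableOn w (cube d)) (h0 : ∀ k, ∫ x in cube d, w x * cosBasis k x = 0)
    (p : C(cube d, ℝ)) :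
    ∫ x : cube d, w x * p x ∂(Measure.comap Subtype.val volume) = 0 := by
  set ν : Measure (cube d) := Measure.comap Subtype.val volume with hν
  have hwν : Integrable (fun x : cube d => w x) ν :=
    (integrableOn_iff_comap_subtypeVal (measurableSet_cube d)).mp hw
  have hint : ∀ p : C(cube d, ℝ), Integrable (fun x : cube d => w x * p x) ν := fun p =>
    hwν.mul_bdd (c := ‖p‖) p.continuous.aestronglyMeasurable
      (Eventually.of_forall fun x => p.norm_coe_le_norm x)
  have hspan : ∀ v ∈ Submodule.span ℝ (Set.range (cosProd (d := d))),
      ∫ x : cube d, w x * v x ∂ν = 0 := by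
    intro v hv
    refine Submodule.span_induction (p := fun v _ => ∫ x : cube d, w x * v x ∂ν = 0)
      ?_ ?_ ?_ ?_ hv
    · rintro _ ⟨k, rfl⟩
      have h1 := h0 (absIdx k)
      rw [← integral_subtype_comap (measurableSet_cube d)] at h1
      simp_rw [← sqrt_two_pow_mul_cosProd, mul_left_comm (w _)] at h1
      rw [integral_const_mul] at h1
      exact (mul_eq_zero.mp h1).resolve_left (by positivity)
    · simp
    · intro a b _ _ ha hb
      simp only [ContinuousMap.add_apply, mul_add]
      rw [integral_add (hint a) (hint b), ha, hb, add_zero]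
    · intro r a _ ha
      simp only [ContinuousMap.smul_apply, smul_eq_mul, mul_left_comm (w _)]
      rw [integral_const_mul, ha, mul_zero]
  refine norm_le_zero_iff.mp (le_of_forall_pos_le_add fun ε hε => ?_)
  rw [zero_add]
  set I := ∫ x : cube d, ‖w x‖ ∂ν with hI
  have hI0 : 0 ≤ I := integral_nonneg fun x => norm_nonneg _
  obtain ⟨v, hv⟩ := ContinuousMap.exists_mem_subalgebra_near_continuousMap_of_separatesPoints _
    (separatesPoints_cosProd d) p (ε / (I + 1)) (by positivity)
  have h1 : ∫ x : cube d, w x * p x ∂ν = ∫ x : cube d, w x * (p - v.1) x ∂ν := by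
    simp only [ContinuousMap.sub_apply, mul_sub]
    rw [integral_sub (hint p) (hint v.1), hspan v.1 (adjoin_cosProd_le v.2), sub_zero]
  rw [h1]
  refine (norm_integral_le_of_norm_le (hwν.norm.mul_const (ε / (I + 1)))
    (Eventually.of_forall fun x => ?_)).trans ?_
  · rw [norm_mul]
    refine mul_le_mul_of_nonneg_left ?_ (norm_nonneg _)
    rw [norm_sub_rev] at hv
    exact ((p - v.1).norm_coe_le_norm x).trans hv.le
  · rw [integral_mul_const, ← hI, mul_div_assoc', div_le_iff₀ (by positivity)]
    nlinarith

/-- An integrable function that is orthogonal to all cosine products vanishes. -/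
theorem ae_eq_zero_of_orthogonal_cosBasis {d : ℕ} {w : (Fin d → ℝ) → ℝ}
    (hw : IntegrableOn w (cube d)) (h0 : ∀ k, ∫ x in cube d, w x * cosBasis k x = 0) :
    w =ᵐ[volume.restrict (cube d)] 0 := by
  have h1 : ∀ᵐ x, (cube d).indicator w x = 0 := by
    refine ae_eq_zero_of_integral_contDiff_smul_eq_zero
      ((integrable_indicator_iff (measurableSet_cube d)).mpr hw).locallyIntegrable ?_
    intro ψ hψ _
    have h2 := integral_mul_continuousMap_eq_zero hw h0
      ⟨fun x => ψ x.1, hψ.continuous.comp continuous_subtype_val⟩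
    simp only [ContinuousMap.coe_mk] at h2
    rw [integral_subtype_comap (measurableSet_cube d) fun x => w x * ψ x,
      ← integral_indicator (measurableSet_cube d)] at h2
    rw [← h2]
    refine integral_congr_ae (Eventually.of_forall fun x => ?_)
    by_cases hx : x ∈ cube d
    · simp [hx, mul_comm]
    · simp [hx]
  rw [EventuallyEq, ae_restrict_iff' (measurableSet_cube d)]
  filter_upwards [h1] with x hx hxc
  rwa [Set.indicator_of_mem hxc] at hx

/-! ### Integration by parts up to the boundary -/

/-- To be used at `y = (n+1) s - 1`, where `y + 1 = (n+1) s`: the growth of a rescaled transition's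
derivative is offset by the distance to the boundary. -/
theorem exists_deriv_smoothTransition_le :
    ∃ K : ℝ, 0 ≤ K ∧ ∀ y : ℝ, -1 ≤ y → |deriv Real.smoothTransition y| * (y + 1) ≤ K := by
  have hc : Continuous (deriv Real.smoothTransition) :=
    (Real.smoothTransition.contDiff (n := 1)).continuous_deriv le_rfl
  obtain ⟨K, hK⟩ := (isCompact_Icc (a := (-1 : ℝ)) (b := 1)).exists_bound_of_continuousOn
    hc.continuousOn
  have hK0 : 0 ≤ K := (norm_nonneg _).trans (hK 1 ⟨by norm_num, le_rfl⟩)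
  refine ⟨K * 2, by positivity, fun y hy => ?_⟩
  rcases le_or_gt y 1 with h | h
  · exact mul_le_mul (hK y ⟨hy, h⟩) (by linarith) (by linarith) hK0
  · have h1 : Real.smoothTransition =ᶠ[𝓝 y] fun _ => 1 := by
      filter_upwards [lt_mem_nhds h] with z hz
      exact Real.smoothTransition.one_of_one_le hz.le
    rw [h1.deriv_eq, deriv_const, abs_zero, zero_mul]
    positivity

/-- A smooth function with support inside `(0,1)`, tending to `1` there. -/
def cutoff (n : ℕ) (s : ℝ) : ℝ :=
  Real.smoothTransition ((n + 1) * s - 1) * Real.smoothTransition ((n + 1) * (1 - s) - 1)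

theorem contDiff_cutoff (n : ℕ) : ContDiff ℝ ∞ (cutoff n) :=
  (Real.smoothTransition.contDiff.comp (by fun_prop)).mul
    (Real.smoothTransition.contDiff.comp (by fun_prop))

theorem abs_cutoff_le (n : ℕ) (s : ℝ) : |cutoff n s| ≤ 1 := by
  rw [cutoff, abs_mul, abs_of_nonneg (Real.smoothTransition.nonneg _),
    abs_of_nonneg (Real.smoothTransition.nonneg _)]
  exact mul_le_one₀ (Real.smoothTransition.le_one _) (Real.smoothTransition.nonneg _)
    (Real.smoothTransition.le_one _)

theorem cutoff_eq_zero {n : ℕ} {s : ℝ}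
    (hs : s ∉ Set.Icc (1 / ((n : ℝ) + 1)) (1 - 1 / ((n : ℝ) + 1))) : cutoff n s = 0 := by
  have hc : (0 : ℝ) < (n : ℝ) + 1 := by positivity
  rw [Set.mem_Icc, not_and_or, not_le, not_le] at hs
  rw [cutoff]
  rcases hs with h | h
  · rw [lt_div_iff₀ hc] at h
    rw [Real.smoothTransition.zero_of_nonpos (by linarith), zero_mul]
  · have h1 : 1 - s < 1 / ((n : ℝ) + 1) := by linarith
    rw [lt_div_iff₀ hc] at h1
    rw [Real.smoothTransition.zero_of_nonpos (x := ((n : ℝ) + 1) * (1 - s) - 1) (by linarith),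
      mul_zero]

theorem eventually_cutoff_eq {s : ℝ} (hs : s ∈ Set.Ioo (0 : ℝ) 1) :
    ∀ᶠ n in atTop, cutoff n =ᶠ[𝓝 s] fun _ => 1 := by
  have h1 : Tendsto (fun n : ℕ => ((n : ℝ) + 1) * s) atTop atTop :=
    (tendsto_natCast_atTop_atTop.atTop_add tendsto_const_nhds).atTop_mul_const hs.1
  have h2 : Tendsto (fun n : ℕ => ((n : ℝ) + 1) * (1 - s)) atTop atTop :=
    (tendsto_natCast_atTop_atTop.atTop_add tendsto_const_nhds).atTop_mul_const
      (sub_pos.mpr hs.2)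
  filter_upwards [h1.eventually_gt_atTop 2, h2.eventually_gt_atTop 2] with n hn1 hn2
  have e1 : ∀ᶠ z in 𝓝 s, 2 < ((n : ℝ) + 1) * z :=
    (by fun_prop : Continuous fun z : ℝ => ((n : ℝ) + 1) * z).continuousAt.eventually_const_lt hn1
  have e2 : ∀ᶠ z in 𝓝 s, 2 < ((n : ℝ) + 1) * (1 - z) :=
    (by fun_prop : Continuous fun z : ℝ =>
      ((n : ℝ) + 1) * (1 - z)).continuousAt.eventually_const_lt hn2
  filter_upwards [e1, e2] with z hz1 hz2
  rw [cutoff, Real.smoothTransition.one_of_one_le (by linarith),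
    Real.smoothTransition.one_of_one_le (by linarith), one_mul]

theorem deriv_cutoff (n : ℕ) (s : ℝ) : deriv (cutoff n) s =
    deriv Real.smoothTransition ((n + 1) * s - 1) * (n + 1) *
        Real.smoothTransition ((n + 1) * (1 - s) - 1) +
      Real.smoothTransition ((n + 1) * s - 1) *
        (deriv Real.smoothTransition ((n + 1) * (1 - s) - 1) * (-(n + 1))) := by
  have hT : ∀ y, HasDerivAt Real.smoothTransition (deriv Real.smoothTransition y) y := fun y =>
    ((Real.smoothTransition.contDiff (n := 1)).differentiable one_ne_zero y).hasDerivAt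
  have h1 : HasDerivAt (fun s : ℝ => ((n : ℝ) + 1) * s - 1) (n + 1) s := by
    simpa using ((hasDerivAt_id s).const_mul ((n : ℝ) + 1)).sub_const 1
  have h2 : HasDerivAt (fun s : ℝ => ((n : ℝ) + 1) * (1 - s) - 1) (-(n + 1)) s := by
    simpa using (((hasDerivAt_id s).const_sub 1).const_mul ((n : ℝ) + 1)).sub_const 1
  exact (((hT _).comp s h1).mul ((hT _).comp s h2)).deriv

/-- The derivatives of `cutoff n * b` are uniformly bounded if `b` vanishes at `0` and `1`. -/
theorem exists_deriv_cutoff_mul_le {b : ℝ → ℝ} (hb : ContDiff ℝ ∞ b) (hb0 : b 0 = 0)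
    (hb1 : b 1 = 0) : ∃ B : ℝ, ∀ n : ℕ, ∀ s ∈ Set.Icc (0 : ℝ) 1,
      |deriv (fun s => cutoff n s * b s) s| ≤ B := by
  obtain ⟨K, hK0, hK⟩ := exists_deriv_smoothTransition_le
  have hbd : Differentiable ℝ b := hb.differentiable (by simp)
  obtain ⟨L, hL⟩ := (isCompact_Icc (a := (0 : ℝ)) (b := 1)).exists_bound_of_continuousOn
    (hb.continuous_deriv (by simp)).continuousOn
  have hL0 : 0 ≤ L := (norm_nonneg _).trans (hL 1 ⟨zero_le_one, le_rfl⟩)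
  have hmv : ∀ x ∈ Set.Icc (0 : ℝ) 1, ∀ y ∈ Set.Icc (0 : ℝ) 1, ‖b y - b x‖ ≤ L * ‖y - x‖ :=
    fun x hx y hy => (convex_Icc 0 1).norm_image_sub_le_of_norm_deriv_le
      (fun z _ => hbd z) hL hx hy
  refine ⟨K * L + K * L + L, fun n s hs => ?_⟩
  have hc : (0 : ℝ) < (n : ℝ) + 1 := by positivity
  -- As `b` vanishes at both ends, the mean value inequality makes it linearly small there, which
  -- absorbs the factor `n + 1` of the derivative of the cutoff.
  have hs0 : |b s| ≤ L * s := by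
    have := hmv 0 ⟨le_rfl, zero_le_one⟩ s hs
    rwa [hb0, sub_zero, sub_zero, Real.norm_eq_abs, Real.norm_of_nonneg hs.1] at this
  have hs1 : |b s| ≤ L * (1 - s) := by
    have := hmv 1 ⟨zero_le_one, le_rfl⟩ s hs
    rwa [hb1, sub_zero, norm_sub_rev, Real.norm_eq_abs,
      Real.norm_of_nonneg (sub_nonneg.mpr hs.2)] at this
  have hd : deriv (fun s => cutoff n s * b s) s =
      deriv (cutoff n) s * b s + cutoff n s * deriv b s :=
    deriv_fun_mul ((contDiff_cutoff n).differentiable (by simp) s) (hbd s)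
  set T := Real.smoothTransition
  set y := ((n : ℝ) + 1) * s - 1 with hy
  set z := ((n : ℝ) + 1) * (1 - s) - 1 with hz
  have hy1 : |deriv T y| * (((n : ℝ) + 1) * s) ≤ K := by
    have := hK y (by have := mul_nonneg hc.le hs.1; linarith)
    rwa [hy, sub_add_cancel] at this
  have hz1 : |deriv T z| * (((n : ℝ) + 1) * (1 - s)) ≤ K := by
    have := hK z (by have := mul_nonneg hc.le (sub_nonneg.mpr hs.2); linarith)
    rwa [hz, sub_add_cancel] at this
  have hT : ∀ x, |T x| ≤ 1 := fun x => by
    rw [abs_of_nonneg (Real.smoothTransition.nonneg _)]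
    exact Real.smoothTransition.le_one _
  have e1 : |deriv T y * (n + 1) * T z * b s| ≤ K * L := by
    rw [abs_mul, abs_mul, abs_mul, abs_of_pos hc]
    calc |deriv T y| * (n + 1) * |T z| * |b s| ≤ |deriv T y| * (n + 1) * 1 * (L * s) := by
          gcongr
          exact hT z
      _ = |deriv T y| * (((n : ℝ) + 1) * s) * L := by ring
      _ ≤ K * L := by gcongr
  have e2 : |T y * (deriv T z * (-(n + 1))) * b s| ≤ K * L := by
    rw [abs_mul, abs_mul, abs_mul, abs_neg, abs_of_pos hc]
    calc |T y| * (|deriv T z| * (n + 1)) * |b s| ≤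
          1 * (|deriv T z| * (n + 1)) * (L * (1 - s)) := by
          gcongr
          exact hT y
      _ = |deriv T z| * (((n : ℝ) + 1) * (1 - s)) * L := by ring
      _ ≤ K * L := by gcongr
  have e3 : |cutoff n s * deriv b s| ≤ L := by
    rw [abs_mul]
    calc |cutoff n s| * |deriv b s| ≤ 1 * L := by
          gcongr
          · exact abs_cutoff_le n s
          · exact hL s hs
      _ = L := one_mul L
  rw [hd, deriv_cutoff, add_mul]
  exact (abs_add_le _ _).trans (add_le_add ((abs_add_le _ _).trans (add_le_add e1 e2)) e3)

theorem fderiv_prod_single {d : ℕ} {p : Fin d → ℝ → ℝ} (hp : ∀ i, Differentiable ℝ (p i))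
    (x : Fin d → ℝ) (j : Fin d) :
    fderiv ℝ (fun x : Fin d → ℝ => ∏ i, p i (x i)) x (Pi.single j 1) =
      deriv (p j) (x j) * ∏ i ∈ Finset.univ.erase j, p i (x i) := by
  have h1 : ∀ i, HasFDerivAt (fun x : Fin d → ℝ => p i (x i))
      ((deriv (p i) (x i)) • ContinuousLinearMap.proj (R := ℝ) (φ := fun _ : Fin d => ℝ) i) x :=
    fun i => ((hp i (x i)).hasDerivAt).comp_hasFDerivAt x
      (ContinuousLinearMap.proj (R := ℝ) (φ := fun _ : Fin d => ℝ) i).hasFDerivAt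
  rw [(HasFDerivAt.finsetProd fun i _ => h1 i).fderiv]
  simp only [_root_.sum_apply, _root_.smul_apply,
    ContinuousLinearMap.proj_apply, smul_eq_mul]
  rw [Finset.sum_eq_single j]
  · rw [Pi.single_eq_same, mul_one, mul_comm]
  · intro i _ hi
    rw [Pi.single_eq_of_ne hi, mul_zero, mul_zero]
  · simp

theorem restrict_cube_eq (d : ℕ) : (volume : Measure (Fin d → ℝ)).restrict (cube d) =
    volume.restrict (Set.univ.pi fun _ => Set.Ioo (0 : ℝ) 1) :=
  (Measure.restrict_congr_set (Measure.univ_pi_Ioo_ae_eq_Icc (μ := fun _ => volume)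
    (f := fun _ : Fin d => (0 : ℝ)) (g := fun _ => 1))).symm

theorem IsWeakPartial.integral_prod {d : ℕ} {j : Fin d} {u G : (Fin d → ℝ) → ℝ}
    (huG : IsWeakPartial j u G) (hu : IntegrableOn u (cube d)) (hG : IntegrableOn G (cube d))
    {q : Fin d → ℝ → ℝ} (hq : ∀ i, ContDiff ℝ ∞ (q i)) (h0 : q j 0 = 0) (h1 : q j 1 = 0) :
    ∫ x in cube d, u x * (deriv (q j) (x j) * ∏ i ∈ Finset.univ.erase j, q i (x i)) =
      -∫ x in cube d, G x * ∏ i, q i (x i) := by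
  set p : ℕ → Fin d → ℝ → ℝ := fun n i s => cutoff n s * q i s with hp
  have hpc : ∀ n i, ContDiff ℝ ∞ (p n i) := fun n i => (contDiff_cutoff n).mul (hq i)
  have hpd : ∀ n i, Differentiable ℝ (p n i) := fun n i => (hpc n i).differentiable (by simp)
  set P : ℕ → (Fin d → ℝ) → ℝ := fun n x => ∏ i, p n i (x i) with hP
  have hPc : ∀ n, ContDiff ℝ ∞ (P n) := fun n =>
    contDiff_prod fun i _ => (hpc n i).comp (contDiff_apply ℝ ℝ i)
  have hsupp : ∀ n, Function.support (P n) ⊆ Set.univ.pi fun _ : Fin d =>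
      Set.Icc (1 / ((n : ℝ) + 1)) (1 - 1 / ((n : ℝ) + 1)) := by
    intro n x hx i _
    by_contra hxi
    refine hx (Finset.prod_eq_zero (Finset.mem_univ i) ?_)
    simp only [hp]
    rw [cutoff_eq_zero hxi, zero_mul]
  have hcomp : ∀ n, IsCompact (Set.univ.pi fun _ : Fin d =>
      Set.Icc (1 / ((n : ℝ) + 1)) (1 - 1 / ((n : ℝ) + 1))) := fun n =>
    isCompact_univ_pi fun _ => isCompact_Icc
  have htest : ∀ n, ∫ x in cube d, u x * fderiv ℝ (P n) x (Pi.single j 1) =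
      -∫ x in cube d, G x * P n x := by
    intro n
    refine huG (P n) (hPc n) (HasCompactSupport.of_support_subset_isCompact (hcomp n) (hsupp n)) ?_
    refine (closure_minimal (hsupp n) (hcomp n).isClosed).trans ?_
    refine Set.pi_mono fun i _ s hs => ?_
    have hc : 0 < 1 / ((n : ℝ) + 1) := by positivity
    exact ⟨hc.trans_le hs.1, hs.2.trans_lt (by linarith)⟩
  have hbq : ∀ i, ∃ B, ∀ s ∈ Set.Icc (0 : ℝ) 1, ‖q i s‖ ≤ B := fun i =>
    isCompact_Icc.exists_bound_of_continuousOn (hq i).continuous.continuousOn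
  choose B hB using hbq
  obtain ⟨B', hB'⟩ := exists_deriv_cutoff_mul_le (hq j) h0 h1
  have hpB : ∀ n i, ∀ s ∈ Set.Icc (0 : ℝ) 1, |p n i s| ≤ B i := by
    intro n i s hs
    simp only [hp]
    rw [abs_mul]
    exact (mul_le_of_le_one_left (abs_nonneg _) (abs_cutoff_le n s)).trans (hB i s hs)
  have hcoord : ∀ x ∈ cube d, ∀ i, x i ∈ Set.Icc (0 : ℝ) 1 := fun x hx i => ⟨hx.1 i, hx.2 i⟩
  have hopen : ∀ᵐ x ∂volume.restrict (cube d), ∀ i, x i ∈ Set.Ioo (0 : ℝ) 1 := by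
    rw [restrict_cube_eq]
    filter_upwards [ae_restrict_mem (MeasurableSet.univ_pi fun _ => measurableSet_Ioo)]
      with x hx i using hx i (Set.mem_univ i)
  have hcube : ∀ᵐ x ∂volume.restrict (cube d), x ∈ cube d :=
    ae_restrict_mem (measurableSet_cube d)
  have hfd : ∀ n x, fderiv ℝ (P n) x (Pi.single j 1) =
      deriv (p n j) (x j) * ∏ i ∈ Finset.univ.erase j, p n i (x i) := fun n x =>
    fderiv_prod_single (hpd n) x j
  have hlim1 : Tendsto (fun n => ∫ x in cube d, u x * fderiv ℝ (P n) x (Pi.single j 1)) atTop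
      (𝓝 (∫ x in cube d,
        u x * (deriv (q j) (x j) * ∏ i ∈ Finset.univ.erase j, q i (x i)))) := by
    refine tendsto_integral_of_dominated_convergence
      (fun x => ‖u x‖ * (B' * ∏ i ∈ Finset.univ.erase j, B i)) (fun n => ?_)
      (hu.norm.mul_const _) (fun n => ?_) ?_
    · refine hu.aestronglyMeasurable.mul (Continuous.aestronglyMeasurable ?_)
      exact ((hPc n).continuous_fderiv (by simp)).clm_apply continuous_const
    · filter_upwards [hcube] with x hx
      rw [norm_mul, hfd]
      refine mul_le_mul_of_nonneg_left ?_ (norm_nonneg _)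
      rw [Real.norm_eq_abs, abs_mul, Finset.abs_prod]
      exact mul_le_mul (hB' n _ (hcoord x hx j))
        (Finset.prod_le_prod (fun _ _ => abs_nonneg _) fun i _ => hpB n i _ (hcoord x hx i))
        (Finset.prod_nonneg fun _ _ => abs_nonneg _)
        ((abs_nonneg _).trans (hB' n _ (hcoord x hx j)))
    · filter_upwards [hopen] with x hx
      -- At an interior point the cutoffs are eventually equal to `1` nearby, so the sequence is
      -- eventually constant.
      refine tendsto_const_nhds.congr' ?_
      filter_upwards [eventually_all.mpr fun i => eventually_cutoff_eq (hx i)] with n hn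
      rw [hfd]
      congr 2
      · refine (EventuallyEq.deriv_eq ?_).symm
        filter_upwards [hn j] with s hs
        simp only [hp]
        rw [hs, one_mul]
      · refine Finset.prod_congr rfl fun i _ => ?_
        simp only [hp]
        rw [(hn i).self_of_nhds, one_mul]
  have hlim2 : Tendsto (fun n => -∫ x in cube d, G x * P n x) atTop
      (𝓝 (-∫ x in cube d, G x * ∏ i, q i (x i))) := by
    refine Tendsto.neg (tendsto_integral_of_dominated_convergence
      (fun x => ‖G x‖ * ∏ i, B i) (fun n => ?_) (hG.norm.mul_const _) (fun n => ?_) ?_)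
    · exact hG.aestronglyMeasurable.mul (hPc n).continuous.aestronglyMeasurable
    · filter_upwards [hcube] with x hx
      rw [norm_mul]
      refine mul_le_mul_of_nonneg_left ?_ (norm_nonneg _)
      rw [Real.norm_eq_abs, Finset.abs_prod]
      exact Finset.prod_le_prod (fun _ _ => abs_nonneg _) fun i _ => hpB n i _ (hcoord x hx i)
    · filter_upwards [hopen] with x hx
      refine tendsto_const_nhds.congr' ?_
      filter_upwards [eventually_all.mpr fun i => eventually_cutoff_eq (hx i)] with n hn
      congr 1
      refine Finset.prod_congr rfl fun i _ => ?_
      simp only [hp]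
      rw [(hn i).self_of_nhds, one_mul]
  simp_rw [htest] at hlim1
  exact tendsto_nhds_unique hlim1 hlim2

/-! ### The cosine coefficients of a weak solution -/

theorem contDiff_cosFactor (n : ℕ) : ContDiff ℝ ∞ (cosFactor n) := by
  unfold cosFactor
  fun_prop

theorem deriv_cosFactor (n : ℕ) : deriv (cosFactor n) =
    fun s => -((if n = 0 then 1 else √2) * (Real.pi * n) * Real.sin (Real.pi * n * s)) := by
  funext s
  have h1 : HasDerivAt (fun s : ℝ => Real.pi * n * s) (Real.pi * n) s := by
    simpa using (hasDerivAt_id s).const_mul (Real.pi * n)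
  have h2 := (h1.cos.const_mul (if n = 0 then 1 else √2)).deriv
  unfold cosFactor
  rw [h2]
  ring

theorem deriv_deriv_cosFactor (n : ℕ) (s : ℝ) :
    deriv (deriv (cosFactor n)) s = -(Real.pi ^ 2 * (n : ℝ) ^ 2 * cosFactor n s) := by
  have h1 : HasDerivAt (fun s : ℝ => Real.pi * n * s) (Real.pi * n) s := by
    simpa using (hasDerivAt_id s).const_mul (Real.pi * n)
  rw [deriv_cosFactor, ((h1.sin.const_mul ((if n = 0 then 1 else √2) * (Real.pi * n))).fun_neg).deriv,
    cosFactor]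
  ring

/-- The test function is `φ_k` itself. Its derivative `∂_j φ_k` contains a sine that vanishes on the
faces `x_j = 0, 1`, so a second integration by parts has no boundary term and yields `-∂_j² φ_k = π²
k_j² φ_k`. -/
theorem IsWeakNeumannSolution.eigval_mul {d : ℕ} {f u : (Fin d → ℝ) → ℝ}
    (h : IsWeakNeumannSolution f u) (k : Fin d → ℕ) :
    eigval k * ∫ x in cube d, u x * cosBasis k x = -cosCoeff f k := by
  obtain ⟨hu, G, hG, hweak⟩ := h
  have hui : IntegrableOn u (cube d) := hu.integrable one_le_two
  have hGi : ∀ j, IntegrableOn (G j) (cube d) := fun j => (hG j).1.integrable one_le_two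
  have hcb : (cosBasis k : (Fin d → ℝ) → ℝ) = fun x => ∏ i, cosFactor (k i) (x i) :=
    funext fun x => cosBasis_eq_prod k x
  have hcd : ContDiff ℝ ∞ (cosBasis k : (Fin d → ℝ) → ℝ) := by
    rw [hcb]
    exact contDiff_prod fun i _ => (contDiff_cosFactor (k i)).comp (contDiff_apply ℝ ℝ i)
  have hfd : ∀ x j, fderiv ℝ (cosBasis k) x (Pi.single j 1) =
      deriv (cosFactor (k j)) (x j) * ∏ i ∈ Finset.univ.erase j, cosFactor (k i) (x i) := by
    intro x j
    rw [hcb]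
    exact fderiv_prod_single
      (fun i => (contDiff_cosFactor (k i)).differentiable (by simp)) x j
  have hdir : ∀ j, ∫ x in cube d, G j x * fderiv ℝ (cosBasis k) x (Pi.single j 1) =
      Real.pi ^ 2 * (k j : ℝ) ^ 2 * ∫ x in cube d, u x * cosBasis k x := by
    intro j
    set q : Fin d → ℝ → ℝ :=
      Function.update (fun i => cosFactor (k i)) j (deriv (cosFactor (k j))) with hq
    have hqj : q j = deriv (cosFactor (k j)) := Function.update_self _ _ _
    have hqi : ∀ i ∈ Finset.univ.erase j, q i = cosFactor (k i) := fun i hi =>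
      Function.update_of_ne (Finset.ne_of_mem_erase hi) _ _
    have hqc : ∀ i, ContDiff ℝ ∞ (q i) := by
      intro i
      rcases eq_or_ne i j with rfl | hi
      · rw [hqj, deriv_cosFactor]
        fun_prop
      · rw [hqi i (Finset.mem_erase.mpr ⟨hi, Finset.mem_univ i⟩)]
        exact contDiff_cosFactor _
    have h0 : q j 0 = 0 := by
      rw [hqj, deriv_cosFactor]
      simp
    have h1 : q j 1 = 0 := by
      rw [hqj, deriv_cosFactor]
      simp only
      rw [mul_one, mul_comm Real.pi, Real.sin_nat_mul_pi, mul_zero, neg_zero]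
    have key := (hG j).2.integral_prod hui (hGi j) hqc h0 h1
    have e1 : ∀ x : Fin d → ℝ, ∏ i, q i (x i) = fderiv ℝ (cosBasis k) x (Pi.single j 1) := by
      intro x
      rw [hfd, ← Finset.mul_prod_erase _ _ (Finset.mem_univ j), hqj]
      congr 1
      exact Finset.prod_congr rfl fun i hi => by rw [hqi i hi]
    have e2 : ∀ x : Fin d → ℝ, deriv (q j) (x j) * ∏ i ∈ Finset.univ.erase j, q i (x i) =
        -(Real.pi ^ 2 * (k j : ℝ) ^ 2 * cosBasis k x) := by
      intro x
      rw [hqj, deriv_deriv_cosFactor, cosBasis_eq_prod,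
        ← Finset.mul_prod_erase _ _ (Finset.mem_univ j),
        Finset.prod_congr rfl fun i hi => by rw [hqi i hi]]
      ring
    simp_rw [e1, e2] at key
    rw [eq_comm, neg_eq_iff_eq_neg] at key
    rw [key, ← integral_neg, ← integral_const_mul]
    refine integral_congr_ae (Eventually.of_forall fun x => ?_)
    simp only
    ring
  have hint : ∀ j, IntegrableOn (fun x => G j x * fderiv ℝ (cosBasis k) x (Pi.single j 1))
      (cube d) := by
    intro j
    have hc : Continuous fun x => fderiv ℝ (cosBasis k) x (Pi.single j (1 : ℝ)) :=
      (hcd.continuous_fderiv (by simp)).clm_apply continuous_const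
    obtain ⟨B, hB⟩ := (isCompact_Icc (a := (0 : Fin d → ℝ)) (b := 1)).exists_bound_of_continuousOn
      hc.continuousOn
    refine (hGi j).mul_bdd (c := B) hc.aestronglyMeasurable ?_
    filter_upwards [ae_restrict_mem (measurableSet_cube d)] with x hx using hB x hx
  have h2 := hweak (cosBasis k) hcd
  rw [integral_finsetSum _ fun j _ => hint j] at h2
  simp_rw [hdir] at h2
  rw [← Finset.sum_mul, ← Finset.mul_sum] at h2
  exact h2

/-! ### The cosine series of the error of the numerical solution -/

theorem pi_sq_le_eigval {d : ℕ} {k : Fin d → ℕ} (hk : k ≠ 0) : Real.pi ^ 2 ≤ eigval k := by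
  obtain ⟨j, hj⟩ : ∃ j, k j ≠ 0 := by
    by_contra h
    push Not at h
    exact hk (funext h)
  rw [eigval]
  refine le_mul_of_one_le_right (by positivity) ?_
  have h1 : (1 : ℝ) ≤ (k j : ℝ) := by exact_mod_cast Nat.one_le_iff_ne_zero.mpr hj
  calc (1 : ℝ) ≤ (k j : ℝ) ^ 2 := one_le_pow₀ h1
    _ ≤ _ := Finset.single_le_sum (f := fun j => (k j : ℝ) ^ 2) (fun i _ => by positivity)
        (Finset.mem_univ j)

theorem cosBasis_zero {d : ℕ} (x : Fin d → ℝ) : cosBasis (0 : Fin d → ℕ) x = 1 := by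
  rw [cosBasis_eq_prod]
  exact Finset.prod_eq_one fun j _ => by simp [cosFactor]

theorem one_le_pi_sq : (1 : ℝ) ≤ Real.pi ^ 2 :=
  one_le_pow₀ (by linarith [Real.pi_gt_three])

/-- An integrable function with absolutely summable cosine coefficients is the sum of its cosine
series. -/
theorem ae_eq_tsum_cosBasis {d : ℕ} {u : (Fin d → ℝ) → ℝ} (hu : IntegrableOn u (cube d))
    (hs : Summable fun k => |∫ x in cube d, u x * cosBasis k x|) :
    u =ᵐ[volume.restrict (cube d)]
      fun x => ∑' k, (∫ y in cube d, u y * cosBasis k y) * cosBasis k x := by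
  set a : (Fin d → ℕ) → ℝ := fun k => ∫ x in cube d, u x * cosBasis k x with ha
  set B : ℝ := √2 ^ d with hB
  have hterm : ∀ k x, ‖a k * cosBasis k x‖ ≤ |a k| * B := fun k x => by
    rw [norm_mul, Real.norm_eq_abs, Real.norm_eq_abs]
    exact mul_le_mul_of_nonneg_left (abs_cosBasis_le k x) (abs_nonneg _)
  have hcont : Continuous fun x => ∑' k, a k * cosBasis k x :=
    continuous_tsum (fun k => continuous_const.mul (continuous_cosBasis k)) (hs.mul_right B) hterm
  have hci : ∀ v : (Fin d → ℝ) → ℝ, Continuous v → IntegrableOn v (cube d) := fun v hv =>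
    hv.continuousOn.integrableOn_compact isCompact_Icc
  have hui : ∀ l, IntegrableOn (fun x => u x * cosBasis l x) (cube d) := fun l =>
    hu.mul_bdd (c := B) (continuous_cosBasis l).aestronglyMeasurable
      (Eventually.of_forall fun x => abs_cosBasis_le l x)
  -- The difference of `u` and its series is orthogonal to every `φ_l`, so completeness finishes the
  -- proof.
  have horth : ∀ l, ∫ x in cube d, (u x - ∑' k, a k * cosBasis k x) * cosBasis l x = 0 := by
    intro l
    simp_rw [sub_mul]
    rw [integral_sub (hui l) (hci (fun x => (∑' k, a k * cosBasis k x) * cosBasis l x)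
      (hcont.mul (continuous_cosBasis l)))]
    have h1 : ∫ x in cube d, (∑' k, a k * cosBasis k x) * cosBasis l x =
        ∑' k, ∫ x in cube d, a k * cosBasis k x * cosBasis l x := by
      rw [integral_tsum_of_summable_integral_norm
        (F := fun k x => a k * cosBasis k x * cosBasis l x)
        (fun k => hci _ ((continuous_const.mul (continuous_cosBasis k)).mul
          (continuous_cosBasis l)))]
      · simp_rw [tsum_mul_right]
      · refine Summable.of_nonneg_of_le (fun k => integral_nonneg fun x => norm_nonneg _)
          (fun k => ?_) (hs.mul_right (B * B))
        have h2 : ∀ᵐ x ∂volume.restrict (cube d),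
            ‖‖a k * cosBasis k x * cosBasis l x‖‖ ≤ |a k| * (B * B) :=
          Eventually.of_forall fun x => by
            rw [norm_norm, norm_mul, ← mul_assoc]
            exact mul_le_mul (hterm k x) (abs_cosBasis_le l x) (norm_nonneg _) (by positivity)
        have h3 := norm_integral_le_of_norm_le_const h2
        rw [measureReal_restrict_apply_univ, measureReal_def, volume_cube, ENNReal.toReal_one,
          mul_one] at h3
        exact (le_abs_self _).trans h3
    rw [h1]
    simp_rw [mul_assoc, integral_const_mul, integral_cosBasis_orth, mul_ite, mul_one, mul_zero]
    rw [tsum_ite_eq, sub_self]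
  have hw := ae_eq_zero_of_orthogonal_cosBasis (hu.sub (hci _ hcont)) horth
  filter_upwards [hw] with x hx
  simpa [sub_eq_zero] using hx

/-! ### The norms of the error of the numerical solution -/

section

variable {d : ℕ} {α : ℝ} {γ : ℕ → ℝ} {t : ℝ} {N : ℕ} {g : Fin d → ℤ} {f u : (Fin d → ℝ) → ℝ}

/-- The cosine coefficients of the error of the numerical solution. -/
def solCoeffErr (α : ℝ) (γ : ℕ → ℝ) (t : ℝ) (N : ℕ) (g : Fin d → ℤ) (f : (Fin d → ℝ) → ℝ)
    (Δ : Fin d → ℝ) (k : Fin d → ℕ) : ℂ :=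
  if k = 0 then 0 else cosErr α γ t N g f Δ k / (eigval k : ℂ)

/-- The mean is known, so the mode `0` has no error; every other mode is divided by at least `π²`.
-/
theorem norm_solCoeffErr_le (Δ : Fin d → ℝ) (k : Fin d → ℕ) :
    ‖solCoeffErr α γ t N g f Δ k‖ ≤ ‖cosErr α γ t N g f Δ k‖ / Real.pi ^ 2 := by
  rw [solCoeffErr]
  split_ifs with hk
  · rw [norm_zero]
    positivity
  · have h1 := pi_sq_le_eigval hk
    have h2 : (0 : ℝ) < Real.pi ^ 2 := by positivity
    rw [norm_div, Complex.norm_real, Real.norm_of_nonneg (h2.le.trans h1)]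
    gcongr

theorem summable_fourierErr (hα : 1 / 2 < α) (hγ : ∀ j, 0 < γ j) (hf : MemCosineSpace α γ f)
    (M : ℝ) (Y : List (Fin d → ℝ)) (Δ : Fin d → ℝ) :
    Summable fun h => ‖fourierErr α γ M N g f Y Δ h‖ := by
  have h0 := hasSum_fourierErr (N := N) (g := g) hα hγ Y Δ (summable_tail_abs hα hγ hf M)
  simp_rw [pow_one ‖fourierErr _ _ _ _ _ _ _ _ _‖] at h0
  exact h0.summable

theorem tsum_norm_solCoeffErr_le (hα : 1 / 2 < α) (hγ : ∀ j, 0 < γ j)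
    (hf : MemCosineSpace α γ f) (Δ : Fin d → ℝ) :
    Summable (fun k => ‖solCoeffErr α γ t N g f Δ k‖) ∧
    ∑' k, ‖solCoeffErr α γ t N g f Δ k‖ ≤
      (∑' h, ‖fourierErr α γ (truncM d α γ N) N g f (shifts α γ t N g) Δ h‖) /
        Real.pi ^ 2 := by
  have h1 := (hasSum_signs (summable_fourierErr (N := N) (g := g) hα hγ hf (truncM d α γ N)
    (shifts α γ t N g) Δ)).div_const (Real.pi ^ 2)
  have h2 : ∀ k, ‖solCoeffErr α γ t N g f Δ k‖ ≤ (∑ h ∈ signs k,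
      ‖fourierErr α γ (truncM d α γ N) N g f (shifts α γ t N g) Δ h‖) / Real.pi ^ 2 := fun k =>
    (norm_solCoeffErr_le Δ k).trans (by gcongr; exact norm_cosErr_le Δ k)
  have h3 := Summable.of_nonneg_of_le (fun k => norm_nonneg _) h2 h1.summable
  exact ⟨h3, (h3.tsum_le_tsum h2 h1.summable).trans h1.tsum_eq.le⟩

theorem tsum_norm_solCoeffErr_sq_le (hα : 1 / 2 < α) (hγ : ∀ j, 0 < γ j)
    (hf : MemCosineSpace α γ f) (hM : 0 < truncM d α γ N) (Δ : Fin d → ℝ) :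
    Summable (fun k => ‖solCoeffErr α γ t N g f Δ k‖ ^ 2) ∧
    ∑' k, ‖solCoeffErr α γ t N g f Δ k‖ ^ 2 ≤
      (∑' h, ‖fourierErr α γ (truncM d α γ N) N g f (shifts α γ t N g) Δ h‖ ^ 2) /
        Real.pi ^ 4 := by
  have h0 := (hasSum_fourierErr (N := N) (g := g) hα hγ (shifts α γ t N g) Δ
    (summable_tail_sq hf hM)).summable
  have h1 := (hasSum_signs h0).div_const (Real.pi ^ 4)
  have h2 : ∀ k, ‖solCoeffErr α γ t N g f Δ k‖ ^ 2 ≤ (∑ h ∈ signs k,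
      ‖fourierErr α γ (truncM d α γ N) N g f (shifts α γ t N g) Δ h‖ ^ 2) / Real.pi ^ 4 := by
    intro k
    refine (pow_le_pow_left₀ (norm_nonneg _) (norm_solCoeffErr_le Δ k) 2).trans ?_
    rw [div_pow, ← pow_mul]
    gcongr
    exact norm_cosErr_sq_le Δ k
  have h3 := Summable.of_nonneg_of_le (fun k => by positivity) h2 h1.summable
  exact ⟨h3, (h3.tsum_le_tsum h2 h1.summable).trans h1.tsum_eq.le⟩

/-- The error of the numerical solution is the sum of its cosine series. -/
theorem solError_ae_eq (hα : 1 / 2 < α) (hγ : ∀ j, 0 < γ j) (hf : MemCosineSpace α γ f)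
    (hu : IsWeakNeumannSolution f u) (Δ : Fin d → ℝ) :
    solError α γ t N g f u Δ =ᵐ[volume.restrict (cube d)]
      fun x => ∑' k, solCoeffErr α γ t N g f Δ k * (cosBasis k x : ℂ) := by
  classical
  have hui : IntegrableOn u (cube d) := hu.1.integrable one_le_two
  set a : (Fin d → ℕ) → ℝ := fun k => ∫ x in cube d, u x * cosBasis k x with ha
  have ha1 : ∀ k, k ≠ 0 → a k = -(cosCoeff f k / eigval k) := by
    intro k hk
    have h1 : eigval k ≠ 0 := ((by positivity : (0 : ℝ) < Real.pi ^ 2).trans_le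
      (pi_sq_le_eigval hk)).ne'
    rw [← neg_div, eq_div_iff h1, mul_comm]
    exact hu.eigval_mul k
  have ha0 : a 0 = ∫ y in cube d, u y := by
    simp only [ha, cosBasis_zero, mul_one]
  have hs : Summable fun k => |a k| := by
    refine Summable.of_nonneg_of_le (fun k => abs_nonneg _) (fun k => ?_)
      ((summable_of_ne_finset_zero (s := {(0 : Fin d → ℕ)})
        (f := fun k => if k = 0 then |a 0| else 0) fun k hk => if_neg (by simpa using hk)).add
        (summable_abs_cosCoeff hα hγ hf))
    split_ifs with hk
    · rw [hk]
      exact le_add_of_nonneg_right (abs_nonneg _)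
    · rw [ha1 k hk, abs_neg, abs_div, zero_add]
      refine div_le_self (abs_nonneg _) ?_
      exact (one_le_pi_sq.trans (pi_sq_le_eigval hk)).trans (le_abs_self _)
  filter_upwards [ae_eq_tsum_cosBasis hui hs] with x hx
  set A := (crossPlus d α γ (truncM d α γ N)).erase 0 with hA
  set b : (Fin d → ℕ) → ℂ := fun k =>
    cosCoeffEst α γ t N g f Δ k / (eigval k : ℂ) * (cosBasis k x : ℂ) with hb
  have hsa : Summable fun k => ((a k * cosBasis k x : ℝ) : ℂ) := by
    refine Complex.summable_ofReal.mpr (Summable.of_norm ?_)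
    refine Summable.of_nonneg_of_le (fun k => norm_nonneg _) (fun k => ?_)
      (hs.mul_right (√2 ^ d))
    rw [norm_mul, Real.norm_eq_abs, Real.norm_eq_abs]
    exact mul_le_mul_of_nonneg_left (abs_cosBasis_le k x) (abs_nonneg _)
  have hsm : HasSum (fun k : Fin d → ℕ => if k = 0 then (a 0 : ℂ) else 0) (a 0 : ℂ) :=
    hasSum_ite_eq 0 _
  have hsb : HasSum (fun k => if k ∈ A then b k else 0) (∑ k ∈ A, b k) := by
    rw [← Finset.sum_congr rfl fun k hk => if_pos hk]
    exact hasSum_sum_of_ne_finset_zero fun k hk => if_neg hk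
  have hsum := (hsa.hasSum.sub hsm).add hsb
  have hux : (u x : ℂ) = ∑' k, ((a k * cosBasis k x : ℝ) : ℂ) := by
    rw [← Complex.ofReal_tsum]
    exact congrArg _ hx
  rw [solError, approxSol, ← ha0, hux, sub_sub_eq_add_sub, add_sub_right_comm, ← hsum.tsum_eq]
  refine tsum_congr fun k => ?_
  by_cases hk : k = 0
  · subst hk
    rw [if_pos rfl, if_neg (by simp [hA]), solCoeffErr, if_pos rfl, cosBasis_zero]
    simp
  · rw [if_neg hk, solCoeffErr, if_neg hk, cosErr, sub_zero, ha1 k hk]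
    -- Outside the cross both the term of the numerical solution and the recovered coefficient are
    -- zero, so one formula describes the error everywhere.
    by_cases hkA : k ∈ crossPlus d α γ (truncM d α γ N)
    · rw [if_pos (Finset.mem_erase.mpr ⟨hk, hkA⟩), hb]
      push_cast
      ring
    · rw [if_neg (fun h => hkA (Finset.mem_of_mem_erase h)),
        cosCoeffEst_of_notMem hα hγ Δ hkA]
      push_cast
      ring

theorem eLpNorm_two_solError_sq (hα : 1 / 2 < α) (hγ : ∀ j, 0 < γ j)
    (hf : MemCosineSpace α γ f) (hu : IsWeakNeumannSolution f u) (hM : 0 < truncM d α γ N)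
    (Δ : Fin d → ℝ) :
    eLpNorm (solError α γ t N g f u Δ) 2 (volume.restrict (cube d)) ^ 2 ≤
      ENNReal.ofReal ((Real.pi ^ 4)⁻¹) * ENNReal.ofReal
        (∑' h, ‖fourierErr α γ (truncM d α γ N) N g f (shifts α γ t N g) Δ h‖ ^ 2) := by
  classical
  rw [eLpNorm_congr_ae (solError_ae_eq hα hγ hf hu Δ)]
  have h1 := eLpNorm_nnreal_pow_eq_lintegral (μ := volume.restrict (cube d)) (p := 2)
    (f := fun x => ∑' k, solCoeffErr α γ t N g f Δ k * (cosBasis k x : ℂ)) two_ne_zero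
  simp only [ENNReal.coe_ofNat, NNReal.coe_ofNat, ENNReal.rpow_ofNat] at h1
  have hsq := tsum_norm_solCoeffErr_sq_le (t := t) (g := g) hα hγ hf hM Δ
  rw [h1, lintegral_enorm_sq_tsum (ψ := fun (k : Fin d → ℕ) x => (cosBasis k x : ℂ))
    (B := √2 ^ d) (fun k => (Complex.continuous_ofReal.comp (continuous_cosBasis k)).measurable)
    (fun k x => by
      rw [Complex.norm_real]
      exact abs_cosBasis_le k x)
    (fun k l => integral_cosBasis_orth_complex k l)
    (tsum_norm_solCoeffErr_le hα hγ hf Δ).1 hsq.1, ← ENNReal.ofReal_mul (by positivity)]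
  refine ENNReal.ofReal_le_ofReal (hsq.2.trans (le_of_eq ?_))
  rw [div_eq_inv_mul]

/-- The root-mean-square error is controlled by the truncation parameter. -/
theorem rmsError_le [NeZero N] (hα : 1 / 2 < α) (hγ : ∀ j, 0 < γ j)
    (hf : MemCosineSpace α γ f) (hu : IsWeakNeumannSolution f u) (hM : 0 < truncM d α γ N)
    {κ : ℝ} (hκ : 0 < κ) (hY : 1 ≤ (shifts α γ t N g).length)
    (hst : ∀ l ∈ cross d α γ (truncM d α γ N), IsStable κ (shifts α γ t N g)
      (fiber (cross d α γ (truncM d α γ N)) N g l)) :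
    rmsError α γ t N g f u ≤ ENNReal.ofReal
      (√(κ⁻¹ + 1) / Real.pi ^ 2 * (truncM d α γ N)⁻¹ * cosineNorm α γ f) := by
  have hn : 0 ≤ cosineNorm α γ f := Real.sqrt_nonneg _
  set X : ℝ := √(κ⁻¹ + 1) / Real.pi ^ 2 * (truncM d α γ N)⁻¹ * cosineNorm α γ f with hX
  have hX0 : 0 ≤ X := by positivity
  have h1 : ∫⁻ Δ in cube d, eLpNorm (solError α γ t N g f u Δ) 2 (volume.restrict (cube d)) ^ 2 ≤
      ENNReal.ofReal (X ^ 2) := by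
    refine (lintegral_mono fun Δ => eLpNorm_two_solError_sq hα hγ hf hu hM Δ).trans ?_
    rw [lintegral_const_mul' _ _ ENNReal.ofReal_ne_top]
    refine (mul_le_mul_right (lintegral_tsum_fourierErr_le hα hγ hf hM hκ hY hst) _).trans ?_
    rw [← ENNReal.ofReal_mul (by positivity)]
    refine ENNReal.ofReal_le_ofReal (le_of_eq ?_)
    rw [hX, mul_pow, mul_pow, div_pow, Real.sq_sqrt (by positivity)]
    field_simp
  rw [rmsError]
  refine (ENNReal.rpow_le_rpow h1 (by norm_num)).trans (le_of_eq ?_)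
  rw [ENNReal.ofReal_rpow_of_nonneg (by positivity) (by norm_num), ← Real.sqrt_eq_rpow,
    Real.sqrt_sq hX0]

/-- The uniform error is controlled by the errors of the Fourier coefficients. -/
theorem supError_le (hα : 1 / 2 < α) (hγ : ∀ j, 0 < γ j)
    (hf : MemCosineSpace α γ f) (hu : IsWeakNeumannSolution f u) {E : ℝ}
    (hE : ∑' h, ‖fourierErr α γ (truncM d α γ N) N g f (shifts α γ t N g) 0 h‖ ≤ E) :
    supError α γ t N g f u ≤ ENNReal.ofReal (√2 ^ d / Real.pi ^ 2 * E) := by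
  rw [supError, eLpNorm_congr_ae (solError_ae_eq hα hγ hf hu 0), eLpNorm_exponent_top]
  refine eLpNormEssSup_le_of_ae_bound (Eventually.of_forall fun x => ?_)
  have h1 := tsum_norm_solCoeffErr_le (t := t) (N := N) (g := g) hα hγ hf 0
  have h2 : ∀ k, ‖solCoeffErr α γ t N g f 0 k * (cosBasis k x : ℂ)‖ ≤
      ‖solCoeffErr α γ t N g f 0 k‖ * √2 ^ d := fun k => by
    rw [norm_mul, Complex.norm_real]
    exact mul_le_mul_of_nonneg_left (abs_cosBasis_le k x) (norm_nonneg _)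
  refine (tsum_of_norm_bounded (h1.1.mul_right (√2 ^ d)).hasSum h2).trans ?_
  rw [tsum_mul_right, div_mul_eq_mul_div, mul_comm (√2 ^ d), mul_div_right_comm]
  refine mul_le_mul_of_nonneg_right (h1.2.trans ?_) (by positivity)
  gcongr

end

/-! ### Rates of convergence -/

/-- At `q = 1/α` both inequalities would hold with `τ = 0`, but that endpoint is excluded. Moving to
`q = 1/α + δ` loses at most `(α² + α) δ ≤ τ`, twice that in the second. -/
theorem exists_exponent {α τ : ℝ} (hα : 1 / 2 < α) (hτ : 0 < τ) :
    ∃ q ∈ Set.Ioc (1 / α) 2, α - τ ≤ 1 / q ∧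
      α * q + (q - 2 - 1 / α) / q ≤ 2 * (-α + 1 / 2 + τ) := by
  have hα0 : 0 < α := by linarith
  have h2 : 1 / α < 2 := by
    rw [div_lt_iff₀ hα0]
    linarith
  set δ := min (τ / (α ^ 2 + α)) (2 - 1 / α) with hδ
  have hδ0 : 0 < δ := lt_min (by positivity) (by linarith)
  have hδ1 : (α ^ 2 + α) * δ ≤ τ := by
    have := min_le_left (τ / (α ^ 2 + α)) (2 - 1 / α)
    rw [← hδ, le_div_iff₀ (by positivity)] at this
    linarith
  have hδ2 : δ ≤ 2 - 1 / α := min_le_right _ _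
  set q := 1 / α + δ with hq
  have hq0 : 0 < q := by positivity
  have hαq : α * q = 1 + α * δ := by
    rw [hq]
    field_simp
  have h3 : α - α ^ 2 * δ ≤ 1 / q := by
    rw [le_div_iff₀ hq0]
    have : (α - α ^ 2 * δ) * q = (1 - α * δ) * (α * q) := by ring
    rw [this, hαq]
    nlinarith [sq_nonneg (α * δ)]
  have h4 : 1 / q ≤ α := by
    rw [div_le_iff₀ hq0, hαq]
    have := mul_pos hα0 hδ0
    linarith
  have h5 : (q - 2 - 1 / α) / q = δ * (1 / q) - 2 * (1 / q) := by
    rw [show q - 2 - 1 / α = δ - 2 by rw [hq]; ring]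
    ring
  refine ⟨q, ⟨by linarith, by linarith⟩, ?_, ?_⟩
  · nlinarith [mul_pos hα0 hδ0]
  · rw [h5, hαq]
    have h6 : δ * (1 / q) ≤ δ * α := mul_le_mul_of_nonneg_left h4 hδ0.le
    nlinarith

theorem sqrt_le_sqrt_mul_rpow {X C n β : ℝ} (hC : 0 ≤ C) (hn : 0 < n)
    (h : X ≤ C * n ^ (2 * β)) : √X ≤ √C * n ^ β := by
  refine (Real.sqrt_le_sqrt h).trans (le_of_eq ?_)
  rw [Real.sqrt_mul hC, mul_comm 2 β, Real.rpow_mul hn.le, Real.rpow_two,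
    Real.sqrt_sq (Real.rpow_nonneg hn.le _)]

theorem exists_rmsError_le {d : ℕ} (hd : 1 ≤ d) {α : ℝ} (hα : 1 / 2 < α) {γ : ℕ → ℝ}
    (hγ : ∀ j, 0 < γ j) {t : ℝ} (ht0 : 0 < t) (ht1 : t < 1) {τ : ℝ} (hτ : 0 < τ) :
    ∃ D : ℝ, 0 < D ∧ ∀ N : ℕ, N.Prime → ∀ g : Fin d → ℤ, IsGeneratingVector α γ N g →
      ∀ f : (Fin d → ℝ) → ℝ, MemCosineSpace α γ f →
      ∀ u : (Fin d → ℝ) → ℝ, IsWeakNeumannSolution f u →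
      rmsError α γ t N g f u ≤
        ENNReal.ofReal (D / Real.pi ^ 2 * (N : ℝ) ^ (-α + τ) * cosineNorm α γ f) := by
  obtain ⟨K, -, hshifts⟩ := exists_shifts_good hd hα hγ ht0 ht1
  obtain ⟨q, hq, hq1, -⟩ := exists_exponent hα hτ
  obtain ⟨c, hc, hMc⟩ := exists_le_truncM (d := d) (by linarith : 0 < α) hγ hq
  set κ : ℝ := min (1 - t) (1 / 2048) with hκ
  have hκ0 : 0 < κ := lt_min (by linarith) (by norm_num)
  refine ⟨√(κ⁻¹ + 1) * c⁻¹, by positivity, fun N hN g hg f hf u hu => ?_⟩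
  have : NeZero N := ⟨hN.ne_zero⟩
  have hN1 : (1 : ℝ) ≤ N := by exact_mod_cast hN.one_le
  have hN0 : (0 : ℝ) < N := by linarith
  obtain ⟨hY, -, hst⟩ := hshifts N hN g hg
  have hn : 0 ≤ cosineNorm α γ f := Real.sqrt_nonneg _
  have hM := truncM_pos (d := d) hα hγ hN.one_le
  refine (rmsError_le hα hγ hf hu hM hκ0 hY hst).trans (ENNReal.ofReal_le_ofReal ?_)
  have h1 : (truncM d α γ N)⁻¹ ≤ c⁻¹ * (N : ℝ) ^ (-α + τ) := by
    have h2 : (N : ℝ) ^ (α - τ) ≤ (N : ℝ) ^ (1 / q) :=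
      Real.rpow_le_rpow_of_exponent_le hN1 hq1
    have h3 : c * (N : ℝ) ^ (α - τ) ≤ truncM d α γ N :=
      (mul_le_mul_of_nonneg_left h2 hc.le).trans (hMc N hN.one_le)
    rw [show -α + τ = -(α - τ) by ring, Real.rpow_neg hN0.le, ← mul_inv]
    exact inv_anti₀ (by positivity) h3
  calc _ ≤ √(κ⁻¹ + 1) / Real.pi ^ 2 * (c⁻¹ * (N : ℝ) ^ (-α + τ)) * cosineNorm α γ f := by
        gcongr
    _ = _ := by ring

/-- The squared aliasing part is at most of order `|A| W`, with `|A| = O(N^(αq))` and `W =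
O(M^(q-2-1/α))`. Both this and the truncation part have the desired rate for the exponent of
`exists_exponent`. -/
theorem exists_supError_le {d : ℕ} (hd : 1 ≤ d) {α : ℝ} (hα : 1 / 2 < α) {γ : ℕ → ℝ}
    (hγ : ∀ j, 0 < γ j) {t : ℝ} (ht0 : 0 < t) (ht1 : t < 1) {τ : ℝ} (hτ : 0 < τ) :
    ∃ D : ℝ, 0 < D ∧ ∀ N : ℕ, N.Prime → ∀ g : Fin d → ℤ, IsGeneratingVector α γ N g →
      ∀ f : (Fin d → ℝ) → ℝ, MemCosineSpace α γ f →
      ∀ u : (Fin d → ℝ) → ℝ, IsWeakNeumannSolution f u →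
      supError α γ t N g f u ≤
        ENNReal.ofReal (D / Real.pi ^ 2 * (N : ℝ) ^ (-α + 1 / 2 + τ) * cosineNorm α γ f) := by
  have hα0 : 0 < α := by linarith
  obtain ⟨K, -, hshifts⟩ := exists_shifts_good hd hα hγ ht0 ht1
  obtain ⟨q, hq, hq1, hq2⟩ := exists_exponent hα hτ
  obtain ⟨c, hc, hMc⟩ := exists_le_truncM (d := d) hα0 hγ hq
  obtain ⟨hαq, hq0⟩ := one_lt_mul_of_mem hα0 hq
  obtain ⟨KA, hKA, hcard⟩ := card_cross_le d hα0 hγ hq0 hαq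
  obtain ⟨c', hc', hc'1, hdual⟩ := exists_truncM_le_rWeight d hα hγ
  obtain ⟨KW, hKW, htail⟩ := tsum_wgt_separated_le d hα0 hγ hc' hc'1 hαq hq.2
  set κ : ℝ := min (1 - t) (1 / 2048) with hκ
  have hκ0 : 0 < κ := lt_min (by linarith) (by norm_num)
  set e : ℝ := q - 2 - 1 / α with he
  have he0 : e ≤ 0 := by
    have : 0 < 1 / α := by positivity
    linarith [hq.2]
  set T : ℝ := ∑' h : Fin d → ℤ, rWeight α γ h ^ (-q) with hT
  have hT0 : 0 ≤ T := tsum_nonneg fun h => Real.rpow_nonneg (rWeight_pos α γ h).le _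
  set C1 : ℝ := KA * (κ⁻¹ * (KW * c ^ e)) with hC1
  set C2 : ℝ := T * c ^ (q - 2) with hC2
  have hC1p : 0 < C1 := by positivity
  have hC2p : 0 ≤ C2 := by positivity
  refine ⟨√2 ^ d * (√C1 + √C2), by positivity, fun N hN g hg f hf u hu => ?_⟩
  have : NeZero N := ⟨hN.ne_zero⟩
  have hN1 : (1 : ℝ) ≤ N := by exact_mod_cast hN.one_le
  have hN0 : (0 : ℝ) < N := by linarith
  obtain ⟨hY, -, hst⟩ := hshifts N hN g hg
  have hn : 0 ≤ cosineNorm α γ f := Real.sqrt_nonneg _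
  have hM := truncM_pos (d := d) hα hγ hN.one_le
  set M := truncM d α γ N with hMdef
  -- Negative powers of `M` are bounded through the lower bound `c N^(1/q)`.
  have hMlow : ∀ x ≤ 0, M ^ x ≤ c ^ x * (N : ℝ) ^ (x / q) := by
    intro x hx
    refine (Real.rpow_le_rpow_of_nonpos (by positivity) (hMc N hN.one_le) hx).trans (le_of_eq ?_)
    rw [Real.mul_rpow hc.le (by positivity), ← Real.rpow_mul hN0.le, one_div_mul_eq_div]
  have hW : ∀ r : ZMod N, ∑' h, Set.indicator {h | (idot h g : ZMod N) = r ∧ M ≤ rWeight α γ h}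
      (wgt α γ 2) h ≤ ENNReal.ofReal (KW * M ^ e) := by
    classical
    intro r
    refine htail M hM _ (fun _ => inferInstance) (fun x hx y hy hlt => ?_) fun h hh => hh.2
    exact fiber_separated (hdual N hN g hg)
      ((ZMod.intCast_eq_intCast_iff _ _ _).mp (hx.1.trans hy.1.symm)) hlt
  have hsum := (tsum_fourierErr_le hα hγ hf hM hκ0 hY 0 hst (by positivity) hW hαq hq.2).2
  refine (supError_le hα hγ hf hu hsum).trans (ENNReal.ofReal_le_ofReal ?_)
  have h1 : √((cross d α γ M).card * (κ⁻¹ * (KW * M ^ e))) ≤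
      √C1 * (N : ℝ) ^ (-α + 1 / 2 + τ) := by
    refine sqrt_le_sqrt_mul_rpow hC1p.le hN0 ?_
    have hA : ((cross d α γ M).card : ℝ) ≤ KA * (N : ℝ) ^ (α * q) := by
      refine (hcard M hM).trans ?_
      rw [Real.rpow_mul hN0.le]
      gcongr
      exact truncM_le hα hγ hN.one_le
    calc _ ≤ KA * (N : ℝ) ^ (α * q) * (κ⁻¹ * (KW * (c ^ e * (N : ℝ) ^ (e / q)))) := by
          gcongr
          exact hMlow e he0
      _ = C1 * (N : ℝ) ^ (α * q + e / q) := by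
          rw [Real.rpow_add hN0, hC1]
          ring
      _ ≤ C1 * (N : ℝ) ^ (2 * (-α + 1 / 2 + τ)) :=
          mul_le_mul_of_nonneg_left (Real.rpow_le_rpow_of_exponent_le hN1 hq2) hC1p.le
  have h2 : √(T * M ^ (q - 2)) ≤ √C2 * (N : ℝ) ^ (-α + 1 / 2 + τ) := by
    refine sqrt_le_sqrt_mul_rpow hC2p hN0 ?_
    calc _ ≤ T * (c ^ (q - 2) * (N : ℝ) ^ ((q - 2) / q)) :=
          mul_le_mul_of_nonneg_left (hMlow _ (by linarith [hq.2])) hT0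
      _ = C2 * (N : ℝ) ^ ((q - 2) / q) := by rw [hC2, mul_assoc]
      _ ≤ C2 * (N : ℝ) ^ (2 * (-α + 1 / 2 + τ)) := by
          refine mul_le_mul_of_nonneg_left (Real.rpow_le_rpow_of_exponent_le hN1 ?_) hC2p
          rw [sub_div, div_self hq0.ne', show 2 / q = 2 * (1 / q) by ring]
          linarith
  calc _ ≤ √2 ^ d / Real.pi ^ 2 * ((√C1 * (N : ℝ) ^ (-α + 1 / 2 + τ) +
        √C2 * (N : ℝ) ^ (-α + 1 / 2 + τ)) * cosineNorm α γ f) := by gcongr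
    _ = _ := by ring

/-- A positive power of `n` outweighs any negative power of the logarithm. This serves large `τ`,
where the rate in `N_tot` no longer decays. -/
theorem exists_le_logRate (a : ℝ) {b : ℝ} (hb : 0 < b) :
    ∃ c : ℝ, 0 < c ∧ ∀ n : ℕ, 2 ≤ n → c ≤ logRate n a b := by
  have hl2 : 0 < Real.log 2 := Real.log_pos one_lt_two
  rcases le_or_gt 0 a with ha | ha
  · refine ⟨Real.log 2 ^ a, by positivity, fun n hn => ?_⟩
    have hn2 : (2 : ℝ) ≤ n := by exact_mod_cast hn
    have h1 : Real.log 2 ≤ Real.log n := Real.log_le_log two_pos hn2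
    calc Real.log 2 ^ a = Real.log 2 ^ a * 1 := (mul_one _).symm
      _ ≤ Real.log n ^ a * (n : ℝ) ^ b :=
          mul_le_mul (Real.rpow_le_rpow hl2.le h1 ha)
            (Real.one_le_rpow (by linarith) hb.le) zero_le_one
            (Real.rpow_nonneg (hl2.le.trans h1) _)
  · set ε := b / (-a) with hε
    have hε0 : 0 < ε := div_pos hb (by linarith)
    refine ⟨ε⁻¹ ^ a, by positivity, fun n hn => ?_⟩
    have hn2 : (2 : ℝ) ≤ n := by exact_mod_cast hn
    have hn0 : (0 : ℝ) < n := by linarith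
    have hln : 0 < Real.log n := Real.log_pos (by linarith)
    have h1 : Real.log n ≤ (n : ℝ) ^ ε / ε := Real.log_le_rpow_div hn0.le hε0
    have h2 := Real.rpow_le_rpow_of_nonpos hln h1 ha.le
    rw [div_eq_mul_inv, Real.mul_rpow (by positivity) (by positivity), ← Real.rpow_mul hn0.le,
      show ε * a = -b by rw [hε]; field_simp [ha.ne], Real.rpow_neg hn0.le] at h2
    have h3 : (0 : ℝ) < (n : ℝ) ^ b := by positivity
    rw [logRate]
    calc ε⁻¹ ^ a = ((n : ℝ) ^ b)⁻¹ * ε⁻¹ ^ a * (n : ℝ) ^ b := by field_simp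
      _ ≤ _ := mul_le_mul_of_nonneg_right h2 h3.le

/-- Comparison of the rates in the number of lattice points and in the total number of function
evaluations. -/
theorem exists_logRate_comparison {d : ℕ} (hd : 1 ≤ d) {α : ℝ} (hα : 1 / 2 < α) {γ : ℕ → ℝ}
    (hγ : ∀ j, 0 < γ j) {t : ℝ} (ht0 : 0 < t) (ht1 : t < 1) (b : ℝ) :
    ∃ c : ℝ, 0 < c ∧ ∀ N : ℕ, N.Prime → ∀ g : Fin d → ℤ, IsGeneratingVector α γ N g →
      c * (N : ℝ) ^ min b 0 ≤ logRate N (((d : ℝ) - 1) / 2) b ∧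
      c * (N : ℝ) ^ min b 0 ≤
        logRate (Ntot α γ t N g) (-(2 * d * b) + ((d : ℝ) - 1) / 2) b ∧
      (b ≤ 0 → c * logRate N (((d : ℝ) - 1) / 2) b ≤
        logRate (Ntot α γ t N g) (-(2 * d * b) + ((d : ℝ) - 1) / 2) b) := by
  obtain ⟨K, hK, hshifts⟩ := exists_shifts_good hd hα hγ ht0 ht1
  have hl2 : 0 < Real.log 2 := Real.log_pos one_lt_two
  have hd1 : (1 : ℝ) ≤ d := by exact_mod_cast hd
  set e : ℝ := ((d : ℝ) - 1) / 2 with he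
  have he0 : 0 ≤ e := by
    rw [he]
    linarith
  have hlog : ∀ N : ℕ, N.Prime → Real.log 2 ^ e * (N : ℝ) ^ b ≤ logRate N e b := by
    intro N hN
    have h1 : Real.log 2 ≤ Real.log N := Real.log_le_log two_pos (by exact_mod_cast hN.two_le)
    exact mul_le_mul_of_nonneg_right (Real.rpow_le_rpow hl2.le h1 he0) (by positivity)
  rcases le_or_gt b 0 with hb | hb
  -- With at most `K (log N)^(2d)` shifts and `b ≤ 0`, the factor `S^b` costs at most `K^b (log
  -- N)^(2db)`; the extra `-2db` in the exponent of the logarithm restores this.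
  · have hcmp : ∀ N : ℕ, N.Prime → ∀ g : Fin d → ℤ, IsGeneratingVector α γ N g →
        K ^ b * logRate N e b ≤ logRate (Ntot α γ t N g) (-(2 * d * b) + e) b := by
      intro N hN g hg
      obtain ⟨hS1, hS2, -⟩ := hshifts N hN g hg
      set S := (shifts α γ t N g).length with hS
      have hN2 : (2 : ℝ) ≤ N := by exact_mod_cast hN.two_le
      have hS1' : (1 : ℝ) ≤ S := by exact_mod_cast hS1
      have hL : 0 < Real.log N := Real.log_pos (by linarith)
      have hNtot : ((Ntot α γ t N g : ℕ) : ℝ) = N * S := by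
        rw [Ntot, ← hS]
        push_cast
        rfl
      have ha0 : 0 ≤ -(2 * d * b) + e := by
        have : 0 ≤ 2 * (d : ℝ) * (-b) := by
          have : 0 ≤ -b := by linarith
          positivity
        linarith
      have h1 : Real.log N ^ (-(2 * d * b) + e) ≤
          Real.log (N * S) ^ (-(2 * d * b) + e) := by
        refine Real.rpow_le_rpow hL.le (Real.log_le_log (by linarith) ?_) ha0
        exact le_mul_of_one_le_right (by linarith) hS1'
      have h2 : K ^ b * Real.log N ^ (2 * d * b) ≤ (S : ℝ) ^ b := by
        refine le_trans (le_of_eq ?_) (Real.rpow_le_rpow_of_nonpos (by linarith) hS2 hb)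
        rw [Real.mul_rpow hK.le (by positivity), ← Real.rpow_natCast, ← Real.rpow_mul hL.le]
        push_cast
        rfl
      rw [logRate, logRate, hNtot, Real.mul_rpow (by linarith) (by linarith)]
      calc K ^ b * (Real.log N ^ e * (N : ℝ) ^ b) =
            Real.log N ^ (-(2 * d * b) + e) * ((N : ℝ) ^ b *
              (K ^ b * Real.log N ^ (2 * d * b))) := by
            have h3 : Real.log N ^ e =
                Real.log N ^ (-(2 * d * b) + e) * Real.log N ^ (2 * d * b) := by
              rw [← Real.rpow_add hL]
              congr 1
              ring
            rw [h3]
            ring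
        _ ≤ _ := by
            gcongr
            exact (Real.rpow_nonneg hL.le _).trans h1
    refine ⟨min (Real.log 2 ^ e) (min (K ^ b) (K ^ b * Real.log 2 ^ e)), by positivity,
      fun N hN g hg => ?_⟩
    set c := min (Real.log 2 ^ e) (min (K ^ b) (K ^ b * Real.log 2 ^ e)) with hc
    have hc1 : c ≤ Real.log 2 ^ e := min_le_left _ _
    have hc2 : c ≤ K ^ b := (min_le_right _ _).trans (min_le_left _ _)
    have hc3 : c ≤ K ^ b * Real.log 2 ^ e := (min_le_right _ _).trans (min_le_right _ _)
    have hNb : (0 : ℝ) ≤ (N : ℝ) ^ b := by positivity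
    have hr : 0 ≤ logRate N e b := by
      refine le_trans ?_ (hlog N hN)
      positivity
    rw [min_eq_left hb]
    refine ⟨(mul_le_mul_of_nonneg_right hc1 hNb).trans (hlog N hN), ?_,
      fun _ => (mul_le_mul_of_nonneg_right hc2 hr).trans (hcmp N hN g hg)⟩
    refine (mul_le_mul_of_nonneg_right hc3 hNb).trans ?_
    rw [mul_assoc]
    exact (mul_le_mul_of_nonneg_left (hlog N hN) (by positivity)).trans (hcmp N hN g hg)
  -- For `b > 0` only a constant has to be dominated.
  · obtain ⟨c, hc, hlow⟩ := exists_le_logRate (-(2 * d * b) + e) hb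
    refine ⟨min c (Real.log 2 ^ e), by positivity, fun N hN g hg => ?_⟩
    have hN1 : (1 : ℝ) ≤ N := by exact_mod_cast hN.one_le
    rw [min_eq_right hb.le, Real.rpow_zero, mul_one]
    refine ⟨(min_le_right _ _).trans (le_trans ?_ (hlog N hN)),
      (min_le_left _ _).trans (hlow _ ?_), fun h => absurd hb (not_lt.mpr h)⟩
    · exact le_mul_of_one_le_right (by positivity) (Real.one_le_rpow hN1 hb.le)
    · rw [Ntot]
      exact hN.two_le.trans (Nat.le_mul_of_pos_right N (hshifts N hN g hg).1)

end

end LatticeNeumann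

/-! ### Assembly of the error bounds and choice of the constants -/

theorem theorem7p3 (d : ℕ) (hd : 1 ≤ d) (α : ℝ) (hα : 1 / 2 < α)
    (γ : ℕ → ℝ) (hγ : ∀ j, 0 < γ j) (t : ℝ) (ht0 : 0 < t) (ht1 : t < 1)
    (τ : ℝ) (hτ0 : 0 < τ) (hτ1 : τ ≤ 1) :
    ∃ C C' : ℝ, 0 < C ∧ 0 < C' ∧
      ∀ N : ℕ, N.Prime → ∀ g : Fin d → ℤ, IsGeneratingVector α γ N g →
        -- the bound in `N` is at most the bound in `N_tot`
        (τ ≤ α →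
          C * logRate N (((d : ℝ) - 1) / 2) (-α + τ) ≤
            C' * logRate (Ntot α γ t N g) ((2 * α - 2 * τ + 1 / 2) * d - 1 / 2) (-α + τ)) ∧
        (τ ≤ α - 1 / 2 →
          C * logRate N (((d : ℝ) - 1) / 2) (-α + 1 / 2 + τ) ≤
            C' * logRate (Ntot α γ t N g) ((2 * α - 2 * τ - 1 / 2) * d - 1 / 2)
              (-α + 1 / 2 + τ)) ∧
        ∀ f : (Fin d → ℝ) → ℝ, MemCosineSpace α γ f →
          ∀ u : (Fin d → ℝ) → ℝ, IsWeakNeumannSolution f u →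
            -- root-mean-square `L₂` error
            rmsError α γ t N g f u ≤ ENNReal.ofReal
              (C / Real.pi ^ 2 * logRate N (((d : ℝ) - 1) / 2) (-α + τ) * cosineNorm α γ f) ∧
            rmsError α γ t N g f u ≤ ENNReal.ofReal
              (C' / Real.pi ^ 2 *
                logRate (Ntot α γ t N g) ((2 * α - 2 * τ + 1 / 2) * d - 1 / 2) (-α + τ) *
                cosineNorm α γ f) ∧
            -- worst-case `L_∞` error
            supError α γ t N g f u ≤ ENNReal.ofReal
              (C / Real.pi ^ 2 * logRate N (((d : ℝ) - 1) / 2) (-α + 1 / 2 + τ) *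
                cosineNorm α γ f) ∧
            supError α γ t N g f u ≤ ENNReal.ofReal
              (C' / Real.pi ^ 2 *
                logRate (Ntot α γ t N g) ((2 * α - 2 * τ - 1 / 2) * d - 1 / 2)
                  (-α + 1 / 2 + τ) *
                cosineNorm α γ f) := by
  -- Capping `τ` at `α` turns the exponent `-α + τ` into its minimum with `0`. So for `τ > α` the
  -- errors are bounded by a constant, and the rate in `N_tot` need not be monotone in `N`.
  obtain ⟨D₁, hD₁, hrms⟩ := exists_rmsError_le hd hα hγ ht0 ht1
    (lt_min hτ0 (by linarith) : 0 < min τ α)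
  obtain ⟨D₂, hD₂, hsup⟩ := exists_supError_le hd hα hγ ht0 ht1
    (lt_min hτ0 (by linarith) : 0 < min τ (α - 1 / 2))
  obtain ⟨c₁, hc₁, hcmp₁⟩ := exists_logRate_comparison hd hα hγ ht0 ht1 (-α + τ)
  obtain ⟨c₂, hc₂, hcmp₂⟩ := exists_logRate_comparison hd hα hγ ht0 ht1 (-α + 1 / 2 + τ)
  have hb₁ : -α + min τ α = min (-α + τ) 0 := by
    rw [← min_add_add_left, neg_add_cancel]
  have hb₂ : -α + 1 / 2 + min τ (α - 1 / 2) = min (-α + 1 / 2 + τ) 0 := by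
    rw [← min_add_add_left, show -α + 1 / 2 + (α - 1 / 2) = 0 by ring]
  -- The stated powers of `log N_tot` are exactly those that offset the number of shifts.
  have ha₁ : -(2 * d * (-α + τ)) + ((d : ℝ) - 1) / 2 =
      (2 * α - 2 * τ + 1 / 2) * d - 1 / 2 := by ring
  have ha₂ : -(2 * d * (-α + 1 / 2 + τ)) + ((d : ℝ) - 1) / 2 =
      (2 * α - 2 * τ - 1 / 2) * d - 1 / 2 := by ring
  rw [ha₁] at hcmp₁
  rw [ha₂] at hcmp₂
  rw [hb₁] at hrms
  rw [hb₂] at hsup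
  set C := D₁ / c₁ + D₂ / c₂ with hC
  -- The summand `C` makes `C'` suitable for the error bounds; the other two are for the comparison
  -- of the rates.
  set C' := C + C / c₁ + C / c₂ with hC'
  have hC0 : 0 < C := by positivity
  have hle : ∀ {D c B x y : ℝ}, 0 ≤ D → 0 < c → 0 ≤ x → c * x ≤ y → D / c ≤ B →
      D * x ≤ B * y := by
    intro D c B x y hD hc hx hxy hB
    have hy : 0 ≤ y := le_trans (by positivity) hxy
    calc D * x = D / c * (c * x) := by field_simp
      _ ≤ D / c * y := mul_le_mul_of_nonneg_left hxy (by positivity)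
      _ ≤ B * y := mul_le_mul_of_nonneg_right hB hy
  have hD₁C : D₁ / c₁ ≤ C := le_add_of_nonneg_right (by positivity)
  have hD₂C : D₂ / c₂ ≤ C := le_add_of_nonneg_left (by positivity)
  have hCC' : C ≤ C' := by
    rw [hC', add_assoc]
    exact le_add_of_nonneg_right (by positivity)
  have hC₁ : C / c₁ ≤ C' := by
    have : 0 < C / c₂ := by positivity
    linarith
  have hC₂ : C / c₂ ≤ C' := by
    have : 0 < C / c₁ := by positivity
    linarith
  refine ⟨C, C', hC0, by positivity, fun N hN g hg => ?_⟩
  obtain ⟨h11, h12, h13⟩ := hcmp₁ N hN g hg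
  obtain ⟨h21, h22, h23⟩ := hcmp₂ N hN g hg
  have hN0 : ∀ x : ℝ, 0 ≤ (N : ℝ) ^ x := fun x => by positivity
  have hrate : ∀ {c x y : ℝ}, 0 < c → c * (N : ℝ) ^ x ≤ y → 0 ≤ y := fun hc h =>
    le_trans (mul_nonneg hc.le (hN0 _)) h
  refine ⟨fun hτ => hle hC0.le hc₁ (hrate hc₁ h11) (h13 (by linarith)) hC₁,
    fun hτ => hle hC0.le hc₂ (hrate hc₂ h21) (h23 (by linarith)) hC₂, fun f hf u hu => ?_⟩
  have hn : 0 ≤ cosineNorm α γ f := Real.sqrt_nonneg _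
  have hmono : ∀ {D B x y : ℝ}, D * x ≤ B * y →
      ENNReal.ofReal (D / Real.pi ^ 2 * x * cosineNorm α γ f) ≤
        ENNReal.ofReal (B / Real.pi ^ 2 * y * cosineNorm α γ f) := by
    intro D B x y h
    refine ENNReal.ofReal_le_ofReal (mul_le_mul_of_nonneg_right ?_ hn)
    rw [div_mul_eq_mul_div, div_mul_eq_mul_div]
    gcongr
  have h1 := hrms N hN g hg f hf u hu
  have h2 := hsup N hN g hg f hf u hu
  exact ⟨h1.trans (hmono (hle hD₁.le hc₁ (hN0 _) h11 hD₁C)),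
    h1.trans (hmono (hle hD₁.le hc₁ (hN0 _) h12 (hD₁C.trans hCC'))),
    h2.trans (hmono (hle hD₂.le hc₂ (hN0 _) h21 hD₂C)),
    h2.trans (hmono (hle hD₂.le hc₂ (hN0 _) h22 (hD₂C.trans hCC')))⟩
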